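/- Let $H=(t_1^n,\ldots,t_r^n,S(\underline t))$ be a quasi-ordinary (q.o.) parameterization. That is, $n\ge 1$, $S\in\mathbb{C}\{\underline t\}=\mathbb C\{t_1,\dots,t_r\}$ is a nonunit with exactly $n$ distinct conjugates $S(\omega_1t_1,\ldots,\omega_rt_r)$ ($\omega_i^n=1$), and every difference of two distinct conjugates is a monomial times a unit. The exponents $\lambda_1\prec\cdots\prec\lambda_g$ of these monomials are the generalized characteristic exponents, where $\preceq$ is the product order on $\mathbb{N}^r$. Write $\lambda_k=(\lambda_{k1},\ldots,\lambda_{kr})$. Suppose that $g\ge 1$ and that $H$ is normalized: (1) $S=u\,\underline t^{\lambda_1}$ with $u(0)=1$, so that $S=\underline t^{\lambda_1}+\sum_{\delta\succ\lambda_1}b_\delta\underline t^\delta$; (2) $(\lambda_{1i},\ldots,\lambda_{gi})\ge_{lex}(\lambda_{1j},\ldots,\lambda_{gj})$ for $i<j$; (3) if $\lambda_1=(\lambda_{11},0,\ldots,0)$, then $\lambda_{11}>n$. A series $q\neq 0$ has dominant exponent $\gamma$ if $q=\underline t^\gamma$ times a unit. Let $\Gamma\subseteq\mathbb N^r$ be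 the associated semigroup of $H$, that is, the set of dominant exponents of those series $h(t_1^n,\ldots,t_r^n,S(\underline t))$, $h\in\mathbb{C}\{X_1,\ldots,X_{r+1}\}$, that have one. Put $\nu_i=n\theta_i$, where $\theta_i$ is the $i$-th standard basis vector. Let $\widetilde{\mathcal A}_1$ be the set of pairs $(\sigma,\rho)$ of analytic isomorphisms of $(\mathbb C^{r+1},0)$ and $(\mathbb C^r,0)$ of the form $$\rho_i=t_i(c_i+\zeta_i),\quad \sigma_i=a_iX_i+X_i\epsilon_i+X_{r+1}\eta_i\ (1\le i\le r),\quad \sigma_{r+1}=a_{r+1}X_{r+1}+X_{r+1}\epsilon_{r+1}+\underline X^{\alpha}\eta_{r+1},$$ where $\alpha_i=\lceil\lambda_{1i}/n\rceil$, the constants $a_i,a_{r+1},c_i$ are nonzero, $\zeta_i,\epsilon_i,\epsilon_{r+1}$ vanish at $0$, and $\eta_i=0$ if $n>\lambda_{1i}$, and whose $1$-jets are $j^1\sigma=(X_1+d_1X_{r+1},\ldots,X_r+d_rX_{r+1},X_{r+1})$, with $d_i=0$ if $n>\lambda_{1i}$, and $j^1\rho=\underline t$. Two parameterizations $H,H'$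 are $\widetilde{\mathcal A}_1$-equivalent if $H'=\sigma\circ H\circ\rho^{-1}$ for some $(\sigma,\rho)\in\widetilde{\mathcal A}_1$. (a) Let $\gamma\succ\lambda_1$ with $b_\gamma\ne0$ and $$\gamma\in\Gamma\cup\bigcup_{1\le i\le r,\ \lambda_{1i}\ge n}(\Gamma+2\lambda_1-\nu_i).$$ Then $\underline t^\gamma$ is eliminable by the $\widetilde{\mathcal A}_1$-action: there is a q.o. parameterization $H'=(t_1^n,\ldots,t_r^n,\sum_{\delta\succeq\lambda_1}c_\delta\underline t^\delta)$ with the same characteristic exponents, $\widetilde{\mathcal A}_1$-equivalent to $H$, such that $c_\gamma=0$ and $c_\delta=b_\delta$ for all $\delta\neq\gamma$ with $\delta\not\succ\gamma$ (with $b_{\lambda_1}=1$). (b) $H$ is formally equivalent to a quasi-short parameterization. That is, there are q.o. parameterizations $H=H_0,H_1,H_2,\ldots$ with the same characteristic exponents and $(\sigma^{(k)},\rho^{(k)})\in\widetilde{\mathcal A}_1$ with $H_{k+1}=\sigma^{(k)}\circ H_k\circ(\rho^{(k)})^{-1}$, such that, coefficientwise (each coefficient being eventually constant), the $H_k$ converge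 to some formal $H'=(t_1^n,\ldots,t_r^n,S')$ and the compositions $(\sigma^{(k)}\circ\cdots\circ\sigma^{(0)},\ \rho^{(k)}\circ\cdots\circ\rho^{(0)})$ converge to a pair $(\hat\sigma,\hat\rho)$ of formal power series maps which satisfies the conditions defining $\widetilde{\mathcal A}_1$ with formal instead of convergent power series and for which $H'=\hat\sigma\circ H\circ\hat\rho^{-1}$. Moreover $H'$ is a normalized formal q.o. parameterization (the same definition, with $S'$ a formal power series) with the same characteristic exponents, and no exponent of $S'-\underline t^{\lambda_1}$ lies in $\Gamma'\cup\bigcup_{\lambda_{1i}\ge n}(\Gamma'+2\lambda_1-\nu_i)$, where $\Gamma'$ is the associated semigroup of $H'$. -/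

import Mathlib

noncomputable section

namespace QuasiOrdinary

open MvPowerSeries

/-- The ring of formal power series over the complex numbers in `k` variables. -/
abbrev Ser (k : ℕ) : Type := MvPowerSeries (Fin k) ℂ

/-- The power series converges absolutely on some polydisc around the origin,
i.e. it is an element of the ring of convergent power series. -/
def IsConvergent {k : ℕ} (f : Ser k) : Prop :=
  ∃ ε : ℝ, 0 < ε ∧ Summable fun m : Fin k →₀ ℕ => ‖coeff m f‖ * ε ^ m.degree

/-- `γ` is the dominant exponent of `q`: the Newton polyhedron of `q` is `γ + ℝ₊ᵏ` (its only
vertex is `γ`). Equivalently, `q` is the monomial `t^γ` times a unit. -/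
def IsDominantExponent {k : ℕ} (q : Ser k) (γ : Fin k →₀ ℕ) : Prop :=
  coeff γ q ≠ 0 ∧ ∀ δ : Fin k →₀ ℕ, coeff δ q ≠ 0 → γ ≤ δ

/-- The map germ `H = (t₁ⁿ, …, t_rⁿ, S(t))`, given by its `r + 1` components. The coordinates
`X₁, …, X_r` have indices `Fin.castSucc i` and `X_{r+1}` has index `Fin.last r`. -/
def param {r : ℕ} (n : ℕ) (S : Ser r) : Fin (r + 1) → Ser r :=
  Fin.snoc (α := fun _ => Ser r) (fun i : Fin r => (X i : Ser r) ^ n) S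

/-- The homomorphism `H^*`: `h(X₁, …, X_{r+1}) ↦ h(t₁ⁿ, …, t_rⁿ, S(t))`. -/
def pullback {r : ℕ} (n : ℕ) (S : Ser r) (h : Ser (r + 1)) : Ser r :=
  subst (param n S) h

/-! ### Quasi-ordinary parameterizations -/

/-- The conjugates `S(ω₁ t₁, …, ω_r t_r)`, `ω_iⁿ = 1`, of `S`. With `t_i = X_i^{1/n}` they are the
roots, over the ring of power series in `X₁, …, X_r`, of the minimal polynomial of
`S(X₁^{1/n}, …, X_r^{1/n})`. -/
def conjugates {r : ℕ} (n : ℕ) (S : Ser r) : Set (Ser r) :=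
  {T | ∃ ω : Fin r → ℂ, (∀ i, ω i ^ n = 1) ∧ T = rescale ω S}

/-- The set of generalized characteristic exponents: the dominant exponents of the differences of
two distinct conjugates. -/
def charExponents {r : ℕ} (n : ℕ) (S : Ser r) : Set (Fin r →₀ ℕ) :=
  {l | ∃ T ∈ conjugates n S, ∃ T' ∈ conjugates n S, T ≠ T' ∧ IsDominantExponent (T - T') l}

/-- `(t₁ⁿ, …, t_rⁿ, S(t))` is a (possibly formal) quasi-ordinary parameterization with generalized
characteristic exponents `lam 0 ≺ lam 1 ≺ ⋯ ≺ lam (g - 1)`: `S` is a nonunit, its minimal polynomial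
(the product of `X_{r+1} - T` over the conjugates `T`) has degree `n`, and the discriminant of this
polynomial is a monomial times a unit, that is, every difference of two distinct roots is so. -/
structure IsFormalQOParam {r g : ℕ} (n : ℕ) (lam : Fin g → Fin r →₀ ℕ) (S : Ser r) : Prop where
  pos : 0 < n
  nonunit : constantCoeff S = 0
  degree : (conjugates n S).ncard = n
  quasiOrdinary : ∀ T ∈ conjugates n S, ∀ T' ∈ conjugates n S, T ≠ T' →
    ∃ l, IsDominantExponent (T - T') l
  strictMono : StrictMono lam
  range_eq : Set.range lam = charExponents n S

/-- An (analytic) quasi-ordinary parameterization: `S` is a convergent power series. -/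
def IsQOParam {r g : ℕ} (n : ℕ) (lam : Fin g → Fin r →₀ ℕ) (S : Ser r) : Prop :=
  IsFormalQOParam n lam S ∧ IsConvergent S

/-- The quasi-ordinary parameterization is normalized; `lam 0` is the first characteristic
exponent `λ₁`.
* `monic`, `dominant`: `S = u · t^{λ₁}` with `u(0) = 1`;
* `lex`: `(λ_{1j}, …, λ_{gj}) ≤_lex (λ_{1i}, …, λ_{gi})` for `i < j`;
* `large`: if `λ₁ = (λ₁₁, 0, …, 0)`, then `λ₁₁ > n`. -/
structure IsFormalNormalized {r g : ℕ} [NeZero g] (n : ℕ) (lam : Fin g → Fin r →₀ ℕ)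
    (S : Ser r) : Prop where
  isFormalQOParam : IsFormalQOParam n lam S
  monic : coeff (lam 0) S = 1
  dominant : IsDominantExponent S (lam 0)
  lex : ∀ i j : Fin r, i < j → toLex (fun k => lam k j) ≤ toLex (fun k => lam k i)
  large : ∀ i : Fin r, (i : ℕ) = 0 → (∀ j : Fin r, j ≠ i → lam 0 j = 0) → n < lam 0 i

/-- A normalized (analytic) quasi-ordinary parameterization. -/
def IsNormalized {r g : ℕ} [NeZero g] (n : ℕ) (lam : Fin g → Fin r →₀ ℕ) (S : Ser r) : Prop :=
  IsFormalNormalized n lam S ∧ IsConvergent S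

/-- The associated semigroup `Γ` of `H = (t₁ⁿ, …, t_rⁿ, S(t))`: all dominant exponents of series
`H^*(h)`, with `h` a convergent power series in `X₁, …, X_{r+1}`. -/
def assocSemigroup {r : ℕ} (n : ℕ) (S : Ser r) : Set (Fin r →₀ ℕ) :=
  {γ | ∃ h : Ser (r + 1), IsConvergent h ∧ IsDominantExponent (pullback n S h) γ}

/-- The set `Γ ∪ ⋃_{λ_{1i} ≥ n} (Γ + 2λ₁ - ν_i)`, where `ν_i` is `n` times the `i`-th
standard basis vector and `l` stands for `λ₁`. -/
def eliminationSet {r : ℕ} (n : ℕ) (l : Fin r →₀ ℕ) (S : Ser r) : Set (Fin r →₀ ℕ) :=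
  assocSemigroup n S ∪
    ⋃ (i : Fin r) (_ : n ≤ l i),
      {γ | ∃ δ ∈ assocSemigroup n S, γ + Finsupp.single i n = δ + 2 • l}

/-- A (possibly formal) quasi-short parameterization: it is normalized and no exponent of
`S - t^{λ₁}` lies in `Γ ∪ ⋃_{λ_{1i} ≥ n} (Γ + 2λ₁ - ν_i)`. -/
def IsFormalQuasiShort {r g : ℕ} [NeZero g] (n : ℕ) (lam : Fin g → Fin r →₀ ℕ)
    (S : Ser r) : Prop :=
  IsFormalNormalized n lam S ∧
    ∀ γ, coeff γ (S - monomial (lam 0) 1) ≠ 0 → γ ∉ eliminationSet n (lam 0) S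

/-! ### Changes of coordinates -/

/-- `f` is a formal automorphism of affine `k`-space at the origin: zero constant terms and an
invertible Jacobian matrix at the origin. If the components of `f` converge, `f` is an analytic
isomorphism of `(ℂᵏ, 0)`, by the inverse function theorem. -/
def IsFormalIso {k : ℕ} (f : Fin k → Ser k) : Prop :=
  (∀ i, constantCoeff (f i) = 0) ∧
    IsUnit (Matrix.of fun i j : Fin k => coeff (Finsupp.single j 1) (f i)).det

/-- The composition `f ∘ g` of formal maps. -/
def comp {k : ℕ} (f g : Fin k → Ser k) : Fin k → Ser k := fun i => subst g (f i)

/-- `f` and `f'` have the same jet of order one. -/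
def SameOneJet {k : ℕ} (f f' : Ser k) : Prop :=
  ∀ m : Fin k →₀ ℕ, m.degree ≤ 1 → coeff m f = coeff m f'

/-- The formal version of the group `Ã`, where `l` stands for `λ₁`:
* `ρ_i = t_i (c_i + ζ_i)`;
* `σ_i = a_i X_i + (X_i ε_i + X_{r+1} η_i)` with `η_i = 0` if `n > λ_{1i}`;
* `σ_{r+1} = a X_{r+1} + (X_{r+1} ε + X^α η)` with `α_i = ⌈λ_{1i} / n⌉`;
the numbers `c_i, a_i, a` are nonzero, and `ζ_i, ε_i, ε` lie in the maximal ideals. -/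
def InFormalTildeA {r : ℕ} (n : ℕ) (l : Fin r →₀ ℕ)
    (σ : Fin (r + 1) → Ser (r + 1)) (ρ : Fin r → Ser r) : Prop :=
  IsFormalIso σ ∧ IsFormalIso ρ ∧
  (∀ i : Fin r, ∃ (c : ℂ) (ζ : Ser r), c ≠ 0 ∧ constantCoeff ζ = 0 ∧ ρ i = X i * (C c + ζ)) ∧
  (∀ i : Fin r, ∃ (a : ℂ) (ε η : Ser (r + 1)), a ≠ 0 ∧ constantCoeff ε = 0 ∧
    (l i < n → η = 0) ∧
    σ i.castSucc = C a * X i.castSucc + (X i.castSucc * ε + X (Fin.last r) * η)) ∧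
  (∃ (a : ℂ) (ε η : Ser (r + 1)), a ≠ 0 ∧ constantCoeff ε = 0 ∧
    σ (Fin.last r) = C a * X (Fin.last r) +
      (X (Fin.last r) * ε + (∏ i : Fin r, X i.castSucc ^ ⌈(l i : ℚ) / (n : ℚ)⌉₊) * η))

/-- The formal version of the group `Ã₁`: the elements `(σ, ρ)` of `Ã` whose one-jets are
`(X₁ + d₁ X_{r+1}, …, X_r + d_r X_{r+1}, X_{r+1})`, with `d_i = 0` if `n > λ_{1i}`, and
`(t₁, …, t_r)`. -/
def InFormalTildeA₁ {r : ℕ} (n : ℕ) (l : Fin r →₀ ℕ)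
    (σ : Fin (r + 1) → Ser (r + 1)) (ρ : Fin r → Ser r) : Prop :=
  InFormalTildeA n l σ ρ ∧
  (∀ i : Fin r, ∃ d : ℂ, (l i < n → d = 0) ∧
    SameOneJet (σ i.castSucc) (X i.castSucc + C d * X (Fin.last r))) ∧
  SameOneJet (σ (Fin.last r)) (X (Fin.last r)) ∧
  (∀ i : Fin r, SameOneJet (ρ i) (X i))

/-- The group `Ã₁` of analytic coordinate changes: all components converge. (The series
`ζ`, `ε`, `η` can then be chosen convergent, by sorting monomials.) -/
def InTildeA₁ {r : ℕ} (n : ℕ) (l : Fin r →₀ ℕ)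
    (σ : Fin (r + 1) → Ser (r + 1)) (ρ : Fin r → Ser r) : Prop :=
  InFormalTildeA₁ n l σ ρ ∧ (∀ i, IsConvergent (σ i)) ∧ (∀ i, IsConvergent (ρ i))

/-- `σ ∘ H ∘ ρ⁻¹ = H'`, written as `σ ∘ H = H' ∘ ρ`, where `H = (t₁ⁿ, …, t_rⁿ, S)` and
`H' = (t₁ⁿ, …, t_rⁿ, S')`. -/
def Carries {r : ℕ} (n : ℕ) (σ : Fin (r + 1) → Ser (r + 1)) (ρ : Fin r → Ser r)
    (S S' : Ser r) : Prop :=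
  ∀ i : Fin (r + 1), subst (param n S) (σ i) = subst ρ (param n S' i)

/-- The term `t^γ` of `H = (t₁ⁿ, …, t_rⁿ, S)` is eliminable by the `Ã₁`-action: there is a
quasi-ordinary parameterization `(t₁ⁿ, …, t_rⁿ, ∑_{δ ⪰ λ₁} c_δ t^δ)` in the same topological class
which is `Ã₁`-equivalent to `H` and such that `c_γ = 0`, and every other coefficient agrees with
that of `S`, except possibly those with `δ ≻ γ`. -/
def IsEliminable {r g : ℕ} [NeZero g] (n : ℕ) (lam : Fin g → Fin r →₀ ℕ) (S : Ser r)
    (γ : Fin r →₀ ℕ) : Prop :=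
  ∃ S' : Ser r, IsQOParam n lam S' ∧ (∀ δ, coeff δ S' ≠ 0 → lam 0 ≤ δ) ∧
    (∃ σ ρ, InTildeA₁ n (lam 0) σ ρ ∧ Carries n σ ρ S S') ∧
    coeff γ S' = 0 ∧
    ∀ δ, δ ≠ γ → ¬ γ < δ → coeff δ S' = coeff δ S

/-! ### Formal equivalence -/

/-- Convergence in the ring of formal power series: each coefficient is eventually constant. -/
def FormallyTendsto {k : ℕ} (f : ℕ → Ser k) (f' : Ser k) : Prop :=
  ∀ m : Fin k →₀ ℕ, ∀ᶠ j in Filter.atTop, coeff m (f j) = coeff m f'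

/-- The finite compositions `f_{j-1} ∘ ⋯ ∘ f_1 ∘ f_0`. -/
def iterComp {k : ℕ} (f : ℕ → Fin k → Ser k) : ℕ → Fin k → Ser k
  | 0 => fun i => X i
  | j + 1 => comp (f j) (iterComp f j)

/-- `H = (t₁ⁿ, …, t_rⁿ, S)` and `H' = (t₁ⁿ, …, t_rⁿ, S')` are formally equivalent: `H'` is obtained
from `H` by a (possibly infinite) sequence of coordinate changes in `Ã₁` between quasi-ordinary
parameterizations, whose compositions converge, as formal power series, to a formal change of
coordinates that carries `H` to `H'`. A finite sequence is continued by identities. -/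
def FormallyEquivalent {r g : ℕ} [NeZero g] (n : ℕ) (lam : Fin g → Fin r →₀ ℕ)
    (S S' : Ser r) : Prop :=
  ∃ (σ : ℕ → Fin (r + 1) → Ser (r + 1)) (ρ : ℕ → Fin r → Ser r) (T : ℕ → Ser r)
    (σ' : Fin (r + 1) → Ser (r + 1)) (ρ' : Fin r → Ser r),
    T 0 = S ∧
    (∀ j, IsQOParam n lam (T j) ∧ InTildeA₁ n (lam 0) (σ j) (ρ j) ∧
      Carries n (σ j) (ρ j) (T j) (T (j + 1))) ∧
    FormallyTendsto T S' ∧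
    (∀ i, FormallyTendsto (fun j => iterComp σ j i) (σ' i)) ∧
    (∀ i, FormallyTendsto (fun j => iterComp ρ j i) (ρ' i)) ∧
    InFormalTildeA₁ n (lam 0) σ' ρ' ∧ Carries n σ' ρ' S S'

end QuasiOrdinary

end

noncomputable section

namespace QuasiOrdinary

open MvPowerSeries

/-! ### Power series supported in an upper set -/

/-! The two kinds of exponents in part (a) correspond to two elementary coordinate changes. If γ is
the dominant exponent of `H^*(h)`, then σ_{r+1} = X_{r+1} - c h with ρ = id replaces S by S - c
H^*(h), and a suitable c removes t^γ. If γ + ν_i = δ + 2λ₁ and δ is the dominant exponent of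
`H^*(h)`, put σ_i = X_i + c X_{r+1} h. Its pullback is t_i^n (1 + c w) with t_i^n w = S H^*(h),
where w is a power series because λ_{1i} ≥ n. With (1 + v)^n = 1 + c w and ρ_i = t_i (1 + v), the
new series is S' = S ∘ ρ⁻¹. To first order S' = S - (λ_{1i}/n) c w t^{λ₁}, and w t^{λ₁} has dominant
exponent γ. See `eliminates_of_mem_semigroup` and `eliminates_of_mem_translate`.

Normalization ensures that the first change lies in the group. Since λ₁ ∉ nℕ^r, terms of H^*(h) not
above λ₁ cannot cancel, so every monomial of h has weight above λ₁ (`termsAbove_of_pullback`); since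
λ₁ is not ≤ ν_i, no such monomial is linear. The characteristic exponents survive because each
difference of conjugates changes only by terms strictly above its dominant exponent (`ConjStable`),
after a harmless substitution t_j ↦ t_j · unit in the second case.

For part (b) the exponents are enumerated by increasing degree and removed one by one. The
compositions converge only if the orders of the series h grow. A Chevalley-type compactness argument
(`exists_orderBound`) gives this: a pullback of high order is also the pullback of a series of high
order, with a bound that is invariant under the coordinate changes. The new h may diverge, but
truncating it to a polynomial costs only terms of higher degree. Finally, the tail of the process
carries each intermediate parameterization to the limit, so the formal semigroup of the limit is
contained in every intermediate one (`formalEliminationSet_subset_of_carries`). A forbidden exponent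
of the limit would thus have been removed at its own step. -/

/-- The ideal of power series all of whose exponents lie in the upper set `U`. -/
def supp {k : ℕ} (U : UpperSet (Fin k →₀ ℕ)) : Ideal (Ser k) where
  carrier := {f | ∀ m, m ∉ U → coeff m f = 0}
  add_mem' := fun hf hg m hm => by rw [map_add, hf m hm, hg m hm, add_zero]
  zero_mem' := fun m _ => by simp
  smul_mem' := fun c f hf m hm => by
    classical
    rw [smul_eq_mul, coeff_mul]
    refine Finset.sum_eq_zero fun p hp => ?_
    rw [hf p.2 fun h => hm (U.upper ?_ h), mul_zero]
    rw [← Finset.HasAntidiagonal.mem_antidiagonal.1 hp]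
    exact le_add_self

theorem mem_supp {k : ℕ} {U : UpperSet (Fin k →₀ ℕ)} {f : Ser k} :
    f ∈ supp U ↔ ∀ m, m ∉ U → coeff m f = 0 := Iff.rfl

theorem supp_mono {k : ℕ} {U V : UpperSet (Fin k →₀ ℕ)} (h : ∀ m ∈ U, m ∈ V) :
    supp U ≤ supp V := fun _ hf m hm => hf m fun hU => hm (h m hU)

theorem mul_mem_supp {k : ℕ} {U V W : UpperSet (Fin k →₀ ℕ)} {f g : Ser k} (hf : f ∈ supp U)
    (hg : g ∈ supp V) (h : ∀ a ∈ U, ∀ b ∈ V, a + b ∈ W) : f * g ∈ supp W := by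
  classical
  intro m hm
  rw [coeff_mul]
  refine Finset.sum_eq_zero fun p hp => ?_
  by_cases h1 : p.1 ∈ U
  · by_cases h2 : p.2 ∈ V
    · exact absurd (Finset.HasAntidiagonal.mem_antidiagonal.1 hp ▸ h _ h1 _ h2) hm
    · rw [hg _ h2, mul_zero]
  · rw [hf _ h1, zero_mul]

theorem monomial_mem_supp {k : ℕ} {U : UpperSet (Fin k →₀ ℕ)} {d : Fin k →₀ ℕ} (h : d ∈ U)
    (a : ℂ) : (monomial d a : Ser k) ∈ supp U := fun m hm => by
  classical
  rw [coeff_monomial, if_neg]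
  rintro rfl
  exact hm h

/-- The exponents of total degree at least `p`. -/
def degGE (k p : ℕ) : UpperSet (Fin k →₀ ℕ) where
  carrier := {m | p ≤ m.degree}
  upper' := fun _ _ h (h' : p ≤ _) => h'.trans (Finsupp.degree_mono h)

theorem mem_degGE {k p : ℕ} {m : Fin k →₀ ℕ} : m ∈ degGE k p ↔ p ≤ m.degree := Iff.rfl

/-- The exponents that involve the variable `i`. -/
def varSet {k : ℕ} (i : Fin k) : UpperSet (Fin k →₀ ℕ) where
  carrier := {m | m i ≠ 0}
  upper' := fun a b h (h' : a i ≠ 0) => by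
    have := h i
    show b i ≠ 0
    omega

theorem mem_varSet {k : ℕ} {i : Fin k} {m : Fin k →₀ ℕ} : m ∈ varSet i ↔ m i ≠ 0 := Iff.rfl

theorem mem_supp_degGE_one {k : ℕ} {f : Ser k} :
    f ∈ supp (degGE k 1) ↔ constantCoeff f = 0 := by
  rw [mem_supp]
  constructor
  · intro h
    rw [← coeff_zero_eq_constantCoeff_apply]
    exact h 0 (by simp [mem_degGE])
  · intro h m hm
    have : m = 0 := by
      rw [mem_degGE, not_le, Nat.lt_one_iff, Finsupp.degree_eq_zero_iff] at hm
      exact hm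
    rw [this, coeff_zero_eq_constantCoeff_apply, h]

theorem mem_supp_Ioi_zero {k : ℕ} {f : Ser k} :
    f ∈ supp (UpperSet.Ioi 0) ↔ constantCoeff f = 0 := by
  rw [mem_supp]
  constructor
  · intro h
    rw [← coeff_zero_eq_constantCoeff_apply]
    exact h 0 (by simp)
  · intro h m hm
    have : m = 0 := by
      rw [UpperSet.mem_Ioi_iff, pos_iff_ne_zero, not_not] at hm
      exact hm
    rw [this, coeff_zero_eq_constantCoeff_apply, h]

theorem supp_degGE_mul {k p q : ℕ} {f g : Ser k} (hf : f ∈ supp (degGE k p))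
    (hg : g ∈ supp (degGE k q)) : f * g ∈ supp (degGE k (p + q)) :=
  mul_mem_supp hf hg fun a ha b hb => by
    rw [mem_degGE] at *
    rw [map_add]
    exact add_le_add ha hb

theorem supp_Ici_mul {k : ℕ} {a b : Fin k →₀ ℕ} {f g : Ser k} (hf : f ∈ supp (UpperSet.Ici a))
    (hg : g ∈ supp (UpperSet.Ici b)) : f * g ∈ supp (UpperSet.Ici (a + b)) :=
  mul_mem_supp hf hg fun x hx y hy => by
    rw [UpperSet.mem_Ici_iff] at *
    exact add_le_add hx hy

/-- A series in `supp V` times a nonunit. -/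
theorem mul_mem_supp_of_constantCoeff {k : ℕ} {U V : UpperSet (Fin k →₀ ℕ)}
    (hUV : ∀ a ∈ V, ∀ b, a < b → b ∈ U) {f g : Ser k} (hf : f ∈ supp V)
    (hg : constantCoeff g = 0) : f * g ∈ supp U :=
  mul_mem_supp hf (mem_supp_Ioi_zero.2 hg) fun a ha b hb => hUV a ha _ (by
    rw [UpperSet.mem_Ioi_iff] at hb
    exact lt_add_of_pos_right a hb)

theorem isDominantExponent_iff {k : ℕ} {q : Ser k} {γ : Fin k →₀ ℕ} :
    IsDominantExponent q γ ↔ coeff γ q ≠ 0 ∧ q ∈ supp (UpperSet.Ici γ) := by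
  refine and_congr_right fun _ => ?_
  rw [mem_supp]
  refine forall_congr' fun δ => ?_
  rw [UpperSet.mem_Ici_iff]
  exact not_imp_comm

/-! ### Substitution -/

/-- The value of the monomial with exponent `d` at the family `a`. -/
abbrev mon {k l : ℕ} (a : Fin k → Ser l) (d : Fin k →₀ ℕ) : Ser l := d.prod fun s e => a s ^ e

theorem mon_eq {k l : ℕ} (a : Fin k → Ser l) (d : Fin k →₀ ℕ) : mon a d = ∏ s, a s ^ d s :=
  Finsupp.prod_fintype _ _ fun _ => pow_zero _

theorem mon_add {k l : ℕ} (a : Fin k → Ser l) (d e : Fin k →₀ ℕ) :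
    mon a (d + e) = mon a d * mon a e := by
  simp only [mon_eq, Finsupp.add_apply, pow_add, Finset.prod_mul_distrib]

theorem mon_single {k l : ℕ} (a : Fin k → Ser l) (s : Fin k) (p : ℕ) :
    mon a (Finsupp.single s p) = a s ^ p :=
  Finsupp.prod_single_index (pow_zero _)

theorem mon_X {k : ℕ} (d : Fin k →₀ ℕ) : mon (fun i => (X i : Ser k)) d = monomial d 1 :=
  (monomial_one_eq d).symm

theorem hasSubst {k l : ℕ} {a : Fin k → Ser l} (ha : ∀ i, constantCoeff (a i) = 0) :
    HasSubst a := hasSubst_of_constantCoeff_zero ha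

theorem subst_mem_supp {k l : ℕ} {a : Fin k → Ser l} (ha : ∀ i, constantCoeff (a i) = 0)
    {U : UpperSet (Fin l →₀ ℕ)} {f : Ser k} (h : ∀ d, coeff d f ≠ 0 → mon a d ∈ supp U) :
    subst a f ∈ supp U := by
  intro m hm
  rw [coeff_subst (hasSubst ha)]
  refine finsum_eq_zero_of_forall_eq_zero fun d => ?_
  by_cases hd : coeff d f = 0
  · rw [hd, zero_smul]
  · rw [h d hd m hm, smul_zero]

theorem subst_sub_subst_mem_supp {k l : ℕ} {a b : Fin k → Ser l}
    (ha : ∀ i, constantCoeff (a i) = 0) (hb : ∀ i, constantCoeff (b i) = 0)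
    {U : UpperSet (Fin l →₀ ℕ)} {f : Ser k}
    (h : ∀ d, coeff d f ≠ 0 → mon a d - mon b d ∈ supp U) :
    subst a f - subst b f ∈ supp U := by
  intro m hm
  rw [map_sub, coeff_subst (hasSubst ha), coeff_subst (hasSubst hb), sub_eq_zero]
  refine finsum_congr fun d => ?_
  by_cases hd : coeff d f = 0
  · rw [hd, zero_smul, zero_smul]
  · have := h d hd m hm
    rw [map_sub, sub_eq_zero] at this
    rw [this]

theorem prod_sub_prod_mem {R ι : Type*} [CommRing R] (I : Ideal R) (s : Finset ι)
    (a b : ι → R) (h : ∀ i ∈ s, a i - b i ∈ I) : ∏ i ∈ s, a i - ∏ i ∈ s, b i ∈ I := by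
  rw [← Ideal.Quotient.eq, map_prod, map_prod]
  exact Finset.prod_congr rfl fun i hi => Ideal.Quotient.eq.2 (h i hi)

theorem pow_sub_pow_mem {R : Type*} [CommRing R] (I : Ideal R) {a b : R} (h : a - b ∈ I) (p : ℕ) :
    a ^ p - b ^ p ∈ I := I.mem_of_dvd (sub_dvd_pow_sub_pow a b p) h

theorem mon_sub_mon_mem {k l : ℕ} {a b : Fin k → Ser l} (I : Ideal (Ser l))
    (h : ∀ i, a i - b i ∈ I) (d : Fin k →₀ ℕ) : mon a d - mon b d ∈ I := by
  rw [mon_eq, mon_eq]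
  exact prod_sub_prod_mem I _ _ _ fun i _ => pow_sub_pow_mem I (h i) _

theorem subst_sub_subst_mem_supp' {k l : ℕ} {a b : Fin k → Ser l}
    (ha : ∀ i, constantCoeff (a i) = 0) (hb : ∀ i, constantCoeff (b i) = 0)
    {U : UpperSet (Fin l →₀ ℕ)} (h : ∀ i, a i - b i ∈ supp U) (f : Ser k) :
    subst a f - subst b f ∈ supp U :=
  subst_sub_subst_mem_supp ha hb fun d _ => mon_sub_mon_mem _ h d

theorem pow_mem_supp_Ici {k : ℕ} {a : Fin k →₀ ℕ} {f : Ser k} (hf : f ∈ supp (UpperSet.Ici a))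
    (p : ℕ) : f ^ p ∈ supp (UpperSet.Ici (p • a)) := by
  induction p with
  | zero => exact fun m hm => absurd (by simp) hm
  | succ p ih =>
    rw [pow_succ, succ_nsmul]
    exact supp_Ici_mul ih hf

theorem prod_mem_supp_Ici {k : ℕ} {ι : Type*} (s : Finset ι) (e : ι → Fin k →₀ ℕ) (f : ι → Ser k)
    (h : ∀ i ∈ s, f i ∈ supp (UpperSet.Ici (e i))) :
    ∏ i ∈ s, f i ∈ supp (UpperSet.Ici (∑ i ∈ s, e i)) := by
  classical
  induction s using Finset.induction_on with
  | empty => exact fun m hm => absurd (by simp) hm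
  | insert i s hi ih =>
    rw [Finset.prod_insert hi, Finset.sum_insert hi]
    exact supp_Ici_mul (h i (Finset.mem_insert_self i s))
      (ih fun j hj => h j (Finset.mem_insert_of_mem hj))

theorem pow_mem_supp_degGE {k p : ℕ} {f : Ser k} (hf : f ∈ supp (degGE k p)) (q : ℕ) :
    f ^ q ∈ supp (degGE k (q * p)) := by
  induction q with
  | zero => exact fun m hm => absurd (by simp [mem_degGE]) hm
  | succ q ih =>
    rw [pow_succ, Nat.succ_mul]
    exact supp_degGE_mul ih hf

theorem mon_mem_supp_degGE {k l : ℕ} {a : Fin k → Ser l} (ha : ∀ i, constantCoeff (a i) = 0)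
    (d : Fin k →₀ ℕ) : mon a d ∈ supp (degGE l d.degree) := by
  classical
  rw [mon_eq, Finsupp.degree_eq_sum]
  induction (Finset.univ : Finset (Fin k)) using Finset.induction_on with
  | empty => exact fun m hm => absurd (by simp [mem_degGE]) hm
  | insert i s hi ih =>
    rw [Finset.prod_insert hi, Finset.sum_insert hi]
    have := pow_mem_supp_degGE (mem_supp_degGE_one.2 (ha i)) (d i)
    rw [mul_one] at this
    exact supp_degGE_mul this ih

theorem subst_mem_supp_degGE {k l p : ℕ} {a : Fin k → Ser l} (ha : ∀ i, constantCoeff (a i) = 0)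
    {f : Ser k} (hf : f ∈ supp (degGE k p)) : subst a f ∈ supp (degGE l p) :=
  subst_mem_supp ha fun d hd => supp_mono
    (fun _ hm => le_trans (by_contra fun h => hd (hf d h)) (mem_degGE.1 hm))
    (mon_mem_supp_degGE ha d)

theorem constantCoeff_subst_zero {k l : ℕ} {a : Fin k → Ser l}
    (ha : ∀ i, constantCoeff (a i) = 0) {f : Ser k} (hf : constantCoeff f = 0) :
    constantCoeff (subst a f) = 0 := constantCoeff_subst_eq_zero (hasSubst ha) ha hf

theorem subst_monomial' {k l : ℕ} {a : Fin k → Ser l} (ha : ∀ i, constantCoeff (a i) = 0)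
    (d : Fin k →₀ ℕ) (c : ℂ) : subst a (monomial d c : Ser k) = C c * mon a d := by
  rw [subst_monomial (hasSubst ha)]
  rfl

theorem subst_C' {k l : ℕ} {a : Fin k → Ser l} (ha : ∀ i, constantCoeff (a i) = 0)
    (c : ℂ) : subst a (C c : Ser k) = C c := by
  rw [← monomial_zero_eq_C_apply, subst_monomial' ha]
  simp [mon]

theorem subst_one {k l : ℕ} {a : Fin k → Ser l} (ha : ∀ i, constantCoeff (a i) = 0) :
    subst a (1 : Ser k) = 1 := by
  rw [← coe_substAlgHom (hasSubst ha), map_one]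

theorem subst_zero' {k l : ℕ} {a : Fin k → Ser l} (ha : ∀ i, constantCoeff (a i) = 0) :
    subst a (0 : Ser k) = 0 := by
  rw [← coe_substAlgHom (hasSubst ha), map_zero]

theorem subst_subst {k l j : ℕ} {a : Fin k → Ser l} {b : Fin l → Ser j}
    (ha : ∀ i, constantCoeff (a i) = 0) (hb : ∀ i, constantCoeff (b i) = 0) (f : Ser k) :
    subst b (subst a f) = subst (fun i => subst b (a i)) f :=
  subst_comp_subst_apply (hasSubst ha) (hasSubst hb) f

theorem subst_id {k : ℕ} (f : Ser k) : subst (fun i => (X i : Ser k)) f = f := by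
  have := subst_self (σ := Fin k) (R := ℂ)
  exact congrFun this f

/-! ### Substitutions that multiply each variable by a unit -/

/-- The family `a` is a perturbation of the identity multiplicative in each variable. -/
def IsMonic {k : ℕ} (a : Fin k → Ser k) : Prop :=
  ∀ i, ∃ v : Ser k, constantCoeff v = 0 ∧ a i = X i * (1 + v)

theorem IsMonic.constantCoeff {k : ℕ} {a : Fin k → Ser k} (ha : IsMonic a) (i : Fin k) :
    MvPowerSeries.constantCoeff (a i) = 0 := by
  obtain ⟨v, -, h⟩ := ha i
  simp [h]

theorem IsMonic.mon_sub {k : ℕ} {a : Fin k → Ser k} (ha : IsMonic a) (d : Fin k →₀ ℕ) :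
    mon a d - monomial d 1 ∈ supp (UpperSet.Ioi d) := by
  choose v hv h using ha
  have : mon a d = monomial d 1 * ∏ s, (1 + v s) ^ d s := by
    rw [← mon_X, mon_eq, mon_eq, ← Finset.prod_mul_distrib]
    exact Finset.prod_congr rfl fun i _ => by rw [h, mul_pow]
  rw [this, show ∀ x y : Ser k, x * y - x = x * (y - 1) from fun x y => by ring]
  refine mul_mem_supp_of_constantCoeff (V := UpperSet.Ici d) (fun a ha b hb => ?_)
    (monomial_mem_supp (by simp) 1) (by simp [hv])
  rw [UpperSet.mem_Ici_iff] at ha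
  exact lt_of_le_of_lt ha hb

/-- The substitution is unitriangular for the product order: t^d becomes t^d plus terms strictly
above d. Hence minimal exponents keep their coefficients. -/
theorem IsMonic.coeff_subst {k : ℕ} {a : Fin k → Ser k} (ha : IsMonic a) {f : Ser k}
    {β : Fin k →₀ ℕ} (hf : ∀ β' < β, coeff β' f = 0) :
    coeff β (subst a f) = coeff β f := by
  rw [MvPowerSeries.coeff_subst (hasSubst ha.constantCoeff), finsum_eq_single _ β]
  · have := ha.mon_sub β β (by simp)
    rw [map_sub, coeff_monomial_same, sub_eq_zero] at this
    rw [this, smul_eq_mul, mul_one]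
  · intro d hd
    by_cases hdβ : d < β
    · rw [hf d hdβ, zero_smul]
    · have := ha.mon_sub d β (by simpa using hdβ)
      rw [map_sub, coeff_monomial_ne hd.symm, sub_zero] at this
      rw [this, smul_zero]

theorem exists_le_minimal_coeff {k : ℕ} {f : Ser k} {β : Fin k →₀ ℕ} (h : coeff β f ≠ 0) :
    ∃ γ ≤ β, coeff γ f ≠ 0 ∧ ∀ γ' < γ, coeff γ' f = 0 := by
  obtain ⟨γ, hγ⟩ := exists_minimal_le_of_wellFoundedLT (fun γ => coeff γ f ≠ 0) β h
  exact ⟨γ, hγ.1, hγ.2.1, fun γ' h' => by_contra fun h0 => hγ.2.not_lt h0 h'⟩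

/-- Minimal exponents survive the substitution, so the upper set generated by the support is
invariant. This yields the invariance of dominant exponents without inverting the substitution. -/
theorem IsMonic.mem_supp_iff {k : ℕ} {a : Fin k → Ser k} (ha : IsMonic a) {f : Ser k}
    {U : UpperSet (Fin k →₀ ℕ)} : subst a f ∈ supp U ↔ f ∈ supp U := by
  constructor
  · intro h m hm
    by_contra h0
    obtain ⟨γ, hγ, h1, h2⟩ := exists_le_minimal_coeff h0
    rw [← ha.coeff_subst h2] at h1
    exact h1 (h γ fun hU => hm (U.upper hγ hU))
  · intro h
    refine subst_mem_supp ha.constantCoeff fun d hd => ?_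
    have hdU : d ∈ U := by_contra fun hU => hd (h d hU)
    have := ha.mon_sub d
    rw [← sub_add_cancel (mon a d) (monomial d 1)]
    exact add_mem (supp_mono (fun m hm => U.upper (le_of_lt (UpperSet.mem_Ioi_iff.1 hm)) hdU) this)
      (monomial_mem_supp hdU 1)

theorem IsMonic.isDominantExponent_iff {k : ℕ} {a : Fin k → Ser k} (ha : IsMonic a) {f : Ser k}
    {γ : Fin k →₀ ℕ} : IsDominantExponent (subst a f) γ ↔ IsDominantExponent f γ := by
  rw [QuasiOrdinary.isDominantExponent_iff, QuasiOrdinary.isDominantExponent_iff, ha.mem_supp_iff]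
  refine and_congr_left fun h => ?_
  rw [ha.coeff_subst fun β' h' => h β' fun hU => (not_le_of_gt h') (UpperSet.mem_Ici_iff.1 hU)]

theorem IsMonic.injective {k : ℕ} {a : Fin k → Ser k} (ha : IsMonic a) {f g : Ser k}
    (h : subst a f = subst a g) : f = g := by
  rw [← sub_eq_zero, ← MvPowerSeries.coe_substAlgHom (hasSubst ha.constantCoeff), ← map_sub] at h
  rw [← sub_eq_zero]
  rw [MvPowerSeries.coe_substAlgHom] at h
  -- `UpperSet` is ordered by reverse inclusion, so `⊤` is empty and `supp ⊤` is the zero ideal.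
  have h1 : subst a (f - g) ∈ supp (⊤ : UpperSet (Fin k →₀ ℕ)) := by rw [h]; exact zero_mem _
  rw [ha.mem_supp_iff] at h1
  ext m
  exact h1 m (by simp)

/-! ### Weighted norms and convergence -/

open scoped NNReal ENNReal Topology
open Filter

/-- The weighted `ℓ¹`-norm of a power series on the polydisc of radius `ε`. -/
def wnorm {k : ℕ} (ε : ℝ≥0) (f : Ser k) : ℝ≥0∞ :=
  ∑' m : Fin k →₀ ℕ, ‖coeff m f‖ₑ * (ε : ℝ≥0∞) ^ m.degree

theorem wnorm_mono {k : ℕ} {ε δ : ℝ≥0} (h : ε ≤ δ) (f : Ser k) : wnorm ε f ≤ wnorm δ f :=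
  ENNReal.tsum_le_tsum fun m => by gcongr

theorem isConvergent_iff {k : ℕ} {f : Ser k} :
    IsConvergent f ↔ ∃ ε : ℝ≥0, 0 < ε ∧ wnorm ε f ≠ ∞ := by
  have key : ∀ ε : ℝ≥0, (Summable fun m : Fin k →₀ ℕ => ‖coeff m f‖ * (ε : ℝ) ^ m.degree) ↔
      wnorm ε f ≠ ∞ := fun ε => by
    have h1 : wnorm ε f = ∑' m : Fin k →₀ ℕ,
        ((‖coeff m f‖₊ * ε ^ m.degree : ℝ≥0) : ℝ≥0∞) :=
      tsum_congr fun m => by rw [ENNReal.coe_mul, ENNReal.coe_pow]; rfl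
    rw [h1, ENNReal.tsum_coe_ne_top_iff_summable, ← NNReal.summable_coe]
    simp
  constructor
  · rintro ⟨ε, hε, h⟩
    exact ⟨⟨ε, hε.le⟩, hε, (key _).1 h⟩
  · rintro ⟨ε, hε, h⟩
    exact ⟨ε, hε, (key ε).2 h⟩

/-- The filter form lets finitely many series share one small radius. -/
theorem isConvergent_iff_eventually {k : ℕ} {f : Ser k} :
    IsConvergent f ↔ ∀ᶠ ε in 𝓝[>] (0 : ℝ≥0), wnorm ε f ≠ ∞ := by
  rw [isConvergent_iff]
  constructor
  · rintro ⟨ε, hε, h⟩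
    filter_upwards [Ioo_mem_nhdsGT hε] with δ hδ
    exact ne_top_of_le_ne_top h (wnorm_mono hδ.2.le f)
  · intro h
    obtain ⟨ε, h1, h2⟩ := (h.and self_mem_nhdsWithin).exists
    exact ⟨ε, h2, h1⟩

theorem wnorm_add_le {k : ℕ} (ε : ℝ≥0) (f g : Ser k) :
    wnorm ε (f + g) ≤ wnorm ε f + wnorm ε g := by
  rw [wnorm, wnorm, wnorm, ← ENNReal.tsum_add]
  refine ENNReal.tsum_le_tsum fun m => ?_
  rw [← add_mul, map_add]
  gcongr
  exact enorm_add_le _ _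

theorem wnorm_neg {k : ℕ} (ε : ℝ≥0) (f : Ser k) : wnorm ε (-f) = wnorm ε f := by
  simp [wnorm]

theorem wnorm_sub_le {k : ℕ} (ε : ℝ≥0) (f g : Ser k) :
    wnorm ε (f - g) ≤ wnorm ε f + wnorm ε g := by
  rw [sub_eq_add_neg, ← wnorm_neg ε g]
  exact wnorm_add_le ε f (-g)

theorem wnorm_mul_le {k : ℕ} (ε : ℝ≥0) (f g : Ser k) :
    wnorm ε (f * g) ≤ wnorm ε f * wnorm ε g := by
  classical
  calc wnorm ε (f * g) ≤ ∑' m : Fin k →₀ ℕ, ∑ p ∈ Finset.HasAntidiagonal.antidiagonal m,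
        (‖coeff p.1 f‖ₑ * (ε : ℝ≥0∞) ^ p.1.degree) *
          (‖coeff p.2 g‖ₑ * (ε : ℝ≥0∞) ^ p.2.degree) := by
        refine ENNReal.tsum_le_tsum fun m => ?_
        rw [coeff_mul]
        refine (mul_le_mul_left (enorm_sum_le _ _) _).trans ?_
        rw [Finset.sum_mul]
        refine Finset.sum_le_sum fun p hp => ?_
        rw [← Finset.HasAntidiagonal.mem_antidiagonal.1 hp, map_add, pow_add, enorm_mul]
        exact (by ring : _ = _).le
    _ = ∑' q : (Fin k →₀ ℕ) × (Fin k →₀ ℕ),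
        (‖coeff q.1 f‖ₑ * (ε : ℝ≥0∞) ^ q.1.degree) *
          (‖coeff q.2 g‖ₑ * (ε : ℝ≥0∞) ^ q.2.degree) := by
        rw [← (Finset.HasAntidiagonal.sigmaAntidiagonalEquivProd (A := Fin k →₀ ℕ)).tsum_eq, ENNReal.tsum_sigma']
        refine tsum_congr fun m => ?_
        rw [← Finset.tsum_subtype]
        rfl
    _ = wnorm ε f * wnorm ε g := by
        rw [ENNReal.tsum_prod (f := fun a b => (‖coeff a f‖ₑ * (ε : ℝ≥0∞) ^ a.degree) *
          (‖coeff b g‖ₑ * (ε : ℝ≥0∞) ^ b.degree))]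
        simp_rw [ENNReal.tsum_mul_left, ENNReal.tsum_mul_right]
        rfl

theorem wnorm_monomial {k : ℕ} (ε : ℝ≥0) (d : Fin k →₀ ℕ) (c : ℂ) :
    wnorm ε (monomial d c : Ser k) = ‖c‖ₑ * (ε : ℝ≥0∞) ^ d.degree := by
  rw [wnorm, tsum_eq_single d, coeff_monomial_same]
  intro m hm
  rw [coeff_monomial_ne hm, enorm_zero, zero_mul]

theorem wnorm_C {k : ℕ} (ε : ℝ≥0) (c : ℂ) : wnorm ε (C c : Ser k) = ‖c‖ₑ := by
  rw [← monomial_zero_eq_C_apply, wnorm_monomial]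
  simp

theorem wnorm_one {k : ℕ} (ε : ℝ≥0) : wnorm ε (1 : Ser k) = 1 := by
  rw [← map_one C, wnorm_C]
  simp

theorem wnorm_X {k : ℕ} (ε : ℝ≥0) (i : Fin k) : wnorm ε (X i : Ser k) = ε := by
  rw [X_def, wnorm_monomial]
  simp

theorem wnorm_pow_le {k : ℕ} (ε : ℝ≥0) (f : Ser k) (p : ℕ) :
    wnorm ε (f ^ p) ≤ wnorm ε f ^ p := by
  induction p with
  | zero => rw [pow_zero, pow_zero, wnorm_one]
  | succ p ih =>
    rw [pow_succ, pow_succ]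
    exact (wnorm_mul_le _ _ _).trans (by gcongr)

theorem wnorm_prod_le {k : ℕ} {ι : Type*} (ε : ℝ≥0) (s : Finset ι) (f : ι → Ser k) :
    wnorm ε (∏ i ∈ s, f i) ≤ ∏ i ∈ s, wnorm ε (f i) := by
  classical
  induction s using Finset.induction_on with
  | empty => rw [Finset.prod_empty, Finset.prod_empty, wnorm_one]
  | insert i s hi ih =>
    rw [Finset.prod_insert hi, Finset.prod_insert hi]
    exact (wnorm_mul_le _ _ _).trans (by gcongr)

/-- Submultiplicativity bounds the norm of each substituted monomial by `δ ^ d.degree`. The sums may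
be exchanged freely since all terms lie in `ℝ≥0∞`. -/
theorem wnorm_subst_le {k l : ℕ} {a : Fin k → Ser l} (ha : ∀ i, constantCoeff (a i) = 0)
    {ε δ : ℝ≥0} (h : ∀ i, wnorm ε (a i) ≤ δ) (f : Ser k) :
    wnorm ε (subst a f) ≤ wnorm δ f := by
  have hmon : ∀ d : Fin k →₀ ℕ, wnorm ε (mon a d) ≤ (δ : ℝ≥0∞) ^ d.degree := fun d => by
    rw [mon_eq, Finsupp.degree_eq_sum, ← Finset.prod_pow_eq_pow_sum]
    refine (wnorm_prod_le _ _ _).trans (Finset.prod_le_prod' fun i _ => ?_)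
    refine (wnorm_pow_le _ _ _).trans ?_
    gcongr
    exact h i
  have hc : ∀ m, ‖coeff m (subst a f)‖ₑ ≤ ∑' d, ‖coeff d f‖ₑ * ‖coeff m (mon a d)‖ₑ := fun m => by
    rw [coeff_subst (hasSubst ha), finsum_eq_sum _ (coeff_subst_finite (hasSubst ha) f m)]
    refine (enorm_sum_le _ _).trans ?_
    refine le_trans (Finset.sum_le_sum fun d _ => ?_) (ENNReal.sum_le_tsum _)
    rw [smul_eq_mul, enorm_mul]
  calc wnorm ε (subst a f)
      ≤ ∑' m : Fin l →₀ ℕ, ∑' d, ‖coeff d f‖ₑ * (‖coeff m (mon a d)‖ₑ * (ε : ℝ≥0∞) ^ m.degree) :=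
        ENNReal.tsum_le_tsum fun m => by
          refine (mul_le_mul_left (hc m) _).trans ?_
          rw [← ENNReal.tsum_mul_right]
          exact (tsum_congr fun d => mul_assoc _ _ _).le
    _ = ∑' d, ‖coeff d f‖ₑ * wnorm ε (mon a d) := by
        rw [ENNReal.tsum_comm]
        exact tsum_congr fun d => ENNReal.tsum_mul_left
    _ ≤ wnorm δ f := ENNReal.tsum_le_tsum fun d => by
        gcongr
        exact hmon d

/-- Shrinking the radius by s gains a factor s^p on terms of degree at least p. This gain makes the
iteration for inverse maps stay bounded. -/
theorem wnorm_mul_le_of_mem {k p : ℕ} {f : Ser k} (hf : f ∈ supp (degGE k p)) {s : ℝ≥0}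
    (hs : s ≤ 1) (ε : ℝ≥0) : wnorm (s * ε) f ≤ s ^ p * wnorm ε f := by
  rw [wnorm, wnorm, ← ENNReal.tsum_mul_left]
  refine ENNReal.tsum_le_tsum fun m => ?_
  by_cases hm : p ≤ m.degree
  · rw [ENNReal.coe_mul, mul_pow, ← mul_assoc, mul_comm ‖_‖ₑ, mul_assoc]
    exact mul_le_mul_left (pow_le_pow_right_of_le_one' (by exact_mod_cast hs) hm) _
  · rw [hf m hm]
    simp

theorem eventually_wnorm_le {k : ℕ} {f : Ser k} (hf : constantCoeff f = 0) (hc : IsConvergent f)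
    {δ : ℝ≥0} (hδ : 0 < δ) : ∀ᶠ ε in 𝓝[>] (0 : ℝ≥0), wnorm ε f ≤ δ := by
  obtain ⟨ε, hε, h⟩ := isConvergent_iff.1 hc
  obtain ⟨A, hA⟩ : ∃ A : ℝ≥0, (A : ℝ≥0∞) = wnorm ε f := ⟨_, ENNReal.coe_toNNReal h⟩
  have hpos : 0 < min 1 (δ / (A + 1)) * ε := mul_pos (lt_min one_pos (by positivity)) hε
  filter_upwards [Ioo_mem_nhdsGT hpos] with η hη
  refine (wnorm_mono hη.2.le f).trans ?_
  refine (wnorm_mul_le_of_mem (mem_supp_degGE_one.2 hf) (min_le_left _ _) ε).trans ?_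
  rw [← hA, pow_one]
  norm_cast
  calc min 1 (δ / (A + 1)) * A ≤ δ / (A + 1) * (A + 1) := by
        gcongr
        · exact min_le_right _ _
        · exact le_self_add
    _ = δ := div_mul_cancel₀ _ (by positivity)

theorem IsConvergent.add {k : ℕ} {f g : Ser k} (hf : IsConvergent f) (hg : IsConvergent g) :
    IsConvergent (f + g) := by
  rw [isConvergent_iff_eventually] at *
  filter_upwards [hf, hg] with ε h1 h2
  exact ne_top_of_le_ne_top (ENNReal.add_ne_top.2 ⟨h1, h2⟩) (wnorm_add_le _ _ _)

theorem IsConvergent.sub {k : ℕ} {f g : Ser k} (hf : IsConvergent f) (hg : IsConvergent g) :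
    IsConvergent (f - g) := by
  rw [isConvergent_iff_eventually] at *
  filter_upwards [hf, hg] with ε h1 h2
  exact ne_top_of_le_ne_top (ENNReal.add_ne_top.2 ⟨h1, h2⟩) (wnorm_sub_le _ _ _)

theorem IsConvergent.mul {k : ℕ} {f g : Ser k} (hf : IsConvergent f) (hg : IsConvergent g) :
    IsConvergent (f * g) := by
  rw [isConvergent_iff_eventually] at *
  filter_upwards [hf, hg] with ε h1 h2
  exact ne_top_of_le_ne_top (ENNReal.mul_ne_top h1 h2) (wnorm_mul_le _ _ _)

theorem IsConvergent.pow {k : ℕ} {f : Ser k} (hf : IsConvergent f) (p : ℕ) :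
    IsConvergent (f ^ p) := by
  rw [isConvergent_iff_eventually] at *
  filter_upwards [hf] with ε h1
  exact ne_top_of_le_ne_top (ENNReal.pow_ne_top h1) (wnorm_pow_le _ _ _)

theorem isConvergent_monomial {k : ℕ} (d : Fin k →₀ ℕ) (c : ℂ) :
    IsConvergent (monomial d c : Ser k) := by
  rw [isConvergent_iff]
  refine ⟨1, one_pos, ?_⟩
  rw [wnorm_monomial]
  simp

theorem isConvergent_C {k : ℕ} (c : ℂ) : IsConvergent (C c : Ser k) := by
  rw [← monomial_zero_eq_C_apply]
  exact isConvergent_monomial _ _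

theorem isConvergent_one {k : ℕ} : IsConvergent (1 : Ser k) := by
  rw [← map_one C]
  exact isConvergent_C 1

theorem isConvergent_X {k : ℕ} (i : Fin k) : IsConvergent (X i : Ser k) :=
  isConvergent_monomial _ _

theorem isConvergent_of_finite {k : ℕ} {f : Ser k} (h : {m | coeff m f ≠ 0}.Finite) :
    IsConvergent f := by
  refine ⟨1, one_pos, summable_of_hasFiniteSupport (h.subset fun m hm => ?_)⟩
  intro h0
  rw [Function.mem_support] at hm
  simp [h0] at hm

theorem IsConvergent.subst {k l : ℕ} {a : Fin k → Ser l} {f : Ser k} (hf : IsConvergent f)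
    (ha : ∀ i, constantCoeff (a i) = 0) (hc : ∀ i, IsConvergent (a i)) :
    IsConvergent (subst a f) := by
  obtain ⟨δ, hδ, h⟩ := isConvergent_iff.1 hf
  rw [isConvergent_iff_eventually]
  filter_upwards [eventually_all.2 fun i => eventually_wnorm_le (ha i) (hc i) hδ] with ε hε
  exact ne_top_of_le_ne_top h (wnorm_subst_le ha hε f)

theorem IsConvergent.of_monomial_mul {k : ℕ} {f : Ser k} {d : Fin k →₀ ℕ}
    (h : IsConvergent (monomial d 1 * f)) : IsConvergent f := by
  obtain ⟨ε, hε, h⟩ := h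
  refine ⟨ε, hε, ?_⟩
  have h1 := h.comp_injective (add_right_injective d)
  refine (h1.mul_left (ε ^ d.degree)⁻¹).congr fun m => ?_
  simp only [Function.comp_apply, coeff_add_monomial_mul, one_mul, map_add, pow_add]
  field_simp

/-! ### Limits of power series -/

/-- A sequence with `f (j + 1) ≡ f j` modulo terms of degree at least `j` has a limit. -/
theorem exists_limit {k : ℕ} (f : ℕ → Ser k) (h : ∀ j, f (j + 1) - f j ∈ supp (degGE k j)) :
    ∃ F : Ser k, ∀ j, F - f j ∈ supp (degGE k j) := by
  have hle : ∀ i j, i ≤ j → f j - f i ∈ supp (degGE k i) := fun i j hij => by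
    induction j, hij using Nat.le_induction with
    | base => rw [sub_self]; exact zero_mem _
    | succ j hij ih =>
      rw [← sub_add_sub_cancel]
      exact add_mem (supp_mono (fun m hm => le_trans hij (mem_degGE.1 hm)) (h j)) ih
  -- Coefficients of degree d no longer change from index d + 1 on.
  let F : Ser k := fun m => coeff m (f (m.degree + 1))
  refine ⟨F, fun j m hm => ?_⟩
  rw [mem_degGE, not_le] at hm
  have := hle (m.degree + 1) j hm m (by rw [mem_degGE]; omega)
  rw [map_sub, sub_eq_zero] at this ⊢
  exact this.symm

theorem eq_zero_of_mem_supp_degGE {k : ℕ} {f : Ser k} (h : ∀ j, f ∈ supp (degGE k j)) : f = 0 := by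
  ext m
  exact h (m.degree + 1) m (by rw [mem_degGE]; omega)

/-- Every finite partial sum of the limit is already a partial sum of some `f j`. -/
theorem wnorm_le_of_limit {k : ℕ} {f : ℕ → Ser k} {F : Ser k}
    (hF : ∀ j, F - f j ∈ supp (degGE k j)) {ε : ℝ≥0} {B : ℝ≥0∞} (h : ∀ j, wnorm ε (f j) ≤ B) :
    wnorm ε F ≤ B := by
  rw [wnorm, ENNReal.tsum_eq_iSup_sum]
  refine iSup_le fun s => ?_
  obtain ⟨j, hj⟩ : ∃ j, ∀ m ∈ s, m.degree < j :=
    ⟨s.sup (fun m => m.degree) + 1, fun m hm =>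
      Nat.lt_succ_of_le (Finset.le_sup (f := fun m => m.degree) hm)⟩
  refine le_trans ?_ (h j)
  refine le_trans (Finset.sum_le_sum fun m hm => ?_) (ENNReal.sum_le_tsum s)
  have := hF j m (by rw [mem_degGE]; exact not_le.2 (hj m hm))
  rw [map_sub, sub_eq_zero] at this
  rw [this]

/-! ### Inverse maps -/

theorem exists_eq_single_add {k : ℕ} {d : Fin k →₀ ℕ} (hd : d ≠ 0) :
    ∃ (s : Fin k) (e : Fin k →₀ ℕ), d = Finsupp.single s 1 + e := by
  obtain ⟨s, hs⟩ := Finsupp.ne_iff.1 hd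
  refine ⟨s, d - Finsupp.single s 1, ?_⟩
  rw [add_tsub_cancel_of_le]
  rw [Finsupp.single_le_iff]
  exact Nat.one_le_iff_ne_zero.2 hs

/-- Substitution into a series of order at least two is a contraction. -/
theorem subst_sub_subst_mem_degGE_succ {k l p : ℕ} {a b : Fin k → Ser l}
    (ha : ∀ i, constantCoeff (a i) = 0) (hb : ∀ i, constantCoeff (b i) = 0)
    (h : ∀ i, a i - b i ∈ supp (degGE l p)) {f : Ser k} (hf : f ∈ supp (degGE k 2)) :
    subst a f - subst b f ∈ supp (degGE l (p + 1)) := by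
  refine subst_sub_subst_mem_supp ha hb fun d hd => ?_
  have hd2 : 2 ≤ d.degree := by_contra fun h0 => hd (hf d h0)
  obtain ⟨s, e, rfl⟩ := exists_eq_single_add (d := d) (by rintro rfl; simp at hd2)
  rw [map_add, Finsupp.degree_single] at hd2
  -- One variable factor is split off; in each of the two telescoped products a difference of order
  -- p is multiplied by a factor of order at least one.
  rw [mon_add, mon_add, mon_single, mon_single, pow_one, pow_one,
    show a s * mon a e - b s * mon b e = (mon a e - mon b e) * a s + (a s - b s) * mon b e by ring]
  refine add_mem (supp_degGE_mul (mon_sub_mon_mem _ h e) (mem_supp_degGE_one.2 (ha s)))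
    (supp_degGE_mul (h s) (supp_mono (fun m hm => ?_) (mon_mem_supp_degGE hb e)))
  rw [mem_degGE] at *
  omega

theorem constantCoeff_of_sub_mem {k : ℕ} {a : Fin k → Ser k}
    (h : ∀ i, a i - X i ∈ supp (degGE k 2)) (i : Fin k) : constantCoeff (a i) = 0 := by
  have := mem_supp_degGE_one.1 (supp_mono (fun m (hm : 2 ≤ _) => by
    rw [mem_degGE]; omega) (h i))
  simpa using this

/-- The inverse is the fixed point of b ↦ X - (a - X)(b), which is a contraction in the degree
topology because a - X has order at least two. For convergent a the same iteration stays in a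
bounded set for the weighted norm, so the limit converges too. -/
theorem exists_right_inverse {k : ℕ} {a : Fin k → Ser k}
    (h : ∀ i, a i - X i ∈ supp (degGE k 2)) :
    ∃ b : Fin k → Ser k, (∀ i, b i - X i ∈ supp (degGE k 2)) ∧ (∀ i, subst b (a i) = X i) ∧
      ((∀ i, IsConvergent (a i)) → ∀ i, IsConvergent (b i)) := by
  obtain ⟨T, hT00, hT⟩ : ∃ T : ℕ → Fin k → Ser k, (∀ i, T 0 i = X i) ∧
      ∀ j i, T (j + 1) i = X i - subst (T j) (a i - X i) :=
    ⟨fun j => Nat.rec (fun i => X i) (fun _ τ i => X i - subst τ (a i - X i)) j,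
      fun _ => rfl, fun _ _ => rfl⟩
  have hT2 : ∀ j i, T j i - X i ∈ supp (degGE k 2) := fun j => by
    induction j with
    | zero => exact fun i => by rw [hT00, sub_self]; exact zero_mem _
    | succ j ih =>
      intro i
      rw [hT, sub_sub_cancel_left]
      exact neg_mem (subst_mem_supp_degGE (constantCoeff_of_sub_mem ih) (h i))
  have hT0 := fun j => constantCoeff_of_sub_mem (hT2 j)
  have hstep : ∀ j i, T (j + 1) i - T j i ∈ supp (degGE k j) := fun j => by
    induction j with
    | zero => exact fun i m hm => absurd (Nat.zero_le _) hm
    | succ j ih =>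
      intro i
      rw [hT (j + 1), hT j, sub_sub_sub_cancel_left, ← neg_sub]
      exact neg_mem (subst_sub_subst_mem_degGE_succ (hT0 _) (hT0 _) ih (h i))
  choose b hb using fun i => exists_limit (fun j => T j i) (fun j => hstep j i)
  have hb2 : ∀ i, b i - X i ∈ supp (degGE k 2) := fun i => by
    rw [← sub_add_sub_cancel _ (T 2 i)]
    exact add_mem (hb i 2) (hT2 2 i)
  have hb0 := constantCoeff_of_sub_mem hb2
  refine ⟨b, hb2, fun i => ?_, fun hc i => ?_⟩
  · have : b i - (X i - subst b (a i - X i)) = 0 := by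
      refine eq_zero_of_mem_supp_degGE fun j => ?_
      rw [show b i - (X i - subst b (a i - X i)) = (b i - T (j + 1) i) +
        (subst b (a i - X i) - subst (T j) (a i - X i)) by rw [hT]; ring]
      refine add_mem (supp_mono (fun m (hm : j + 1 ≤ _) => ?_) (hb i (j + 1)))
        (subst_sub_subst_mem_supp' hb0 (hT0 j) (fun i => hb i j) _)
      rw [mem_degGE]
      omega
    rw [subst_sub (hasSubst hb0), subst_X (hasSubst hb0)] at this
    linear_combination this
  · have hev : ∀ᶠ ε in 𝓝[>] (0 : ℝ≥0), ∀ i, wnorm ε (a i - X i) ≠ ∞ :=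
      eventually_all.2 fun i => isConvergent_iff_eventually.1 ((hc i).sub (isConvergent_X i))
    obtain ⟨r, hr, hrpos⟩ := (hev.and self_mem_nhdsWithin).exists
    have hrpos : 0 < r := hrpos
    have hA : ∀ i, ∃ A : ℝ≥0, (A : ℝ≥0∞) = wnorm r (a i - X i) :=
      fun i => ⟨_, ENNReal.coe_toNNReal (hr i)⟩
    choose A hA using hA
    let B : ℝ≥0 := ∑ i, A i
    have hB : ∀ i, A i ≤ B := fun i => Finset.single_le_sum (fun _ _ => zero_le) (Finset.mem_univ i)
    -- `s` is the ratio `2 ε / r`, chosen so small that `s ^ 2 * B ≤ ε`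
    let s : ℝ≥0 := min 1 (r / (2 * (B + 1)))
    have hs : 0 < s := lt_min one_pos (by positivity)
    let ε : ℝ≥0 := s * r / 2
    have hε : 0 < ε := by positivity
    have hsB : s ^ 2 * B ≤ ε := by
      have h1 : s * B ≤ r / 2 := by
        calc s * B ≤ r / (2 * (B + 1)) * (B + 1) := by
              gcongr
              · exact min_le_right _ _
              · exact le_self_add
          _ = r / 2 := by field_simp
      calc s ^ 2 * B = s * (s * B) := by ring
        _ ≤ s * (r / 2) := by gcongr
        _ = ε := by simp only [ε]; ring
    have hbound : ∀ j i, wnorm ε (T j i) ≤ (2 * ε : ℝ≥0) := fun j => by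
      induction j with
      | zero =>
        intro i
        rw [hT00, wnorm_X]
        norm_cast
        rw [two_mul]
        exact le_self_add
      | succ j ih =>
        intro i
        rw [hT]
        refine (wnorm_sub_le _ _ _).trans ?_
        rw [wnorm_X, two_mul, ENNReal.coe_add]
        gcongr
        refine (wnorm_subst_le (hT0 j) ih _).trans ?_
        -- The iterates have norm at most s r, so order two of a - X bounds the correction by s² B ≤
        -- ε, and ε + ε = 2 ε closes the induction.
        have : 2 * ε = s * r := by simp only [ε]; ring
        rw [this]
        refine (wnorm_mul_le_of_mem (h i) (min_le_left _ _) r).trans ?_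
        rw [← hA i]
        norm_cast
        refine le_trans ?_ hsB
        gcongr
        exact hB i
    rw [isConvergent_iff]
    exact ⟨ε, hε, ne_top_of_le_ne_top ENNReal.coe_ne_top
      (wnorm_le_of_limit (hb i) fun j => hbound j i)⟩

/-- The inverse function theorem for maps tangent to the identity. -/
theorem exists_inverse {k : ℕ} {a : Fin k → Ser k} (h : ∀ i, a i - X i ∈ supp (degGE k 2)) :
    ∃ b : Fin k → Ser k, (∀ i, b i - X i ∈ supp (degGE k 2)) ∧ (∀ i, subst b (a i) = X i) ∧
      (∀ i, subst a (b i) = X i) ∧ ((∀ i, IsConvergent (a i)) → ∀ i, IsConvergent (b i)) := by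
  obtain ⟨b, hb2, hab, hconv⟩ := exists_right_inverse h
  obtain ⟨c, hc2, hbc, -⟩ := exists_right_inverse hb2
  have ha0 := constantCoeff_of_sub_mem h
  have hb0 := constantCoeff_of_sub_mem hb2
  have hc0 := constantCoeff_of_sub_mem hc2
  -- The right inverse b itself has a right inverse c; associativity identifies c with a, so b is
  -- two-sided.
  have hac : a = c := by
    funext i
    have h1 : subst c (subst b (a i)) = a i := by
      rw [subst_subst hb0 hc0]
      simp_rw [hbc]
      exact subst_id _
    rw [← h1, hab, subst_X (hasSubst hc0)]
  exact ⟨b, hb2, hab, fun i => by rw [hac]; exact hbc i, hconv⟩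

theorem exists_one_add_pow_eq {R : Type*} [CommRing R] (x : R) (n : ℕ) :
    ∃ c : R, (1 + x) ^ n = 1 + n * x + x ^ 2 * c := by
  induction n with
  | zero => exact ⟨0, by simp⟩
  | succ n ih =>
    obtain ⟨c, hc⟩ := ih
    refine ⟨n + c + x * c, ?_⟩
    rw [pow_succ, hc]
    push_cast
    ring

theorem natCast_eq_C {k : ℕ} (n : ℕ) : (n : Ser k) = C (n : ℂ) := (map_natCast C n).symm

/-- The `n`-th root of a power series with constant coefficient one. -/
theorem exists_root {k n : ℕ} (hn : 0 < n) {w : Ser k} (hw : constantCoeff w = 0)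
    (hc : IsConvergent w) :
    ∃ v : Ser k, constantCoeff v = 0 ∧ IsConvergent v ∧ (1 + v) ^ n = 1 + w := by
  have hn0 : (n : ℂ) ≠ 0 := by exact_mod_cast hn.ne'
  have hCn : (C (n : ℂ)⁻¹ : Ser 1) * (n : Ser 1) = 1 := by
    rw [natCast_eq_C, ← map_mul, inv_mul_cancel₀ hn0, map_one]
  -- The one-variable series ((1 + X)^n - 1)/n is tangent to the identity; the root is its inverse
  -- evaluated at w/n.
  let a : Fin 1 → Ser 1 := fun i => C (n : ℂ)⁻¹ * ((1 + X i) ^ n - 1)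
  obtain ⟨b, hb2, hb, -, hbc⟩ := exists_inverse (a := a) fun i => by
    obtain ⟨c, hc⟩ := exists_one_add_pow_eq (X i : Ser 1) n
    have : a i - X i = X i ^ 2 * (C (n : ℂ)⁻¹ * c) := by
      simp only [a]
      rw [hc]
      linear_combination X i * hCn
    rw [this]
    have h2 : (X i : Ser 1) ^ 2 ∈ supp (degGE 1 (2 * 1)) :=
      pow_mem_supp_degGE (mem_supp_degGE_one.2 (constantCoeff_X i)) 2
    exact Ideal.mul_mem_right _ _ h2
  have hb0 := constantCoeff_of_sub_mem hb2
  have hbconv := hbc fun i => (isConvergent_C _).mul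
    (((isConvergent_one.add (isConvergent_X i)).pow n).sub isConvergent_one)
  let u : Fin 1 → Ser k := fun _ => C (n : ℂ)⁻¹ * w
  have hu : ∀ i, constantCoeff (u i) = 0 := fun i => by simp [u, hw]
  refine ⟨subst u (b 0), constantCoeff_subst_zero hu (hb0 0),
    (hbconv 0).subst hu fun i => (isConvergent_C _).mul hc, ?_⟩
  have h1 := congrArg (subst u) (hb 0)
  rw [subst_X (hasSubst hu)] at h1
  simp only [a, u] at h1
  rw [subst_mul (hasSubst hb0), subst_sub (hasSubst hb0), subst_pow (hasSubst hb0),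
    subst_add (hasSubst hb0), subst_X (hasSubst hb0), subst_one hb0, subst_C' hb0,
    subst_mul (hasSubst hu), subst_sub (hasSubst hu), subst_pow (hasSubst hu),
    subst_add (hasSubst hu), subst_one hu, subst_C' hu] at h1
  have hCk : (n : Ser k) * C (n : ℂ)⁻¹ = 1 := by
    rw [natCast_eq_C, ← map_mul, mul_inv_cancel₀ hn0, map_one]
  linear_combination (n : Ser k) * h1 + (1 + w - (1 + subst u (b 0)) ^ n) * hCk

/-! ### Stability of quasi-ordinary parameterizations -/

theorem IsDominantExponent.unique {k : ℕ} {q : Ser k} {l l' : Fin k →₀ ℕ}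
    (h : IsDominantExponent q l) (h' : IsDominantExponent q l') : l = l' :=
  le_antisymm (h.2 _ h'.1) (h'.2 _ h.1)

theorem IsDominantExponent.ne_zero {k : ℕ} {q : Ser k} {l : Fin k →₀ ℕ}
    (h : IsDominantExponent q l) : q ≠ 0 := by
  rintro rfl
  exact h.1 (map_zero _)

/-- The coincidences and the contact orders of the conjugates of `S` persist for `S'`. -/
def ConjStable {r : ℕ} (n : ℕ) (S S' : Ser r) : Prop :=
  ∀ ω ω' : Fin r → ℂ, (∀ i, ω i ^ n = 1) → (∀ i, ω' i ^ n = 1) →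
    (rescale ω S = rescale ω' S → rescale ω S' = rescale ω' S') ∧
    ∀ l, IsDominantExponent (rescale ω S - rescale ω' S) l →
      IsDominantExponent (rescale ω S' - rescale ω' S') l

/-- The assignment sending a conjugate of S to the conjugate of S' with the same ω is a well-defined
bijection that preserves contact exponents. Injectivity needs no extra hypothesis: distinct
conjugates of S have a dominant exponent of contact, which persists and keeps the images distinct.
-/
theorem IsFormalQOParam.of_conjStable {r g n : ℕ} {lam : Fin g → Fin r →₀ ℕ} {S S' : Ser r}
    (hS : IsFormalQOParam n lam S) (h : ConjStable n S S') (h0 : constantCoeff S' = 0) :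
    IsFormalQOParam n lam S' := by
  have hdom : ∀ ω ω' : Fin r → ℂ, (∀ i, ω i ^ n = 1) → (∀ i, ω' i ^ n = 1) →
      rescale ω S' ≠ rescale ω' S' → ∃ l, IsDominantExponent (rescale ω S - rescale ω' S) l ∧
        IsDominantExponent (rescale ω S' - rescale ω' S') l := fun ω ω' hω hω' hne => by
    obtain ⟨l, hl⟩ := hS.quasiOrdinary _ ⟨ω, hω, rfl⟩ _ ⟨ω', hω', rfl⟩
      fun h1 => hne ((h ω ω' hω hω').1 h1)
    exact ⟨l, hl, (h ω ω' hω hω').2 l hl⟩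
  have hne : ∀ ω ω' : Fin r → ℂ, (∀ i, ω i ^ n = 1) → (∀ i, ω' i ^ n = 1) →
      rescale ω S ≠ rescale ω' S → rescale ω S' ≠ rescale ω' S' := fun ω ω' hω hω' hne => by
    obtain ⟨l, hl⟩ := hS.quasiOrdinary _ ⟨ω, hω, rfl⟩ _ ⟨ω', hω', rfl⟩ hne
    exact sub_ne_zero.1 ((h ω ω' hω hω').2 l hl).ne_zero
  refine ⟨hS.pos, h0, ?_, ?_, hS.strictMono, ?_⟩
  · refine (Eq.symm ?_).trans hS.degree
    refine Set.ncard_congr (fun T hT => rescale hT.choose S')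
      (fun T hT => ⟨hT.choose, hT.choose_spec.1, rfl⟩) (fun T T' hT hT' heq => ?_)
      (fun T' hT' => ?_)
    · by_contra hTT
      rw [hT.choose_spec.2, hT'.choose_spec.2] at hTT
      exact hne _ _ hT.choose_spec.1 hT'.choose_spec.1 hTT heq
    · obtain ⟨ω, hω, rfl⟩ := hT'
      have hT : rescale ω S ∈ conjugates n S := ⟨ω, hω, rfl⟩
      exact ⟨_, hT, (h _ _ hT.choose_spec.1 hω).1 hT.choose_spec.2.symm⟩
  · rintro T ⟨ω, hω, rfl⟩ T' ⟨ω', hω', rfl⟩ hTT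
    obtain ⟨l, -, hl⟩ := hdom ω ω' hω hω' hTT
    exact ⟨l, hl⟩
  · rw [hS.range_eq]
    ext l
    constructor
    · rintro ⟨T, ⟨ω, hω, rfl⟩, T', ⟨ω', hω', rfl⟩, hTT, hl⟩
      exact ⟨_, ⟨ω, hω, rfl⟩, _, ⟨ω', hω', rfl⟩, hne ω ω' hω hω' hTT, (h ω ω' hω hω').2 l hl⟩
    · rintro ⟨T, ⟨ω, hω, rfl⟩, T', ⟨ω', hω', rfl⟩, hTT, hl⟩
      obtain ⟨l', h1, h2⟩ := hdom ω ω' hω hω' hTT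
      rw [hl.unique h2]
      exact ⟨_, ⟨ω, hω, rfl⟩, _, ⟨ω', hω', rfl⟩, sub_ne_zero.1 h1.ne_zero, h1⟩

theorem IsFormalNormalized.of_conjStable {r g n : ℕ} [NeZero g] {lam : Fin g → Fin r →₀ ℕ}
    {S S' : Ser r} (hS : IsFormalNormalized n lam S) (h : ConjStable n S S')
    (hd : IsDominantExponent S' (lam 0)) (h1 : coeff (lam 0) S' = 1) :
    IsFormalNormalized n lam S' := by
  refine ⟨hS.isFormalQOParam.of_conjStable h ?_, h1, hd, hS.lex, hS.large⟩
  rw [← coeff_zero_eq_constantCoeff_apply]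
  by_contra h0
  have h2 := hd.2 0 h0
  have h3 : lam 0 = 0 := le_antisymm h2 zero_le
  have := hS.isFormalQOParam.nonunit
  rw [← coeff_zero_eq_constantCoeff_apply, ← h3, hS.monic] at this
  exact one_ne_zero this

section Normalized

variable {r g n : ℕ} [NeZero g] {lam : Fin g → Fin r →₀ ℕ} {S : Ser r}

theorem IsFormalNormalized.ne_zero (hS : IsFormalNormalized n lam S) : lam 0 ≠ 0 := by
  intro h
  have h1 := hS.monic
  rw [h, coeff_zero_eq_constantCoeff_apply, hS.isFormalQOParam.nonunit] at h1
  exact zero_ne_one h1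

theorem IsFormalNormalized.mem_supp (hS : IsFormalNormalized n lam S) :
    S ∈ supp (UpperSet.Ici (lam 0)) := (isDominantExponent_iff.1 hS.dominant).2

/-- The first characteristic exponent is not divisible by `n`. -/
theorem IsFormalNormalized.not_dvd (hS : IsFormalNormalized n lam S) :
    ∃ i, ¬ n ∣ lam 0 i := by
  by_contra! hdvd
  have h0 : lam 0 ∈ charExponents n S := hS.isFormalQOParam.range_eq ▸ Set.mem_range_self 0
  obtain ⟨T, ⟨ω, hω, rfl⟩, T', ⟨ω', hω', rfl⟩, -, hl⟩ := h0
  apply hl.1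
  -- If n divided every entry of λ₁, then t^{λ₁} would be fixed by all rescalings and would cancel
  -- in every difference of conjugates, contradicting that λ₁ is characteristic.
  have key : ∀ ω : Fin r → ℂ, (∀ i, ω i ^ n = 1) → coeff (lam 0) (rescale ω S) = 1 :=
    fun ω hω => by
      rw [coeff_rescale, hS.monic, mul_one, Finsupp.prod]
      refine Finset.prod_eq_one fun i _ => ?_
      obtain ⟨q, hq⟩ := hdvd i
      rw [hq, pow_mul, hω, one_pow]
  rw [map_sub, key ω hω, key ω' hω', sub_self]

/-- If `λ₁` has only one nonzero entry, this entry is greater than `n`. -/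
theorem IsFormalNormalized.not_le_single (hS : IsFormalNormalized n lam S) (i : Fin r) :
    ¬ lam 0 ≤ Finsupp.single i n := by
  intro h
  have hj : ∀ j, j ≠ i → lam 0 j = 0 := fun j hji => by
    have := h j
    rwa [Finsupp.single_eq_of_ne hji, Nat.le_zero] at this
  have hi : lam 0 i ≠ 0 := fun h0 => hS.ne_zero (by
    ext j
    by_cases hji : j = i
    · rw [hji, h0]; rfl
    · rw [hj j hji]; rfl)
  -- The lexicographic condition forces the only nonzero entry of λ₁ to belong to the first
  -- variable, where `large` applies.
  have hi0 : (i : ℕ) = 0 := by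
    by_contra hne
    have hr : 0 < r := i.pos
    have hlt : (⟨0, hr⟩ : Fin r) < i := Fin.lt_def.2 (Nat.pos_of_ne_zero hne)
    have hlex := hS.lex _ _ hlt
    rcases hlex.lt_or_eq with hlt' | heq
    · obtain ⟨k, hk1, hk2⟩ := hlt'
      simp only [Pi.toLex_apply] at hk1 hk2
      rcases eq_or_ne k 0 with rfl | hk
      · rw [hj _ hlt.ne] at hk2
        omega
      · have := hk1 0 (pos_iff_ne_zero.2 hk)
        rw [hj _ hlt.ne] at this
        exact hi this
    · have := congrFun (toLex.injective heq) 0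
      beta_reduce at this
      rw [hj _ hlt.ne] at this
      exact hi this
  have h1 := hS.large i hi0 hj
  have h2 := h i
  rw [Finsupp.single_eq_same] at h2
  omega

end Normalized

/-! ### The parameterization map -/

theorem param_castSucc {r : ℕ} (n : ℕ) (S : Ser r) (i : Fin r) :
    param n S i.castSucc = X i ^ n := Fin.snoc_castSucc (α := fun _ => Ser r) _ _ _

theorem param_last {r : ℕ} (n : ℕ) (S : Ser r) : param n S (Fin.last r) = S :=
  Fin.snoc_last (α := fun _ => Ser r) _ _

theorem constantCoeff_param {r n : ℕ} (hn : 0 < n) {S : Ser r} (hS : constantCoeff S = 0)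
    (i : Fin (r + 1)) : constantCoeff (param n S i) = 0 := by
  induction i using Fin.lastCases with
  | last => rw [param_last, hS]
  | cast i => rw [param_castSucc, map_pow, constantCoeff_X, zero_pow hn.ne']

/-- The exponent of the pullback of the monomial `X^d`, where `X_{r+1}` has the weight `l`. -/
def wdeg {r : ℕ} (n : ℕ) (l : Fin r →₀ ℕ) (d : Fin (r + 1) →₀ ℕ) : Fin r →₀ ℕ :=
  (Finsupp.equivFunOnFinite.symm fun i : Fin r => n * d i.castSucc) + d (Fin.last r) • l

theorem wdeg_apply {r : ℕ} (n : ℕ) (l : Fin r →₀ ℕ) (d : Fin (r + 1) →₀ ℕ) (i : Fin r) :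
    wdeg n l d i = n * d i.castSucc + d (Fin.last r) * l i := rfl

theorem mon_param {r : ℕ} (n : ℕ) (S : Ser r) (d : Fin (r + 1) →₀ ℕ) :
    mon (param n S) d = (∏ i : Fin r, X i ^ (n * d i.castSucc)) * S ^ d (Fin.last r) := by
  rw [mon_eq, Fin.prod_univ_castSucc, param_last]
  simp_rw [param_castSucc, ← pow_mul]

theorem prod_X_pow {r : ℕ} (e : Fin r → ℕ) :
    ∏ i : Fin r, (X i : Ser r) ^ e i = monomial (Finsupp.equivFunOnFinite.symm e) 1 := by
  rw [← mon_X, mon_eq]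
  rfl

theorem mon_param_mem {r n : ℕ} {S : Ser r} {l : Fin r →₀ ℕ} (hS : S ∈ supp (UpperSet.Ici l))
    (d : Fin (r + 1) →₀ ℕ) : mon (param n S) d ∈ supp (UpperSet.Ici (wdeg n l d)) := by
  rw [mon_param, prod_X_pow]
  exact supp_Ici_mul (monomial_mem_supp (by simp) 1) (pow_mem_supp_Ici hS _)

/-- All monomials of the pullback of `h` are bigger than `l`, term by term. -/
def TermsAbove {r : ℕ} (n : ℕ) (l : Fin r →₀ ℕ) (h : Ser (r + 1)) : Prop :=
  ∀ d, coeff d h ≠ 0 → l < wdeg n l d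

theorem lt_wdeg {r n : ℕ} (hn : 0 < n) {l : Fin r →₀ ℕ} (hl : l ≠ 0) {d : Fin (r + 1) →₀ ℕ}
    (hd : d (Fin.last r) ≠ 0) (hd' : d ≠ Finsupp.single (Fin.last r) 1) : l < wdeg n l d := by
  have hle : l ≤ wdeg n l d := fun i => by
    rw [wdeg_apply]
    have := Nat.le_mul_of_pos_left (l i) (Nat.pos_of_ne_zero hd)
    omega
  refine lt_of_le_of_ne hle fun heq => hd' ?_
  have hi : ∀ i, l i = n * d i.castSucc + d (Fin.last r) * l i := fun i => by
    rw [← wdeg_apply, ← heq]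
  have h1 : d (Fin.last r) = 1 := by
    obtain ⟨i, h0⟩ := Finsupp.ne_iff.1 hl
    have h0 : l i ≠ 0 := h0
    have h2 := hi i
    by_contra hne
    have : 2 * l i ≤ d (Fin.last r) * l i := Nat.mul_le_mul_right _ (by omega)
    omega
  ext j
  induction j using Fin.lastCases with
  | last => rw [h1, Finsupp.single_eq_same]
  | cast i =>
    have h2 := hi i
    rw [h1, one_mul] at h2
    rw [Finsupp.single_eq_of_ne (Fin.castSucc_lt_last i).ne]
    have : n * d i.castSucc = 0 := by omega
    exact (Nat.mul_eq_zero.1 this).resolve_left hn.ne'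

theorem coeff_subst_mon {k l : ℕ} {a : Fin k → Ser l} (ha : ∀ i, constantCoeff (a i) = 0)
    (f : Ser k) (m : Fin l →₀ ℕ) :
    coeff m (subst a f) = ∑ᶠ d, coeff d f * coeff m (mon a d) := by
  rw [coeff_subst (hasSubst ha)]
  rfl

/-- At exponents not above λ₁, only X_{r+1} and monomials in X_1, …, X_r can contribute. The latter
pull back to distinct monomials with exponents in nℕ^r, which does not contain λ₁, so nothing
cancels and each of these coefficients of h must vanish. -/
theorem termsAbove_of_pullback {r g n : ℕ} [NeZero g] {lam : Fin g → Fin r →₀ ℕ} {S : Ser r}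
    (hS : IsFormalNormalized n lam S) {h : Ser (r + 1)}
    (hh : pullback n S h ∈ supp (UpperSet.Ioi (lam 0))) : TermsAbove n (lam 0) h := by
  have hn := hS.isFormalQOParam.pos
  have h0 := constantCoeff_param hn hS.isFormalQOParam.nonunit
  have habove : ∀ d m, lam 0 < wdeg n (lam 0) d → ¬ lam 0 < m →
      coeff m (mon (param n S) d) = 0 := fun d m hd hm =>
    mon_param_mem hS.mem_supp d m fun hle => hm (lt_of_lt_of_le hd (UpperSet.mem_Ici_iff.1 hle))
  have hmon : ∀ d, d (Fin.last r) = 0 → mon (param n S) d = monomial (wdeg n (lam 0) d) 1 :=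
    fun d hd => by
      rw [mon_param, hd, pow_zero, mul_one, prod_X_pow, wdeg, hd, zero_smul, add_zero]
  have hcase : ∀ d, lam 0 < wdeg n (lam 0) d ∨ d (Fin.last r) = 0 ∨
      d = Finsupp.single (Fin.last r) 1 := fun d => by
    by_cases h1 : d (Fin.last r) = 0
    · exact Or.inr (Or.inl h1)
    by_cases h2 : d = Finsupp.single (Fin.last r) 1
    · exact Or.inr (Or.inr h2)
    exact Or.inl (lt_wdeg hn hS.ne_zero h1 h2)
  -- The coefficient at λ₁ sees X_{r+1} alone.
  have hlast : coeff (Finsupp.single (Fin.last r) 1) h = 0 := by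
    have h1 := hh (lam 0) (by simp)
    rw [pullback, coeff_subst_mon h0,
      finsum_eq_single _ (Finsupp.single (Fin.last r) 1)] at h1
    · rw [mon_single, pow_one, param_last, hS.monic, mul_one] at h1
      exact h1
    · intro d hd
      rcases hcase d with h2 | h2 | h2
      · rw [habove d _ h2 (lt_irrefl _), mul_zero]
      · rw [hmon d h2, coeff_monomial_ne, mul_zero]
        intro heq
        obtain ⟨i, hi⟩ := hS.not_dvd
        apply hi
        have := DFunLike.congr_fun heq i
        rw [wdeg_apply, h2, zero_mul, add_zero] at this
        exact ⟨_, this⟩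
      · exact absurd h2 hd
  intro d hd
  by_contra hlt
  apply hd
  rcases hcase d with h2 | h2 | h2
  · exact absurd h2 hlt
  · have h1 := hh (wdeg n (lam 0) d) (by simpa using hlt)
    rw [pullback, coeff_subst_mon h0, finsum_eq_single _ d] at h1
    · rwa [hmon d h2, coeff_monomial_same, mul_one] at h1
    · intro e he
      rcases hcase e with h3 | h3 | h3
      · rw [habove e _ h3 hlt, mul_zero]
      · rw [hmon e h3, coeff_monomial_ne, mul_zero]
        intro heq
        apply he
        ext j
        induction j using Fin.lastCases with
        | last => rw [h2, h3]
        | cast i =>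
          have := DFunLike.congr_fun heq i
          rw [wdeg_apply, wdeg_apply, h2, h3, zero_mul, add_zero, add_zero] at this
          exact (Nat.eq_of_mul_eq_mul_left hn this).symm
      · rw [h3, hlast, zero_mul]
  · rw [h2, hlast]

/-! ### The group of coordinate changes in terms of exponents -/

/-- The exponents of the ideal `(X_i)`, respectively `(X_i, X_{r+1})` if `n ≤ l i`. -/
def mixedSet {r : ℕ} (n : ℕ) (l : Fin r →₀ ℕ) (i : Fin r) : UpperSet (Fin (r + 1) →₀ ℕ) where
  carrier := {m | m i.castSucc ≠ 0 ∨ (n ≤ l i ∧ m (Fin.last r) ≠ 0)}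
  upper' := fun a b h (h' : a i.castSucc ≠ 0 ∨ (n ≤ l i ∧ a (Fin.last r) ≠ 0)) => by
    have h1 := h i.castSucc
    have h2 := h (Fin.last r)
    show b i.castSucc ≠ 0 ∨ (n ≤ l i ∧ b (Fin.last r) ≠ 0)
    omega

theorem mem_mixedSet {r n : ℕ} {l : Fin r →₀ ℕ} {i : Fin r} {m : Fin (r + 1) →₀ ℕ} :
    m ∈ mixedSet n l i ↔ m i.castSucc ≠ 0 ∨ (n ≤ l i ∧ m (Fin.last r) ≠ 0) := Iff.rfl

/-- The exponents of the ideal `(X_{r+1}, X^α)`, `α_i = ⌈l i / n⌉`. -/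
def lastSet {r : ℕ} (n : ℕ) (l : Fin r →₀ ℕ) : UpperSet (Fin (r + 1) →₀ ℕ) where
  carrier := {m | m (Fin.last r) ≠ 0 ∨ ∀ i : Fin r, l i ≤ n * m i.castSucc}
  upper' := fun a b h (h' : a (Fin.last r) ≠ 0 ∨ ∀ i : Fin r, l i ≤ n * a i.castSucc) => by
    show b (Fin.last r) ≠ 0 ∨ ∀ i : Fin r, l i ≤ n * b i.castSucc
    rcases h' with h' | h'
    · have := h (Fin.last r)
      exact Or.inl (by omega)
    · exact Or.inr fun i => (h' i).trans (Nat.mul_le_mul_left n (h i.castSucc))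

theorem mem_lastSet {r n : ℕ} {l : Fin r →₀ ℕ} {m : Fin (r + 1) →₀ ℕ} :
    m ∈ lastSet n l ↔ m (Fin.last r) ≠ 0 ∨ ∀ i : Fin r, l i ≤ n * m i.castSucc := Iff.rfl

/-- The conditions defining `Ã₁`, expressed by the exponents of the components. -/
structure IsUnipotent {r : ℕ} (n : ℕ) (l : Fin r →₀ ℕ)
    (σ : Fin (r + 1) → Ser (r + 1)) (ρ : Fin r → Ser r) : Prop where
  monic : IsMonic ρ
  mem : ∀ i : Fin r, σ i.castSucc ∈ supp (mixedSet n l i)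
  jet : ∀ i : Fin r, ∃ d : ℂ, (l i < n → d = 0) ∧
    σ i.castSucc - (X i.castSucc + C d * X (Fin.last r)) ∈ supp (degGE (r + 1) 2)
  mem_last : σ (Fin.last r) ∈ supp (lastSet n l)
  jet_last : σ (Fin.last r) - X (Fin.last r) ∈ supp (degGE (r + 1) 2)

theorem sameOneJet_of_sub_mem {k : ℕ} {f f' : Ser k} (h : f - f' ∈ supp (degGE k 2)) :
    SameOneJet f f' := fun m hm => by
  have := h m (by rw [mem_degGE]; omega)
  rwa [map_sub, sub_eq_zero] at this

theorem SameOneJet.constantCoeff {k : ℕ} {f f' : Ser k} (h : SameOneJet f f') :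
    constantCoeff f = constantCoeff f' := by
  rw [← coeff_zero_eq_constantCoeff_apply, ← coeff_zero_eq_constantCoeff_apply]
  exact h 0 (by simp)

theorem SameOneJet.coeff_single {k : ℕ} {f f' : Ser k} (h : SameOneJet f f') (j : Fin k) :
    coeff (Finsupp.single j 1) f = coeff (Finsupp.single j 1) f' := h _ (by simp)

theorem coeff_single_X {k : ℕ} (i j : Fin k) :
    coeff (Finsupp.single j 1) (X i : Ser k) = if j = i then 1 else 0 := by
  rw [coeff_index_single_X]

theorem exists_eq_monomial_mul {k : ℕ} {a : Fin k →₀ ℕ} {f : Ser k}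
    (h : f ∈ supp (UpperSet.Ici a)) :
    ∃ q : Ser k, f = monomial a 1 * q ∧ ∀ m, coeff m q = coeff (a + m) f := by
  classical
  let q : Ser k := fun m => coeff (a + m) f
  have hq : ∀ m, coeff m q = coeff (a + m) f := fun _ => rfl
  refine ⟨q, ?_, hq⟩
  ext m
  rw [coeff_monomial_mul]
  split_ifs with ham
  · rw [hq, add_tsub_cancel_of_le ham, one_mul]
  · exact h m (by rwa [UpperSet.mem_Ici_iff])

/-- All terms divisible by the first monomial go into p, the rest into q. Knowing the coefficients
of p later shows that the series ε of the group has no constant term. -/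
theorem exists_eq_monomial_mul_add {k : ℕ} {U : UpperSet (Fin k →₀ ℕ)} {a b : Fin k →₀ ℕ}
    (hU : ∀ m ∈ U, a ≤ m ∨ b ≤ m) {f : Ser k} (h : f ∈ supp U) :
    ∃ p q : Ser k, f = monomial a 1 * p + monomial b 1 * q ∧
      ∀ m, coeff m p = coeff (a + m) f := by
  classical
  let f₁ : Ser k := fun m => if a ≤ m then coeff m f else 0
  have hf₁ : ∀ m, coeff m f₁ = if a ≤ m then coeff m f else 0 := fun _ => rfl
  obtain ⟨p, hp, hp'⟩ := exists_eq_monomial_mul (a := a) (f := f₁) fun m hm => by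
    rw [hf₁, if_neg (by simpa using hm)]
  obtain ⟨q, hq, -⟩ := exists_eq_monomial_mul (a := b) (f := f - f₁) fun m hm => by
    rw [map_sub, hf₁]
    split_ifs with ham
    · exact sub_self _
    · rw [h m fun hmU => (hU m hmU).elim ham (by simpa using hm), sub_zero]
  refine ⟨p, q, by rw [← hp, ← hq, add_sub_cancel], fun m => ?_⟩
  rw [hp', hf₁, if_pos le_self_add]

theorem IsMonic.sub_mem {k : ℕ} {a : Fin k → Ser k} (ha : IsMonic a) (i : Fin k) :
    a i - X i ∈ supp (degGE k 2) := by
  obtain ⟨v, hv, h⟩ := ha i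
  rw [h, mul_add, mul_one, add_sub_cancel_left]
  exact supp_degGE_mul (p := 1) (q := 1) (mem_supp_degGE_one.2 (constantCoeff_X i))
    (mem_supp_degGE_one.2 hv)

theorem IsUnipotent.constantCoeff {r n : ℕ} {l : Fin r →₀ ℕ} {σ : Fin (r + 1) → Ser (r + 1)}
    {ρ : Fin r → Ser r} (h : IsUnipotent n l σ ρ) (j : Fin (r + 1)) :
    MvPowerSeries.constantCoeff (σ j) = 0 := by
  induction j using Fin.lastCases with
  | last => rw [(sameOneJet_of_sub_mem h.jet_last).constantCoeff, constantCoeff_X]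
  | cast i =>
    obtain ⟨d, -, hd⟩ := h.jet i
    rw [(sameOneJet_of_sub_mem hd).constantCoeff]
    simp

theorem prod_castSucc_X_pow {r : ℕ} (e : Fin r → ℕ) :
    ∏ i : Fin r, (X i.castSucc : Ser (r + 1)) ^ e i =
      monomial (Finsupp.equivFunOnFinite.symm (Fin.snoc (α := fun _ => ℕ) e 0)) 1 := by
  rw [← mon_X, mon_eq, Fin.prod_univ_castSucc]
  simp

/-- The prescribed one-jets make the Jacobian of σ upper triangular with unit diagonal and that of ρ
the identity. All leading constants are 1, and ε, η arise from σ_j - X_j by sorting monomials. The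
support conditions are the form that is easily composed and passed to limits. -/
theorem IsUnipotent.inFormalTildeA₁ {r n : ℕ} (hn : 0 < n) {l : Fin r →₀ ℕ}
    {σ : Fin (r + 1) → Ser (r + 1)} {ρ : Fin r → Ser r} (h : IsUnipotent n l σ ρ) :
    InFormalTildeA₁ n l σ ρ := by
  choose d hd hd2 using h.jet
  have hjet := fun i => sameOneJet_of_sub_mem (hd2 i)
  have hjl := sameOneJet_of_sub_mem h.jet_last
  have hρ := fun i => sameOneJet_of_sub_mem (h.monic.sub_mem i)
  refine ⟨⟨⟨h.constantCoeff, ?_⟩, ⟨h.monic.constantCoeff, ?_⟩, fun i => ?_, fun i => ?_, ?_⟩,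
    fun i => ⟨d i, hd i, hjet i⟩, hjl, hρ⟩
  · rw [Matrix.det_of_isUpperTriangular]
    · refine IsUnit.of_mul_eq_one 1 ?_
      rw [mul_one]
      refine Finset.prod_eq_one fun j _ => ?_
      rw [Matrix.of_apply]
      induction j using Fin.lastCases with
      | last => rw [hjl.coeff_single, coeff_single_X, if_pos rfl]
      | cast i =>
        rw [(hjet i).coeff_single, map_add, coeff_C_mul, coeff_single_X, coeff_single_X,
          if_pos rfl, if_neg (Fin.castSucc_lt_last i).ne, mul_zero, add_zero]
    · intro i j hij
      rw [id, id] at hij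
      rw [Matrix.of_apply]
      induction i using Fin.lastCases with
      | last => rw [hjl.coeff_single, coeff_single_X, if_neg hij.ne]
      | cast i =>
        rw [(hjet i).coeff_single, map_add, coeff_C_mul, coeff_single_X, coeff_single_X,
          if_neg hij.ne, if_neg (hij.trans_le (Fin.le_last _)).ne, mul_zero, add_zero]
  · have : (Matrix.of fun i j : Fin r => coeff (Finsupp.single j 1) (ρ i)) = 1 := by
      ext i j
      rw [Matrix.of_apply, (hρ i).coeff_single, coeff_single_X, Matrix.one_apply]
      exact if_congr eq_comm rfl rfl
    rw [this, Matrix.det_one]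
    exact isUnit_one
  · obtain ⟨v, hv, hv'⟩ := h.monic i
    exact ⟨1, v, one_ne_zero, hv, by rw [hv', map_one]⟩
  · have hf : σ i.castSucc - X i.castSucc ∈ supp (mixedSet n l i) :=
      sub_mem (h.mem i) (monomial_mem_supp (by simp [mem_mixedSet]) 1)
    -- This coefficient is the constant term of ε.
    have hc : coeff (Finsupp.single i.castSucc 1) (σ i.castSucc - X i.castSucc) = 0 := by
      rw [map_sub, (hjet i).coeff_single, map_add, coeff_C_mul, coeff_single_X, coeff_single_X,
        if_pos rfl, if_neg (Fin.castSucc_lt_last i).ne, mul_zero, add_zero, sub_self]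
    by_cases hi : l i < n
    · obtain ⟨ε, hε, hε'⟩ := exists_eq_monomial_mul (a := Finsupp.single i.castSucc 1)
        (supp_mono (fun m hm => by
          rw [mem_mixedSet] at hm
          rw [UpperSet.mem_Ici_iff, Finsupp.single_le_iff]
          omega) hf)
      refine ⟨1, ε, 0, one_ne_zero, ?_, fun _ => rfl, ?_⟩
      · rw [← coeff_zero_eq_constantCoeff_apply, hε', add_zero, hc]
      · rw [map_one, one_mul, mul_zero, add_zero, X_def, ← hε, ← X_def, add_sub_cancel]
    · obtain ⟨ε, η, hε, hε'⟩ := exists_eq_monomial_mul_add (a := Finsupp.single i.castSucc 1)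
        (b := Finsupp.single (Fin.last r) 1) (fun m hm => by
          rw [mem_mixedSet] at hm
          rw [Finsupp.single_le_iff, Finsupp.single_le_iff]
          omega) hf
      refine ⟨1, ε, η, one_ne_zero, ?_, fun h => absurd h hi, ?_⟩
      · rw [← coeff_zero_eq_constantCoeff_apply, hε', add_zero, hc]
      · rw [map_one, one_mul, X_def (Fin.last r), X_def i.castSucc, ← hε, ← X_def, add_sub_cancel]
  · have hf : σ (Fin.last r) - X (Fin.last r) ∈ supp (lastSet n l) :=
      sub_mem h.mem_last (monomial_mem_supp (by simp [mem_lastSet]) 1)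
    rw [prod_castSucc_X_pow]
    obtain ⟨ε, η, hε, hε'⟩ := exists_eq_monomial_mul_add (a := Finsupp.single (Fin.last r) 1)
      (b := Finsupp.equivFunOnFinite.symm (Fin.snoc (α := fun _ => ℕ)
        (fun i : Fin r => ⌈(l i : ℚ) / (n : ℚ)⌉₊) 0)) (fun m hm => by
          rw [mem_lastSet] at hm
          refine hm.imp (fun hm => ?_) fun hm j => ?_
          · rw [Finsupp.single_le_iff]
            omega
          · induction j using Fin.lastCases with
            | last => simp
            | cast i =>
              rw [Finsupp.equivFunOnFinite_symm_apply_apply, Fin.snoc_castSucc, Nat.ceil_le,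
                div_le_iff₀ (by exact_mod_cast hn)]
              have := hm i
              rw [mul_comm] at this
              exact_mod_cast this) hf
    refine ⟨1, ε, η, one_ne_zero, ?_, ?_⟩
    · rw [← coeff_zero_eq_constantCoeff_apply, hε', add_zero, map_sub, hjl.coeff_single, sub_self]
    · rw [map_one, one_mul, X_def, ← hε, ← X_def, add_sub_cancel]

/-- The identity. -/
theorem isUnipotent_X {r : ℕ} (n : ℕ) (l : Fin r →₀ ℕ) :
    IsUnipotent n l (fun j => X j) (fun i => X i) where
  monic := fun i => ⟨0, by simp, by simp⟩
  mem := fun i => monomial_mem_supp (by simp [mem_mixedSet]) 1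
  jet := fun i => ⟨0, fun _ => rfl, by simp⟩
  mem_last := monomial_mem_supp (by simp [mem_lastSet]) 1
  jet_last := by simp

/-! ### Conjugates and substitution -/

theorem rescale_X' {k : ℕ} (ω : Fin k → ℂ) (i : Fin k) :
    rescale ω (X i : Ser k) = C (ω i) * X i := by
  classical
  ext m
  rw [coeff_rescale, coeff_C_mul, coeff_X]
  split_ifs with h
  · rw [h]
    simp
  · simp

theorem constantCoeff_rescale {k : ℕ} (ω : Fin k → ℂ) (f : Ser k) :
    constantCoeff (rescale ω f) = constantCoeff f := by
  rw [← coeff_zero_eq_constantCoeff_apply, ← coeff_zero_eq_constantCoeff_apply, coeff_rescale,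
    Finsupp.prod_zero_index, one_mul]

theorem rescale_mem_supp {k : ℕ} (ω : Fin k → ℂ) {U : UpperSet (Fin k →₀ ℕ)} {f : Ser k}
    (h : f ∈ supp U) : rescale ω f ∈ supp U := fun m hm => by
  rw [coeff_rescale, h m hm, mul_zero]

theorem rescale_subst {k l : ℕ} (ω : Fin l → ℂ) {a : Fin k → Ser l}
    (ha : ∀ i, constantCoeff (a i) = 0) (f : Ser k) :
    rescale ω (subst a f) = subst (fun i => rescale ω (a i)) f := by
  have h : ∀ i, constantCoeff ((ω • X : Fin l → Ser l) i) = 0 := fun i => by simp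
  simp_rw [rescale_eq_subst ω]
  rw [subst_subst ha h]

theorem subst_rescale {k l : ℕ} (ω : Fin k → ℂ) {a : Fin k → Ser l}
    (ha : ∀ i, constantCoeff (a i) = 0) (f : Ser k) :
    subst a (rescale ω f) = subst (fun i => C (ω i) * a i) f := by
  have h : ∀ i, constantCoeff ((ω • X : Fin k → Ser k) i) = 0 := fun i => by simp
  rw [rescale_eq_subst ω, subst_subst h ha]
  congr 1
  funext i
  rw [Pi.smul_apply', smul_eq_C_mul, subst_mul (hasSubst ha), subst_C' ha, subst_X (hasSubst ha)]

theorem rescale_param {r n : ℕ} {ω : Fin r → ℂ} (hω : ∀ i, ω i ^ n = 1) (S : Ser r)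
    (j : Fin (r + 1)) : rescale ω (param n S j) = param n (rescale ω S) j := by
  induction j using Fin.lastCases with
  | last => rw [param_last, param_last]
  | cast i => rw [param_castSucc, param_castSucc, map_pow, rescale_X', mul_pow, ← map_pow, hω,
      map_one, one_mul]

/-- Rescaling by n-th roots of unity fixes every t_i^n, so it moves only S. -/
theorem rescale_pullback {r n : ℕ} (hn : 0 < n) {ω : Fin r → ℂ} (hω : ∀ i, ω i ^ n = 1)
    {S : Ser r} (hS : constantCoeff S = 0) (h : Ser (r + 1)) :
    rescale ω (pullback n S h) = pullback n (rescale ω S) h := by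
  rw [pullback, rescale_subst ω (constantCoeff_param hn hS), pullback]
  simp_rw [rescale_param hω S]

theorem IsDominantExponent.sub_of_mem {k : ℕ} {f g : Ser k} {l : Fin k →₀ ℕ}
    (hf : IsDominantExponent f l) (hg : g ∈ supp (UpperSet.Ioi l)) :
    IsDominantExponent (f - g) l := by
  rw [isDominantExponent_iff] at *
  refine ⟨?_, sub_mem hf.2 (supp_mono (fun m hm => ?_) hg)⟩
  · rw [map_sub, hg l (by simp), sub_zero]
    exact hf.1
  · rw [UpperSet.mem_Ici_iff]
    exact (UpperSet.mem_Ioi_iff.1 hm).le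

theorem TermsAbove.pullback_mem {r n : ℕ} (hn : 0 < n) {l : Fin r →₀ ℕ} {h : Ser (r + 1)}
    (hh : TermsAbove n l h) {S : Ser r} (h0 : constantCoeff S = 0)
    (hS : S ∈ supp (UpperSet.Ici l)) : pullback n S h ∈ supp (UpperSet.Ioi l) :=
  subst_mem_supp (constantCoeff_param hn h0) fun d hd => supp_mono (fun m hm => by
    rw [UpperSet.mem_Ici_iff] at hm
    rw [UpperSet.mem_Ioi_iff]
    exact lt_of_lt_of_le (hh d hd) hm) (mon_param_mem hS d)

/-- For each monomial of h involving X_{r+1}, the difference of its two values is T - T' times a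
nonunit: for exponent one of X_{r+1} another variable must occur, and for higher powers T and T'
supply the nonunit. -/
theorem TermsAbove.pullback_sub_mem {r n : ℕ} (hn : 0 < n) {l l' : Fin r →₀ ℕ}
    {h : Ser (r + 1)} (hh : TermsAbove n l h) {T T' : Ser r} (h0 : constantCoeff T = 0)
    (h0' : constantCoeff T' = 0) (hT : T - T' ∈ supp (UpperSet.Ici l')) :
    pullback n T h - pullback n T' h ∈ supp (UpperSet.Ioi l') := by
  have hIoi : ∀ a ∈ UpperSet.Ici l', ∀ b, a < b → b ∈ UpperSet.Ioi l' := fun a ha b hb => by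
    rw [UpperSet.mem_Ici_iff] at ha
    exact lt_of_le_of_lt ha hb
  refine subst_sub_subst_mem_supp (constantCoeff_param hn h0) (constantCoeff_param hn h0')
    fun d hd => ?_
  rw [mon_param, mon_param, ← mul_sub]
  rcases hp : d (Fin.last r) with - | - | p
  · rw [pow_zero, pow_zero, sub_self, mul_zero]
    exact zero_mem _
  · rw [zero_add, pow_one, pow_one, mul_comm]
    refine mul_mem_supp_of_constantCoeff hIoi hT ?_
    by_contra hne
    rw [map_prod, ← ne_eq, Finset.prod_ne_zero_iff] at hne
    have hd0 : ∀ i : Fin r, n * d i.castSucc = 0 := fun i => by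
      have := hne i (Finset.mem_univ i)
      rw [map_pow, constantCoeff_X] at this
      by_contra h1
      exact this (zero_pow h1)
    -- Without another variable the monomial would be X_{r+1}, whose weight equals l.
    refine (hh d hd).ne ?_
    ext i
    rw [wdeg_apply, hd0, hp]
    simp
  · refine Ideal.mul_mem_left _ _ ?_
    rw [show T ^ (p + 1 + 1) - T' ^ (p + 1 + 1) =
      (T ^ (p + 1) - T' ^ (p + 1)) * T' + (T - T') * T ^ (p + 1) by ring]
    exact add_mem (mul_mem_supp_of_constantCoeff hIoi (pow_sub_pow_mem _ hT _) h0')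
      (mul_mem_supp_of_constantCoeff hIoi hT (by rw [map_pow, h0, zero_pow p.succ_ne_zero]))

/-! ### The elimination steps -/

/-- The coordinate change `(σ, ρ)` carries `S` to a normalized parameterization `S'` without the
exponent `γ`, and changes no other coefficients than those with exponents in `U`. -/
structure Eliminates {r g : ℕ} [NeZero g] (n : ℕ) (lam : Fin g → Fin r →₀ ℕ) (S : Ser r)
    (γ : Fin r →₀ ℕ) (U : UpperSet (Fin r →₀ ℕ)) (σ : Fin (r + 1) → Ser (r + 1))
    (ρ : Fin r → Ser r) (S' : Ser r) : Prop where
  isNormalized : IsNormalized n lam S'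
  conjStable : ConjStable n S S'
  isUnipotent : IsUnipotent n (lam 0) σ ρ
  convergent_left : ∀ j, IsConvergent (σ j)
  convergent_right : ∀ i, IsConvergent (ρ i)
  carries : Carries n σ ρ S S'
  coeff_eq_zero : coeff γ S' = 0
  coeff_eq : ∀ δ, δ ∉ U → δ ≠ γ → coeff δ S' = coeff δ S

/-! ### Elimination by changing the last coordinate -/

section Steps

variable {r g n : ℕ} [NeZero g] {lam : Fin g → Fin r →₀ ℕ} {S : Ser r}

theorem coeff_monomial_add_eq {k : ℕ} {U : UpperSet (Fin k →₀ ℕ)} {f : Ser k}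
    {γ : Fin k →₀ ℕ} {a : ℂ} (h : f - monomial γ a ∈ supp U) (hγ : γ ∉ U) : coeff γ f = a := by
  have := h γ hγ
  rwa [map_sub, coeff_monomial_same, sub_eq_zero] at this

/-- The change is σ_{r+1} = X_{r+1} - c h, ρ = id, S' = S - c H^*(h). The pullback needs to be a
monomial only modulo `U`, so that h may be a truncation. The last clause passes the order of h on to
σ for the infinite composition. -/
theorem eliminates_of_mem_semigroup (hS : IsNormalized n lam S) {γ : Fin r →₀ ℕ}
    {U : UpperSet (Fin r →₀ ℕ)} (hγU : γ ∉ U) {h : Ser (r + 1)} (hh : TermsAbove n (lam 0) h)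
    (hc : IsConvergent h) {a : ℂ} (ha : a ≠ 0)
    (hpull : pullback n S h - monomial γ a ∈ supp U) :
    ∃ (σ : Fin (r + 1) → Ser (r + 1)) (S' : Ser r),
      Eliminates n lam S γ U σ (fun i => X i) S' ∧
      ∀ p, h ∈ supp (degGE (r + 1) p) → ∀ j, σ j - X j ∈ supp (degGE (r + 1) p) := by
  obtain ⟨hN, hSc⟩ := hS
  have hn := hN.isFormalQOParam.pos
  have hS0 := hN.isFormalQOParam.nonunit
  have hH0 := constantCoeff_param hn hS0
  obtain ⟨c, hca⟩ : ∃ c, c * a = coeff γ S := ⟨coeff γ S / a, div_mul_cancel₀ _ ha⟩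
  have hmem := hh.pullback_mem hn hS0 hN.mem_supp
  have hconv : IsConvergent (pullback n S h) := hc.subst hH0 fun j => by
    induction j using Fin.lastCases with
    | last => rw [param_last]; exact hSc
    | cast i => rw [param_castSucc]; exact (isConvergent_X i).pow n
  let S' := S - C c * pullback n S h
  have hσl : ∀ (f : Ser (r + 1)),
      (Function.update (fun j => (X j : Ser (r + 1))) (Fin.last r) f) (Fin.last r) = f :=
    fun f => Function.update_self _ _ _
  have hσc : ∀ (f : Ser (r + 1)) (i : Fin r),
      (Function.update (fun j => (X j : Ser (r + 1))) (Fin.last r) f) i.castSucc = X i.castSucc :=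
    fun f i => Function.update_of_ne (Fin.castSucc_lt_last i).ne _ _
  -- Weight above λ₁ means membership in (X_{r+1}, X^α). It also excludes constants since λ₁ ≠ 0,
  -- X_{r+1} since its weight is λ₁, and X_i since λ₁ is not ≤ ν_i.
  have hwd : ∀ d, coeff d h ≠ 0 → 2 ≤ d.degree ∧ d ∈ lastSet n (lam 0) := fun d hd => by
    have h1 := hh d hd
    have h2 : d ∈ lastSet n (lam 0) := by
      rw [mem_lastSet]
      by_cases hd0 : d (Fin.last r) = 0
      · refine Or.inr fun i => ?_
        have := h1.le i
        rwa [wdeg_apply, hd0, zero_mul, add_zero] at this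
      · exact Or.inl hd0
    refine ⟨?_, h2⟩
    by_contra! hlt
    have hd1 : d.degree = 0 ∨ d.degree = 1 := by omega
    rcases hd1 with hd1 | hd1
    · rw [Finsupp.degree_eq_zero_iff] at hd1
      have := h1.le
      rw [hd1] at this
      refine hN.ne_zero (le_antisymm (this.trans_eq ?_) zero_le)
      ext i
      simp [wdeg_apply]
    · obtain ⟨s, e, rfl⟩ := exists_eq_single_add (d := d) (by rintro rfl; simp at hd1)
      rw [map_add, Finsupp.degree_single, Nat.add_eq_left, Finsupp.degree_eq_zero_iff] at hd1
      rw [hd1, add_zero] at h1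
      induction s using Fin.lastCases with
      | last =>
        refine h1.ne ?_
        ext i
        rw [wdeg_apply, Finsupp.single_eq_same, one_mul,
          Finsupp.single_eq_of_ne (Fin.castSucc_lt_last i).ne, mul_zero, zero_add]
      | cast i =>
        refine hN.not_le_single i (h1.le.trans_eq ?_)
        ext j
        rw [wdeg_apply, Finsupp.single_eq_of_ne (Fin.castSucc_lt_last i).ne', zero_mul, add_zero]
        by_cases hji : j = i
        · rw [hji, Finsupp.single_eq_same, Finsupp.single_eq_same, mul_one]
        · rw [Finsupp.single_eq_of_ne hji, Finsupp.single_eq_of_ne, mul_zero]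
          exact fun h => hji (Fin.castSucc_injective r h)
  have hS'1 : coeff (lam 0) S' = 1 := by
    rw [map_sub, coeff_C_mul, hmem _ (by simp), mul_zero, sub_zero, hN.monic]
  have hCmem : C c * pullback n S h ∈ supp (UpperSet.Ioi (lam 0)) := Ideal.mul_mem_left _ _ hmem
  have hdom : IsDominantExponent S' (lam 0) := hN.dominant.sub_of_mem hCmem
  have hconj : ConjStable n S S' := by
    intro ω ω' hω hω'
    have hω1 : ∀ ω : Fin r → ℂ, (∀ i, ω i ^ n = 1) →
        rescale ω S' = rescale ω S - C c * pullback n (rescale ω S) h := fun ω hω => by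
      rw [← rescale_pullback hn hω hS0, map_sub, map_mul]
      congr 2
      rw [rescale_eq_subst, subst_C']
      intro i
      simp
    rw [hω1 ω hω, hω1 ω' hω']
    refine ⟨fun heq => by rw [heq], fun l hl => ?_⟩
    rw [sub_sub_sub_comm, ← mul_sub]
    refine hl.sub_of_mem (Ideal.mul_mem_left _ _ (hh.pullback_sub_mem hn ?_ ?_
      (isDominantExponent_iff.1 hl).2))
    · rw [constantCoeff_rescale, hS0]
    · rw [constantCoeff_rescale, hS0]
  refine ⟨Function.update (fun j => X j) (Fin.last r) (X (Fin.last r) - C c * h), S', ⟨?_, hconj,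
    ⟨?_, ?_, ?_, ?_, ?_⟩, ?_, isConvergent_X, ?_, ?_, ?_⟩, ?_⟩
  · exact ⟨hN.of_conjStable hconj hdom hS'1, hSc.sub ((isConvergent_C c).mul hconv)⟩
  · exact (isUnipotent_X n (lam 0)).monic
  · intro i
    rw [hσc]
    exact (isUnipotent_X n (lam 0)).mem i
  · intro i
    rw [hσc]
    exact (isUnipotent_X n (lam 0)).jet i
  · rw [hσl]
    exact sub_mem (isUnipotent_X n (lam 0)).mem_last
      (Ideal.mul_mem_left _ _ fun d hd => by_contra fun h0 => hd (hwd d h0).2)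
  · rw [hσl, sub_sub_cancel_left]
    exact neg_mem (Ideal.mul_mem_left _ _ fun d hd => by_contra fun h0 => hd (hwd d h0).1)
  · intro j
    induction j using Fin.lastCases with
    | last =>
      rw [hσl]
      exact (isConvergent_X _).sub ((isConvergent_C c).mul hc)
    | cast i => rw [hσc]; exact isConvergent_X _
  · intro j
    rw [subst_id]
    induction j using Fin.lastCases with
    | last =>
      rw [hσl, param_last, subst_sub (hasSubst hH0), subst_X (hasSubst hH0), param_last,
        subst_mul (hasSubst hH0), subst_C' hH0]
      rfl
    | cast i => rw [hσc, subst_X (hasSubst hH0), param_castSucc, param_castSucc]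
  · rw [map_sub, coeff_C_mul, coeff_monomial_add_eq hpull hγU, hca, sub_self]
  · intro δ hδ hδγ
    have := hpull δ hδ
    rw [map_sub, coeff_monomial_ne hδγ, sub_zero] at this
    rw [map_sub, coeff_C_mul, this, mul_zero, sub_zero]
  · intro p hp j
    induction j using Fin.lastCases with
    | last =>
      rw [hσl, sub_sub_cancel_left]
      exact neg_mem (Ideal.mul_mem_left _ _ hp)
    | cast i => rw [hσc, sub_self]; exact zero_mem _

end Steps

/-- The geometric sum dividing the two n-th powers has constant term n ≠ 0, hence is invertible.
Bounds on 1 + w thereby pass to its n-th root. -/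
theorem exists_unit_mul_eq_pow_sub_pow {k n : ℕ} (hn : 0 < n) {x y : Ser k}
    (hx : constantCoeff x = 0) (hy : constantCoeff y = 0) :
    ∃ u : Ser k, (x - y) = u * ((1 + x) ^ n - (1 + y) ^ n) := by
  let e : Ser k := ∑ i ∈ Finset.range n, (1 + x) ^ i * (1 + y) ^ (n - 1 - i)
  have he : e * (x - y) = (1 + x) ^ n - (1 + y) ^ n := by
    rw [← geom_sum₂_mul, add_sub_add_left_eq_sub]
  have hu : IsUnit e := by
    rw [isUnit_iff_constantCoeff]
    simp only [e, map_sum, map_mul, map_pow, map_add, map_one, hx, hy, add_zero, one_pow, mul_one,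
      Finset.sum_const, Finset.card_range, nsmul_eq_mul]
    exact IsUnit.mk0 _ (by exact_mod_cast hn.ne')
  obtain ⟨u, hu⟩ := hu.exists_left_inv
  exact ⟨u, by rw [← he, ← mul_assoc, hu, one_mul]⟩

/-! ### Elimination by reparameterizing one variable -/

section Steps

variable {r g n : ℕ} [NeZero g] {lam : Fin g → Fin r →₀ ℕ} {S : Ser r}

/-- The family `(t_1, …, t_i (1 + v), …, t_r)`. -/
def stretch (i : Fin r) (v : Ser r) (j : Fin r) : Ser r := if j = i then X j * (1 + v) else X j

theorem stretch_same (i : Fin r) (v : Ser r) : stretch i v i = X i * (1 + v) := if_pos rfl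

theorem stretch_ne {i j : Fin r} (h : j ≠ i) (v : Ser r) : stretch i v j = X j := if_neg h

theorem isMonic_stretch (i : Fin r) {v : Ser r} (hv : constantCoeff v = 0) :
    IsMonic (stretch i v) := fun j => by
  by_cases h : j = i
  · exact ⟨v, hv, by rw [h, stretch_same]⟩
  · exact ⟨0, map_zero _, by rw [stretch_ne h, add_zero, mul_one]⟩

theorem mon_stretch (i : Fin r) (v : Ser r) (d : Fin r →₀ ℕ) :
    mon (stretch i v) d = monomial d 1 * (1 + v) ^ d i := by
  rw [← mon_X, mon_eq, mon_eq, ← Finset.mul_prod_erase _ _ (Finset.mem_univ i),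
    ← Finset.mul_prod_erase _ _ (Finset.mem_univ i), stretch_same, mul_pow,
    Finset.prod_congr rfl fun j hj => by rw [stretch_ne (Finset.ne_of_mem_erase hj)]]
  ring

theorem rescale_stretch (ω : Fin r → ℂ) (i : Fin r) (v : Ser r) (j : Fin r) :
    rescale ω (stretch i v j) = C (ω j) * stretch i (rescale ω v) j := by
  by_cases h : j = i
  · rw [h, stretch_same, stretch_same, map_mul, rescale_X', map_add, map_one, mul_assoc]
  · rw [stretch_ne h, stretch_ne h, rescale_X']

/-- Stability of the conjugates under `t_i ↦ t_i (1 + v)`, where `(1 + v)^n = 1 + w` and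
`t_i^n w` is the pullback of `f`. -/
theorem conjStable_of_stretch (hN : IsFormalNormalized n lam S) {i : Fin r} (hi : n ≤ lam 0 i)
    {v w : Ser r} (hv : constantCoeff v = 0) (hvw : (1 + v) ^ n = 1 + w) {f : Ser (r + 1)}
    (hw : X i ^ n * w = pullback n S f) {S' : Ser r} (hS' : S' ∈ supp (UpperSet.Ici (lam 0)))
    (hSS' : subst (stretch i v) S' = S) : ConjStable n S S' := by
  have hn := hN.isFormalQOParam.pos
  have hS0 := hN.isFormalQOParam.nonunit
  have hv' : ∀ ω : Fin r → ℂ, constantCoeff (rescale ω v) = 0 := fun ω => by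
    rw [constantCoeff_rescale, hv]
  have hmon : ∀ ω, IsMonic (stretch i (rescale ω v)) := fun ω => isMonic_stretch i (hv' ω)
  have hmonc := fun ω => (hmon ω).constantCoeff
  have hsub : ∀ ω : Fin r → ℂ, subst (stretch i (rescale ω v)) (rescale ω S') = rescale ω S :=
    fun ω => by
      rw [← hSS', rescale_subst ω (isMonic_stretch i hv).constantCoeff,
        subst_rescale ω (hmonc ω)]
      simp_rw [rescale_stretch]
  have hw' : ∀ ω : Fin r → ℂ, (∀ j, ω j ^ n = 1) →
      X i ^ n * rescale ω w = pullback n (rescale ω S) f := fun ω hω => by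
    rw [← rescale_pullback hn hω hS0, ← hw, map_mul, map_pow, rescale_X', mul_pow, ← map_pow, hω,
      map_one, one_mul]
  have hvw' : ∀ ω : Fin r → ℂ, (1 + rescale ω v) ^ n = 1 + rescale ω w := fun ω => by
    rw [← map_one (rescale ω), ← map_add, ← map_add, ← map_pow, hvw]
  intro ω ω' hω hω'
  -- the difference of the stretching factors is controlled by the difference of the conjugates
  have hdiff : ∀ U : UpperSet (Fin r →₀ ℕ), rescale ω S - rescale ω' S ∈ supp U →
      X i ^ n * (rescale ω v - rescale ω' v) ∈ supp U := fun U hU => by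
    obtain ⟨u, hu⟩ := exists_unit_mul_eq_pow_sub_pow hn (hv' ω) (hv' ω')
    rw [hu, hvw', hvw', add_sub_add_left_eq_sub, mul_left_comm, mul_sub, hw' ω hω, hw' ω' hω']
    refine Ideal.mul_mem_left _ _ (subst_sub_subst_mem_supp' (constantCoeff_param hn ?_)
      (constantCoeff_param hn ?_) (fun j => ?_) f)
    · rw [constantCoeff_rescale, hS0]
    · rw [constantCoeff_rescale, hS0]
    · induction j using Fin.lastCases with
      | last => rwa [param_last, param_last]
      | cast j => rw [param_castSucc, param_castSucc, sub_self]; exact zero_mem _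
  constructor
  · intro heq
    have h0 : rescale ω v = rescale ω' v := by
      -- With the empty upper set, membership in `supp` means vanishing; t_i^n is then cancelled.
      have h1 := hdiff ⊤ (by rw [heq, sub_self]; exact zero_mem _)
      have h2 : X i ^ n * (rescale ω v - rescale ω' v) = 0 := by
        ext m
        exact h1 m (by simp)
      rw [X_pow_eq] at h2
      rw [← sub_eq_zero]
      ext m
      have h3 := congrArg (coeff (Finsupp.single i n + m)) h2
      rwa [coeff_add_monomial_mul, one_mul, map_zero] at h3
    refine (hmon ω).injective ?_
    rw [hsub ω, h0, hsub ω', heq]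
  · intro l hl
    rw [← (hmon ω).isDominantExponent_iff]
    -- Both conjugates of S' are stretched by the same factor, that of ω. The error compares two
    -- stretchings of the single series `rescale ω' S'`.
    have : subst (stretch i (rescale ω v)) (rescale ω S' - rescale ω' S') =
        (rescale ω S - rescale ω' S) - (subst (stretch i (rescale ω v)) (rescale ω' S') -
          subst (stretch i (rescale ω' v)) (rescale ω' S')) := by
      rw [subst_sub (hasSubst (hmonc ω)), hsub, hsub]
      ring
    rw [this]
    refine hl.sub_of_mem (subst_sub_subst_mem_supp (hmonc ω) (hmonc ω') fun d hd => ?_)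
    have hld : lam 0 ≤ d := by
      by_contra h
      exact hd (rescale_mem_supp ω' hS' d (by simpa using h))
    -- Since d ≥ λ₁ and λ₁ is not ≤ ν_i, one has t^d = t_i^n t^e with e ≠ 0. The factor t_i^n
    -- controls the difference of the stretching factors, and t^e pushes the result strictly above
    -- l.
    have hne : Finsupp.single i n ≠ d := fun h => hN.not_le_single i (h ▸ hld)
    obtain ⟨e, he⟩ := exists_add_of_le (show Finsupp.single i n ≤ d by
      rw [Finsupp.single_le_iff]
      exact hi.trans (hld i))
    have he0 : e ≠ 0 := fun h => hne (by rw [he, h, add_zero])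
    obtain ⟨q, hq⟩ := sub_dvd_pow_sub_pow (1 + rescale ω v) (1 + rescale ω' v) (d i)
    rw [mon_stretch, mon_stretch, ← mul_sub, hq, add_sub_add_left_eq_sub]
    nth_rewrite 1 [he]
    rw [← one_mul (1 : ℂ), ← monomial_mul_monomial, ← X_pow_eq,
      show X i ^ n * monomial e 1 * ((rescale ω v - rescale ω' v) * q) =
        X i ^ n * (rescale ω v - rescale ω' v) * (monomial e 1 * q) by ring]
    refine mul_mem_supp_of_constantCoeff (V := UpperSet.Ici l) (fun a ha b hb => ?_)
      (hdiff _ (isDominantExponent_iff.1 hl).2) ?_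
    · rw [UpperSet.mem_Ici_iff] at ha
      exact lt_of_le_of_lt ha hb
    · rw [map_mul, ← coeff_zero_eq_constantCoeff_apply, coeff_monomial_ne he0.symm, zero_mul]

/-- Here σ_i = X_i + c X_{r+1} h pulls back to t_i^n (1 + c w), which is absorbed by ρ_i = t_i (1 +
v) with (1 + v)^n = 1 + c w. Then S' = S ∘ ρ⁻¹, and the change at γ comes from the term λ_{1i} v
t^{λ₁} with n v ≡ c w. The last clause, with t^{λ₁} as a factor, bounds the order of ρ_j - t_j. -/
theorem eliminates_of_mem_translate (hS : IsNormalized n lam S) {γ : Fin r →₀ ℕ}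
    {U : UpperSet (Fin r →₀ ℕ)} (hγ : lam 0 < γ) (hγU : γ ∉ U) (hU : ∀ δ, γ < δ → δ ∈ U)
    {i : Fin r} (hi : n ≤ lam 0 i) {h : Ser (r + 1)} (hc : IsConvergent h)
    {w : Ser r} (hw : X i ^ n * w = S * pullback n S h) {a : ℂ} (ha : a ≠ 0)
    (hpull : monomial (lam 0) 1 * w - monomial γ a ∈ supp U) :
    ∃ (σ : Fin (r + 1) → Ser (r + 1)) (ρ : Fin r → Ser r) (S' : Ser r),
      Eliminates n lam S γ U σ ρ S' ∧
      (∀ p, h ∈ supp (degGE (r + 1) p) → ∀ j, σ j - X j ∈ supp (degGE (r + 1) p)) ∧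
      ∀ V : UpperSet (Fin r →₀ ℕ), γ ∈ V → (∀ δ ∈ U, δ ∈ V) →
        ∀ j, monomial (lam 0) 1 * (ρ j - X j) ∈ supp V := by
  obtain ⟨hN, hSc⟩ := hS
  have hn := hN.isFormalQOParam.pos
  have hnC : (n : ℂ) ≠ 0 := by exact_mod_cast hn.ne'
  have hS0 := hN.isFormalQOParam.nonunit
  have hH0 := constantCoeff_param hn hS0
  have hlamU : lam 0 ∉ U := fun h => hγU (U.upper hγ.le h)
  have hli : (lam 0 i : ℂ) ≠ 0 := by
    have : lam 0 i ≠ 0 := by omega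
    exact_mod_cast this
  -- This makes λ_{1i} c a / n, the first-order change at γ, equal to the coefficient to be removed.
  obtain ⟨c, hca⟩ : ∃ c, lam 0 i * (c * a) = n * coeff γ S :=
    ⟨n * coeff γ S / (lam 0 i * a), by field_simp⟩
  have hconv : IsConvergent (pullback n S h) := hc.subst hH0 fun j => by
    induction j using Fin.lastCases with
    | last => rw [param_last]; exact hSc
    | cast i => rw [param_castSucc]; exact (isConvergent_X i).pow n
  have hwc : IsConvergent w := by
    refine IsConvergent.of_monomial_mul (d := Finsupp.single i n) ?_
    rw [← X_pow_eq, hw]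
    exact hSc.mul hconv
  -- The constant term of w is the coefficient of t^{λ₁} w at λ₁, which is neither γ nor in `U`.
  have hw0 : constantCoeff w = 0 := by
    have h1 := hpull _ hlamU
    rw [map_sub, coeff_monomial_ne hγ.ne, sub_zero] at h1
    have h2 := coeff_add_monomial_mul (lam 0) 0 w (1 : ℂ)
    rw [add_zero, h1, one_mul, coeff_zero_eq_constantCoeff_apply] at h2
    exact h2.symm
  obtain ⟨v, hv0, hvc, hv⟩ := exists_root hn (w := C c * w) (by rw [map_mul, hw0, mul_zero])
    ((isConvergent_C c).mul hwc)
  have hρ := isMonic_stretch i hv0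
  have hρ0 := hρ.constantCoeff
  have hρc : ∀ j, IsConvergent (stretch i v j) := fun j => by
    by_cases hj : j = i
    · rw [hj, stretch_same]
      exact (isConvergent_X i).mul (isConvergent_one.add hvc)
    · rw [stretch_ne hj]
      exact isConvergent_X j
  obtain ⟨τ, hτ2, -, hτρ, hτc⟩ := exists_inverse hρ.sub_mem
  have hτ0 := constantCoeff_of_sub_mem hτ2
  obtain ⟨S', hS'def⟩ : ∃ S', S' = subst τ S := ⟨_, rfl⟩
  have hSS' : subst (stretch i v) S' = S := by
    rw [hS'def, subst_subst hτ0 hρ0]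
    simp_rw [hτρ]
    exact subst_id S
  have hdom : IsDominantExponent S' (lam 0) := by
    rw [← hρ.isDominantExponent_iff, hSS']
    exact hN.dominant
  have hS'mem := (isDominantExponent_iff.1 hdom).2
  have hS'1 : coeff (lam 0) S' = 1 := by
    rw [← hρ.coeff_subst fun β hβ => hS'mem β (by simpa using hβ.not_ge), hSS', hN.monic]
  have hconj : ConjStable n S S' := by
    refine conjStable_of_stretch hN hi hv0 hv (f := X (Fin.last r) * (C c * h)) ?_ hS'mem hSS'
    rw [pullback, subst_mul (hasSubst hH0), subst_X (hasSubst hH0), param_last,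
      subst_mul (hasSubst hH0), subst_C' hH0, ← pullback]
    linear_combination C c * hw
  -- the size of `v`
  obtain ⟨q, hq⟩ := exists_one_add_pow_eq v n
  have hvw : (n : Ser r) * v + v * (v * q) = C c * w := by linear_combination hv - hq
  have hVw : ∀ V : UpperSet (Fin r →₀ ℕ), γ ∈ V → (∀ δ ∈ U, δ ∈ V) →
      monomial (lam 0) 1 * v ∈ supp V := fun V hγV hUV => by
    have h1 : monomial (lam 0) 1 * w ∈ supp V := by
      rw [← sub_add_cancel (monomial (lam 0) 1 * w) (monomial γ a)]
      exact add_mem (supp_mono hUV hpull) (monomial_mem_supp hγV a)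
    have hu : IsUnit ((n : Ser r) + v * q) := by
      rw [isUnit_iff_constantCoeff, map_add, map_mul, hv0, zero_mul, add_zero, map_natCast]
      exact IsUnit.mk0 _ hnC
    obtain ⟨u, hu⟩ := hu.exists_left_inv
    have h2 : monomial (lam 0) 1 * v = (u * C c) * (monomial (lam 0) 1 * w) := by
      linear_combination (-monomial (lam 0) 1 * v) * hu + (u * monomial (lam 0) 1) * hvw
    rw [h2]
    exact Ideal.mul_mem_left _ _ h1
  -- This is {γ} ∪ U. It is an upper set because everything strictly above γ is in U, and
  -- multiplication by a nonunit moves `supp V` into `supp U`.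
  let V : UpperSet (Fin r →₀ ℕ) :=
    { carrier := {δ | δ = γ ∨ δ ∈ U}
      upper' := by
        rintro δ δ' hδ (rfl | h')
        · rcases hδ.eq_or_lt with h1 | h1
          · exact Or.inl h1.symm
          · exact Or.inr (hU _ h1)
        · exact Or.inr (U.upper hδ h') }
  have hVmem : ∀ δ, δ ∈ V ↔ δ = γ ∨ δ ∈ U := fun _ => Iff.rfl
  have hVU : ∀ δ ∈ V, ∀ δ', δ < δ' → δ' ∈ U := by
    rintro δ (rfl | hδ) δ' h1
    · exact hU _ h1
    · exact U.upper h1.le hδ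
  have hvV := hVw V ((hVmem _).2 (Or.inl rfl)) fun δ hδ => (hVmem _).2 (Or.inr hδ)
  have hnv : (n : Ser r) * (monomial (lam 0) 1 * v) - monomial γ (c * a) ∈ supp U := by
    have : (n : Ser r) * (monomial (lam 0) 1 * v) - monomial γ (c * a) =
        C c * (monomial (lam 0) 1 * w - monomial γ a) -
          (monomial (lam 0) 1 * v) * (v * q) := by
      have h1 : (monomial γ (c * a) : Ser r) = C c * monomial γ a := by
        rw [← monomial_zero_eq_C_apply, monomial_mul_monomial, zero_add]
      rw [h1]
      linear_combination monomial (lam 0) 1 * hvw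
    rw [this]
    refine sub_mem (Ideal.mul_mem_left _ _ hpull) (mul_mem_supp_of_constantCoeff hVU hvV ?_)
    rw [map_mul, hv0, zero_mul]
  -- the effect of the substitution on `S`
  have hSρ : subst (stretch i v) S - S - (lam 0 i : Ser r) * (monomial (lam 0) 1 * v) ∈
      supp U := by
    -- Terms of S strictly above λ₁ contribute only to `U`, so t^{λ₁} alone determines the change at
    -- γ.
    have h1 : subst (stretch i v) (S - monomial (lam 0) 1) -
        subst (fun i => X i) (S - monomial (lam 0) 1) ∈ supp U := by
      refine subst_sub_subst_mem_supp hρ0 (fun i => constantCoeff_X i) fun d hd => ?_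
      rw [mon_stretch, mon_X]
      have hlt : lam 0 < d := by
        refine lt_of_le_of_ne ?_ ?_
        · by_contra hle
          apply hd
          rw [map_sub, hN.mem_supp d (by simpa using hle), coeff_monomial_ne, sub_zero]
          rintro rfl
          exact hle le_rfl
        · rintro rfl
          apply hd
          rw [map_sub, hN.monic, coeff_monomial_same, sub_self]
      obtain ⟨e, rfl⟩ := exists_add_of_le hlt.le
      have he0 : e ≠ 0 := by
        rintro rfl
        simp at hlt
      obtain ⟨x, hx⟩ := sub_dvd_pow_sub_pow (1 + v) 1 ((lam 0 + e) i)
      rw [one_pow, add_sub_cancel_left] at hx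
      rw [show ∀ x y : Ser r, x * y - x = x * (y - 1) from fun x y => by ring, hx,
        ← one_mul (1 : ℂ), ← monomial_mul_monomial,
        show (monomial (lam 0) 1 : Ser r) * monomial e 1 * (v * x) =
          monomial (lam 0) 1 * v * (monomial e 1 * x) by ring]
      refine mul_mem_supp_of_constantCoeff hVU hvV ?_
      rw [map_mul, ← coeff_zero_eq_constantCoeff_apply, coeff_monomial_ne he0.symm, zero_mul]
    obtain ⟨x, hx⟩ := exists_one_add_pow_eq v (lam 0 i)
    rw [subst_id, subst_sub (hasSubst hρ0), subst_monomial' hρ0, mon_stretch, map_one,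
      one_mul, hx] at h1
    have h2 : (monomial (lam 0) 1 * v) * (v * x) ∈ supp U :=
      mul_mem_supp_of_constantCoeff hVU hvV (by rw [map_mul, hv0, zero_mul])
    convert add_mem h1 h2 using 1
    ring
  -- Applied to S' - S, the substitution gives S - S ∘ ρ, whose term at γ has coefficient -λ_{1i} c
  -- a / n.
  have hD : subst (stretch i v) (S' - S) + monomial γ (coeff γ S) ∈ supp U := by
    have h1 : (C ((lam 0 i : ℂ) * (n : ℂ)⁻¹) : Ser r) *
        ((n : Ser r) * (monomial (lam 0) 1 * v) - monomial γ (c * a)) ∈ supp U :=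
      Ideal.mul_mem_left _ _ hnv
    have h2 : (C ((lam 0 i : ℂ) * (n : ℂ)⁻¹) : Ser r) * n = lam 0 i := by
      rw [natCast_eq_C, natCast_eq_C, ← map_mul, inv_mul_cancel_right₀ hnC]
    have h3 : (C ((lam 0 i : ℂ) * (n : ℂ)⁻¹) : Ser r) * monomial γ (c * a) =
        monomial γ (coeff γ S) := by
      rw [← monomial_zero_eq_C_apply, monomial_mul_monomial, zero_add]
      congr 1
      field_simp
      linear_combination hca
    rw [mul_sub, h3, ← mul_assoc, h2] at h1
    convert neg_mem (add_mem hSρ h1) using 1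
    rw [subst_sub (hasSubst hρ0), hSS']
    ring
  have hDV : S' - S ∈ supp V := by
    rw [← hρ.mem_supp_iff, ← add_sub_cancel_right (subst _ _) (monomial γ (coeff γ S))]
    exact sub_mem (supp_mono (fun δ hδ => (hVmem δ).2 (Or.inr hδ)) hD)
      (monomial_mem_supp ((hVmem γ).2 (Or.inl rfl)) _)
  -- No exponent of `V` lies strictly below γ, so the triangular substitution leaves this
  -- coefficient unchanged.
  have hDγ : coeff γ (S' - S) = - coeff γ S := by
    rw [← hρ.coeff_subst fun β hβ => hDV β fun h1 => ?_]
    · have := hD γ hγU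
      rw [map_add, coeff_monomial_same] at this
      exact eq_neg_of_add_eq_zero_left this
    · rcases (hVmem β).1 h1 with h2 | h2
      · exact hβ.ne h2
      · exact hγU (U.upper hβ.le h2)
  -- the coordinate change
  have hlast : (Fin.last r) ≠ i.castSucc := (Fin.castSucc_lt_last i).ne'
  have hσi : ∀ (f : Ser (r + 1)),
      (Function.update (fun j => (X j : Ser (r + 1))) i.castSucc f) i.castSucc = f :=
    fun f => Function.update_self _ _ _
  have hσn : ∀ (f : Ser (r + 1)) {j : Fin (r + 1)} (_ : j ≠ i.castSucc),
      (Function.update (fun j => (X j : Ser (r + 1))) i.castSucc f) j = X j :=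
    fun f _ hj => Function.update_of_ne hj _ _
  have hid := isUnipotent_X n (lam 0)
  refine ⟨Function.update (fun j => X j) i.castSucc
    (X i.castSucc + X (Fin.last r) * (C c * h)), stretch i v, S', ⟨?_, hconj,
    ⟨hρ, ?_, ?_, ?_, ?_⟩, ?_, hρc, ?_, ?_, ?_⟩, ?_, ?_⟩
  · refine ⟨hN.of_conjStable hconj hdom hS'1, ?_⟩
    rw [hS'def]
    exact hSc.subst hτ0 (hτc hρc)
  · intro j
    by_cases hj : j = i
    · rw [hj, hσi]
      exact add_mem (hid.mem i) (Ideal.mul_mem_right _ _ (monomial_mem_supp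
        (mem_mixedSet.2 (Or.inr ⟨hi, by simp⟩)) 1))
    · rw [hσn _ fun h1 => hj (Fin.castSucc_injective r h1)]
      exact hid.mem j
  · intro j
    by_cases hj : j = i
    · subst hj
      refine ⟨c * constantCoeff h, fun h1 => absurd hi h1.not_ge, ?_⟩
      rw [hσi, add_sub_add_left_eq_sub, map_mul,
        show X (Fin.last r) * (C c * h) - C c * C (constantCoeff h) * X (Fin.last r) =
          C c * (X (Fin.last r) * (h - C (constantCoeff h))) by ring]
      refine Ideal.mul_mem_left _ _ (supp_degGE_mul (p := 1) (q := 1)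
        (mem_supp_degGE_one.2 (constantCoeff_X _)) (mem_supp_degGE_one.2 ?_))
      rw [map_sub, constantCoeff_C, sub_self]
    · rw [hσn _ fun h1 => hj (Fin.castSucc_injective r h1)]
      exact hid.jet j
  · rw [hσn _ hlast]
    exact hid.mem_last
  · rw [hσn _ hlast]
    exact hid.jet_last
  · intro j
    by_cases hj : j = i.castSucc
    · rw [hj, hσi]
      exact (isConvergent_X _).add ((isConvergent_X _).mul ((isConvergent_C c).mul hc))
    · rw [hσn _ hj]
      exact isConvergent_X j
  · intro j
    induction j using Fin.lastCases with
    | last => rw [hσn _ hlast, param_last, subst_X (hasSubst hH0), param_last, hSS']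
    | cast j =>
      rw [param_castSucc, subst_pow (hasSubst hρ0), subst_X (hasSubst hρ0)]
      by_cases hj : j = i
      · rw [hj, hσi, stretch_same, mul_pow, hv, subst_add (hasSubst hH0), subst_X (hasSubst hH0),
          subst_mul (hasSubst hH0), subst_X (hasSubst hH0), param_last, param_castSucc,
          subst_mul (hasSubst hH0), subst_C' hH0]
        rw [pullback] at hw
        linear_combination -C c * hw
      · rw [hσn _ fun h1 => hj (Fin.castSucc_injective r h1), stretch_ne hj,
          subst_X (hasSubst hH0), param_castSucc]
  · rw [map_sub] at hDγ
    linear_combination hDγ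
  · intro δ hδ hδγ
    have := hDV δ fun h1 => ((hVmem δ).1 h1).elim hδγ hδ
    rwa [map_sub, sub_eq_zero] at this
  · intro p hp j
    by_cases hj : j = i.castSucc
    · rw [hj, hσi, add_sub_cancel_left]
      exact Ideal.mul_mem_left _ _ (Ideal.mul_mem_left _ _ hp)
    · rw [hσn _ hj, sub_self]
      exact zero_mem _
  · intro W hγW hUW j
    by_cases hj : j = i
    · rw [hj, stretch_same, show monomial (lam 0) 1 * (X i * (1 + v) - X i) =
        X i * (monomial (lam 0) 1 * v) by ring]
      exact Ideal.mul_mem_left _ _ (hVw W hγW hUW)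
    · rw [stretch_ne hj, sub_self, mul_zero]
      exact zero_mem _

end Steps

/-! ### Elimination of a single exponent -/

theorem isDominantExponent_iff_exists {k : ℕ} {f : Ser k} {γ : Fin k →₀ ℕ} :
    IsDominantExponent f γ ↔ ∃ q, f = monomial γ 1 * q ∧ constantCoeff q ≠ 0 := by
  rw [isDominantExponent_iff]
  constructor
  · rintro ⟨h1, h2⟩
    obtain ⟨q, hq, hq'⟩ := exists_eq_monomial_mul h2
    refine ⟨q, hq, ?_⟩
    rwa [← coeff_zero_eq_constantCoeff_apply, hq', add_zero]
  · rintro ⟨q, rfl, hq⟩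
    refine ⟨?_, Ideal.mul_mem_right _ _ (monomial_mem_supp (by simp) 1)⟩
    have := coeff_add_monomial_mul γ 0 q (1 : ℂ)
    rw [add_zero, one_mul, coeff_zero_eq_constantCoeff_apply] at this
    rwa [this]

theorem IsDominantExponent.mul {k : ℕ} {f g : Ser k} {a b : Fin k →₀ ℕ}
    (hf : IsDominantExponent f a) (hg : IsDominantExponent g b) :
    IsDominantExponent (f * g) (a + b) := by
  rw [isDominantExponent_iff_exists] at *
  obtain ⟨p, rfl, hp⟩ := hf
  obtain ⟨q, rfl, hq⟩ := hg
  refine ⟨p * q, ?_, by rw [map_mul]; exact mul_ne_zero hp hq⟩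
  rw [mul_mul_mul_comm, monomial_mul_monomial, one_mul]

theorem IsDominantExponent.sub_monomial_mem {k : ℕ} {f : Ser k} {γ : Fin k →₀ ℕ}
    (hf : IsDominantExponent f γ) : f - monomial γ (coeff γ f) ∈ supp (UpperSet.Ioi γ) := by
  intro m hm
  rw [UpperSet.mem_Ioi_iff] at hm
  rw [map_sub]
  by_cases h : m = γ
  · rw [h, coeff_monomial_same, sub_self]
  · rw [coeff_monomial_ne h, sub_zero]
    by_contra h0
    exact hm (lt_of_le_of_ne (hf.2 m h0) (Ne.symm h))

theorem IsDominantExponent.monomial {k : ℕ} (γ : Fin k →₀ ℕ) :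
    IsDominantExponent (MvPowerSeries.monomial γ 1 : Ser k) γ :=
  isDominantExponent_iff_exists.2 ⟨1, by rw [mul_one], by simp⟩

theorem isDominantExponent_monomial_mul_iff {k : ℕ} {f : Ser k} {a γ : Fin k →₀ ℕ} :
    IsDominantExponent (monomial a 1 * f) (a + γ) ↔ IsDominantExponent f γ := by
  refine ⟨fun h => ⟨?_, fun δ hδ => ?_⟩, fun h => (IsDominantExponent.monomial a).mul h⟩
  · have := h.1
    rwa [coeff_add_monomial_mul, one_mul] at this
  · have := h.2 (a + δ) (by rwa [coeff_add_monomial_mul, one_mul])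
    exact (add_le_add_iff_left a).1 this

section Eliminable

variable {r g n : ℕ} [NeZero g] {lam : Fin g → Fin r →₀ ℕ} {S : Ser r}

theorem Eliminates.isEliminable {γ : Fin r →₀ ℕ} {σ : Fin (r + 1) → Ser (r + 1)}
    {ρ : Fin r → Ser r} {S' : Ser r} (h : Eliminates n lam S γ (UpperSet.Ioi γ) σ ρ S') :
    IsEliminable n lam S γ := by
  have hQ := h.isNormalized.1.isFormalQOParam
  refine ⟨S', ⟨hQ, h.isNormalized.2⟩, h.isNormalized.1.dominant.2, ⟨σ, ρ, ⟨?_, ?_, ?_⟩, ?_⟩,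
    h.coeff_eq_zero, fun δ hδ hlt => h.coeff_eq δ (by rwa [UpperSet.mem_Ioi_iff]) hδ⟩
  · exact h.isUnipotent.inFormalTildeA₁ hQ.pos
  · exact h.convergent_left
  · exact h.convergent_right
  · exact h.carries

theorem exists_X_pow_mul_eq (hN : IsFormalNormalized n lam S) {i : Fin r} (hi : n ≤ lam 0 i)
    (f : Ser r) : ∃ w : Ser r, X i ^ n * w = S * f := by
  have : S * f ∈ supp (UpperSet.Ici (Finsupp.single i n)) :=
    Ideal.mul_mem_right _ _ (supp_mono (fun m hm => by
      rw [UpperSet.mem_Ici_iff] at *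
      rw [Finsupp.single_le_iff]
      exact hi.trans (hm i)) hN.mem_supp)
  obtain ⟨w, hw, -⟩ := exists_eq_monomial_mul this
  exact ⟨w, by rw [X_pow_eq, hw]⟩

/-- Multiplying by t_i^n gives t^{λ₁} S f, whose dominant exponent is 2λ₁ + δ = γ + ν_i. -/
theorem isDominantExponent_translate (hN : IsFormalNormalized n lam S) {i : Fin r}
    {γ δ : Fin r →₀ ℕ} (hγδ : γ + Finsupp.single i n = δ + 2 • lam 0) {f w : Ser r}
    (hf : IsDominantExponent f δ) (hw : X i ^ n * w = S * f) :
    IsDominantExponent (monomial (lam 0) 1 * w) γ := by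
  rw [← isDominantExponent_monomial_mul_iff (a := Finsupp.single i n), add_comm, hγδ,
    ← X_pow_eq, mul_left_comm, hw, show δ + 2 • lam 0 = lam 0 + (lam 0 + δ) by
      rw [two_smul]; abel]
  exact (IsDominantExponent.monomial _).mul (hN.dominant.mul hf)

theorem isEliminable_of_mem (hS : IsNormalized n lam S) {γ : Fin r →₀ ℕ} (hγ : lam 0 < γ)
    (h : γ ∈ eliminationSet n (lam 0) S) : IsEliminable n lam S γ := by
  have hγU : γ ∉ UpperSet.Ioi γ := by simp
  rcases h with ⟨h, hc, hd⟩ | h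
  · have hT := termsAbove_of_pullback hS.1 (supp_mono (fun m hm => by
      rw [UpperSet.mem_Ici_iff] at hm
      exact lt_of_lt_of_le hγ hm) (isDominantExponent_iff.1 hd).2)
    obtain ⟨σ, S', hE, -⟩ := eliminates_of_mem_semigroup hS hγU hT hc hd.1 hd.sub_monomial_mem
    exact hE.isEliminable
  · simp only [Set.mem_iUnion] at h
    obtain ⟨i, hi, δ, ⟨h, hc, hd⟩, hγδ⟩ := h
    obtain ⟨w, hw⟩ := exists_X_pow_mul_eq hS.1 hi (pullback n S h)
    have hdw := isDominantExponent_translate hS.1 hγδ hd hw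
    obtain ⟨σ, ρ, S', hE, -⟩ := eliminates_of_mem_translate hS hγ hγU
      (fun δ hδ => UpperSet.mem_Ioi_iff.2 hδ) hi hc hw hdw.1 hdw.sub_monomial_mem
    exact hE.isEliminable

end Eliminable

/-! ### The topology induced by the pullback -/

/-- If the pullback of `h` has order at least `N`, then `h` may be replaced by a series of order
at least `P N` with the same pullback. -/
def OrderBound {r : ℕ} (n : ℕ) (S : Ser r) (P : ℕ → ℕ) : Prop :=
  ∀ N h, pullback n S h ∈ supp (degGE r N) →
    ∃ h', pullback n S h' = pullback n S h ∧ h' ∈ supp (degGE (r + 1) (P N))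

section Chevalley

variable {r n : ℕ} {S : Ser r}

/-- The spaces of series whose pullback has order at least N decrease with N. Their images in the
finite-dimensional space of coefficients of degree below p therefore stabilize. -/
theorem exists_stable (hn : 0 < n) (hS : constantCoeff S = 0) (p : ℕ) :
    ∃ N, ∀ N' ≥ N, ∀ x : Ser (r + 1), pullback n S x ∈ supp (degGE r N) →
      ∃ y : Ser (r + 1), pullback n S y ∈ supp (degGE r N') ∧
        y - x ∈ supp (degGE (r + 1) p) := by
  have hsub := hasSubst (constantCoeff_param hn hS)
  let ι := {m : Fin (r + 1) →₀ ℕ // m.degree < p}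
  have : Finite ι := Finsupp.finite_of_degree_lt p
  let π : Ser (r + 1) →ₗ[ℂ] (ι → ℂ) := LinearMap.pi fun m => coeff m.1
  let W : ℕ → Submodule ℂ (Ser (r + 1)) := fun N =>
    { carrier := {h | pullback n S h ∈ supp (degGE r N)}
      add_mem' := fun {a b} ha hb => by
        rw [Set.mem_ofPred_eq] at *
        rw [pullback, subst_add hsub]
        exact add_mem ha hb
      zero_mem' := by
        rw [Set.mem_ofPred_eq, pullback, subst_zero' (constantCoeff_param hn hS)]
        exact zero_mem _
      smul_mem' := fun c a ha => by
        rw [Set.mem_ofPred_eq] at *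
        rw [pullback, subst_smul hsub, smul_eq_C_mul]
        exact Ideal.mul_mem_left _ _ ha }
  have hW : ∀ N N', N ≤ N' → W N' ≤ W N := fun N N' h x hx =>
    supp_mono (fun m hm => h.trans (mem_degGE.1 hm)) hx
  -- A descending chain of subspaces is a monotone map into the order dual.
  obtain ⟨N, hN⟩ := IsArtinian.monotone_stabilizes (R := ℂ) (M := ι → ℂ)
    ⟨fun N => OrderDual.toDual ((W N).map π), fun N N' h => Submodule.map_mono (hW N N' h)⟩
  refine ⟨N, fun N' hN' x hx => ?_⟩
  have h1 : (W N).map π = (W N').map π := hN N' hN'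
  have h2 : π x ∈ (W N').map π := h1 ▸ Submodule.mem_map_of_mem hx
  obtain ⟨y, hy, hyx⟩ := h2
  refine ⟨y, hy, fun m hm => ?_⟩
  rw [mem_degGE, not_le] at hm
  have := congrFun hyx ⟨m, hm⟩
  rw [map_sub, sub_eq_zero]
  exact this

/-- Starting from h, successive corrections of increasing order push the order of the pullback to
infinity. The limit y lies in the kernel of the pullback and agrees with h below degree p, so h - y
is the required series. -/
theorem exists_order_le (hn : 0 < n) (hS : constantCoeff S = 0) (p : ℕ) :
    ∃ N, ∀ h : Ser (r + 1), pullback n S h ∈ supp (degGE r N) →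
      ∃ h', pullback n S h' = pullback n S h ∧ h' ∈ supp (degGE (r + 1) p) := by
  have hH0 := constantCoeff_param hn hS
  choose N hN using exists_stable (r := r) hn hS
  have hstep : ∀ q (x : Ser (r + 1)), pullback n S x ∈ supp (degGE r (N q)) →
      ∃ y : Ser (r + 1), pullback n S y ∈ supp (degGE r (N (q + 1))) ∧
        pullback n S y ∈ supp (degGE r (q + 1)) ∧ y - x ∈ supp (degGE (r + 1) q) := by
    intro q x hx
    obtain ⟨y, hy, hyx⟩ := hN q (max (N q) (max (N (q + 1)) (q + 1))) (le_max_left _ _) x hx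
    refine ⟨y, supp_mono (fun m hm => ?_) hy, supp_mono (fun m hm => ?_) hy, hyx⟩
    · rw [mem_degGE] at *
      omega
    · rw [mem_degGE] at *
      omega
  choose! F hF1 hF2 hF3 using hstep
  refine ⟨N p, fun h hh => ?_⟩
  obtain ⟨x, hx0, hx⟩ : ∃ x : ℕ → Ser (r + 1), x 0 = h ∧ ∀ q, x (q + 1) = F (p + q) (x q) :=
    ⟨fun q => Nat.rec h (fun q y => F (p + q) y) q, rfl, fun _ => rfl⟩
  have hxN : ∀ q, pullback n S (x q) ∈ supp (degGE r (N (p + q))) := fun q => by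
    induction q with
    | zero => rwa [hx0]
    | succ q ih => rw [hx]; exact hF1 _ _ ih
  -- Truncated subtraction keeps the sequence constant up to index p. Its increments then have order
  -- at least j, and y differs from `x 0` only in degrees at least p.
  obtain ⟨y, hy⟩ := exists_limit (fun j => x (j - p)) fun j => by
    rcases lt_or_ge j p with h1 | h1
    · rw [Nat.sub_eq_zero_of_le h1, Nat.sub_eq_zero_of_le h1.le, sub_self]
      exact zero_mem _
    · obtain ⟨q, rfl⟩ := Nat.exists_eq_add_of_le h1
      rw [add_assoc, Nat.add_sub_cancel_left, Nat.add_sub_cancel_left, hx]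
      exact hF3 _ _ (hxN q)
  have hy0 : pullback n S y = 0 := by
    refine eq_zero_of_mem_supp_degGE fun j => ?_
    have h1 := hy (p + (j + 1))
    rw [Nat.add_sub_cancel_left] at h1
    have h2 := subst_mem_supp_degGE hH0 h1
    rw [subst_sub (hasSubst hH0)] at h2
    rw [← sub_add_cancel (pullback n S y) (pullback n S (x (j + 1)))]
    refine add_mem (supp_mono (fun m hm => ?_) h2) (supp_mono (fun m hm => ?_)
      (by rw [hx]; exact hF2 _ _ (hxN j)))
    · rw [mem_degGE] at *
      omega
    · rw [mem_degGE] at *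
      omega
  refine ⟨h - y, ?_, ?_⟩
  · rw [pullback, subst_sub (hasSubst hH0)]
    rw [pullback] at hy0
    rw [hy0, sub_zero]
    rfl
  · have := hy p
    rw [Nat.sub_self, hx0] at this
    rw [← neg_sub]
    exact neg_mem this

/-- The bound is the largest admissible p not exceeding N; the cutoff N is needed because all p are
admissible for some pullbacks, such as zero. -/
theorem exists_orderBound (hn : 0 < n) (hS : constantCoeff S = 0) :
    ∃ P : ℕ → ℕ, OrderBound n S P ∧ Filter.Tendsto P Filter.atTop Filter.atTop := by
  classical
  let Q : ℕ → ℕ → Prop := fun N p => ∀ h : Ser (r + 1), pullback n S h ∈ supp (degGE r N) →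
      ∃ h', pullback n S h' = pullback n S h ∧ h' ∈ supp (degGE (r + 1) p)
  refine ⟨fun N => Nat.findGreatest (Q N) N, fun N => ?_, Filter.tendsto_atTop.2 fun p => ?_⟩
  · exact Nat.findGreatest_spec (P := Q N) (Nat.zero_le N) fun h _ =>
      ⟨h, rfl, fun m hm => absurd (Nat.zero_le _) hm⟩
  · obtain ⟨N, hN⟩ := exists_order_le (r := r) hn hS p
    filter_upwards [Filter.eventually_ge_atTop (max N p)] with M hM
    refine Nat.le_findGreatest ((le_max_right _ _).trans hM) fun h hh => hN h ?_
    exact supp_mono (fun m hm => ((le_max_left _ _).trans hM).trans (mem_degGE.1 hm)) hh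

end Chevalley

/-- The left inverse of a unipotent coordinate change. -/
theorem IsUnipotent.exists_left_inverse {r n : ℕ} {l : Fin r →₀ ℕ}
    {σ : Fin (r + 1) → Ser (r + 1)} {ρ : Fin r → Ser r} (h : IsUnipotent n l σ ρ) :
    ∃ τ : Fin (r + 1) → Ser (r + 1), (∀ j, MvPowerSeries.constantCoeff (τ j) = 0) ∧
      ∀ j, subst σ (τ j) = X j := by
  choose d _ hd using h.jet
  -- `L 1` is the linear part of σ, and `L (-1)` is its inverse. Hence σ ∘ L(-1) is tangent to the
  -- identity; if b is its inverse, then b ∘ σ = L(1) and L(-1) ∘ b is the left inverse of σ.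
  let L : ℂ → Fin (r + 1) → Ser (r + 1) := fun s =>
    Fin.snoc (α := fun _ => Ser (r + 1)) (fun i => X i.castSucc + C (s * d i) * X (Fin.last r))
      (X (Fin.last r))
  have hLc : ∀ s i, L s (Fin.castSucc i) = X i.castSucc + C (s * d i) * X (Fin.last r) :=
    fun s i => Fin.snoc_castSucc (α := fun _ => Ser (r + 1)) _ _ _
  have hLl : ∀ s, L s (Fin.last r) = X (Fin.last r) :=
    fun s => Fin.snoc_last (α := fun _ => Ser (r + 1)) _ _
  have hL0 : ∀ s j, MvPowerSeries.constantCoeff (L s j) = 0 := fun s j => by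
    induction j using Fin.lastCases with
    | last => rw [hLl, constantCoeff_X]
    | cast i => rw [hLc]; simp
  have hLL : ∀ s j, subst (L s) (L (-s) j) = X j := fun s j => by
    have hs := hasSubst (hL0 s)
    induction j using Fin.lastCases with
    | last => rw [hLl, subst_X hs, hLl]
    | cast i =>
      rw [hLc, subst_add hs, subst_mul hs, subst_C' (hL0 s), subst_X hs, subst_X hs, hLl, hLc,
        neg_mul, map_neg]
      ring
  have hs2 : ∀ j, subst (L (-1)) (σ j) - X j ∈ supp (degGE (r + 1) 2) := fun j => by
    have hs := hasSubst (hL0 (-1))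
    induction j using Fin.lastCases with
    | last =>
      have := subst_mem_supp_degGE (hL0 (-1)) h.jet_last
      rwa [subst_sub hs, subst_X hs, hLl] at this
    | cast i =>
      have := subst_mem_supp_degGE (hL0 (-1)) (hd i)
      rw [subst_sub hs, subst_add hs, subst_mul hs, subst_C' (hL0 _), subst_X hs, subst_X hs,
        hLl, hLc, neg_one_mul, map_neg] at this
      convert this using 1
      ring
  obtain ⟨b, hb2, -, hb, -⟩ := exists_inverse hs2
  have hb0 := constantCoeff_of_sub_mem hb2
  have hσb : ∀ j, subst σ (b j) = L 1 j := fun j => by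
    have h1 := congrArg (subst (L 1)) (hb j)
    rw [subst_X (hasSubst (hL0 1)), ← subst_subst h.constantCoeff (hL0 (-1)),
      subst_subst (hL0 (-1)) (hL0 1)] at h1
    simp_rw [hLL] at h1
    rwa [subst_id] at h1
  refine ⟨fun j => subst b (L (-1) j), fun j => constantCoeff_subst_zero hb0 (hL0 _ j),
    fun j => ?_⟩
  rw [subst_subst hb0 h.constantCoeff]
  simp_rw [hσb]
  exact hLL 1 j

/-! ### Transfer of order bounds and semigroups along a coordinate change -/

section Transfer

variable {r n : ℕ} {l : Fin r →₀ ℕ} {σ : Fin (r + 1) → Ser (r + 1)} {ρ : Fin r → Ser r}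
  {S S' : Ser r}

theorem Carries.pullback_subst (hn : 0 < n) (hC : Carries n σ ρ S S') (hU : IsUnipotent n l σ ρ)
    (hS : constantCoeff S = 0) (hS' : constantCoeff S' = 0) (h : Ser (r + 1)) :
    pullback n S (subst σ h) = subst ρ (pullback n S' h) := by
  rw [pullback, subst_subst hU.constantCoeff (constantCoeff_param hn hS), pullback,
    subst_subst (constantCoeff_param hn hS') hU.monic.constantCoeff]
  congr 1
  funext j
  exact hC j

/-- Substituting ρ, σ or the left inverse of σ does not lower orders, and substitution of ρ is
injective. So one function `P` serves all steps of the infinite process. -/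
theorem OrderBound.of_carries (hn : 0 < n) {P : ℕ → ℕ} (hP : OrderBound n S P)
    (hC : Carries n σ ρ S S') (hU : IsUnipotent n l σ ρ) (hS : constantCoeff S = 0)
    (hS' : constantCoeff S' = 0) : OrderBound n S' P := by
  intro N h hh
  obtain ⟨τ, hτ0, hτ⟩ := hU.exists_left_inverse
  obtain ⟨f, hf1, hf2⟩ := hP N (subst σ h) (by
    rw [hC.pullback_subst hn hU hS hS']
    exact subst_mem_supp_degGE hU.monic.constantCoeff hh)
  refine ⟨subst τ f, hU.monic.injective ?_, subst_mem_supp_degGE hτ0 hf2⟩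
  rw [← hC.pullback_subst hn hU hS hS', ← hC.pullback_subst hn hU hS hS', ← hf1,
    subst_subst hτ0 hU.constantCoeff]
  simp_rw [hτ]
  rw [subst_id]

/-- The dominant exponents of the pullbacks of formal power series. -/
def formalSemigroup {r : ℕ} (n : ℕ) (S : Ser r) : Set (Fin r →₀ ℕ) :=
  {γ | ∃ h : Ser (r + 1), IsDominantExponent (pullback n S h) γ}

/-- The elimination set of the formal semigroup. -/
def formalEliminationSet {r : ℕ} (n : ℕ) (l : Fin r →₀ ℕ) (S : Ser r) : Set (Fin r →₀ ℕ) :=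
  formalSemigroup n S ∪
    {γ | ∃ i : Fin r, n ≤ l i ∧ ∃ δ ∈ formalSemigroup n S,
      γ + Finsupp.single i n = δ + 2 • l}

theorem eliminationSet_subset (n : ℕ) (l : Fin r →₀ ℕ) (S : Ser r) :
    eliminationSet n l S ⊆ formalEliminationSet n l S := by
  have h0 : assocSemigroup n S ⊆ formalSemigroup n S := fun γ ⟨h, _, hd⟩ => ⟨h, hd⟩
  refine Set.union_subset_union h0 fun γ h => ?_
  simp only [Set.mem_iUnion] at h
  obtain ⟨i, hi, δ, hδ, hγδ⟩ := h
  exact ⟨i, hi, δ, h0 hδ, hγδ⟩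

/-- Dominant exponents are unaffected by ρ, so a series h for S' may be replaced by its substitution
by σ for S. Formal series are used because the limiting σ need not converge. -/
theorem formalEliminationSet_subset_of_carries (hn : 0 < n) (hC : Carries n σ ρ S S')
    (hU : IsUnipotent n l σ ρ) (hS : constantCoeff S = 0) (hS' : constantCoeff S' = 0) :
    formalEliminationSet n l S' ⊆ formalEliminationSet n l S := by
  have h0 : formalSemigroup n S' ⊆ formalSemigroup n S := fun γ ⟨h, hd⟩ =>
    ⟨subst σ h, by rwa [hC.pullback_subst hn hU hS hS', hU.monic.isDominantExponent_iff]⟩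
  refine Set.union_subset_union h0 ?_
  rintro γ ⟨i, hi, δ, hδ, hγδ⟩
  exact ⟨i, hi, δ, h0 hδ, hγδ⟩

end Transfer

/-! ### Elimination up to terms of higher degree -/

/-- A polynomial truncation converges, and because it creates no new monomials it inherits
`TermsAbove`. -/
theorem exists_truncation {k : ℕ} (h : Ser k) (M : ℕ) :
    ∃ f : Ser k, IsConvergent f ∧ (∀ d, coeff d f ≠ 0 → coeff d h ≠ 0) ∧
      f - h ∈ supp (degGE k M) := by
  classical
  let f : Ser k := fun m => if m.degree < M then coeff m h else 0
  have hf : ∀ m, coeff m f = if m.degree < M then coeff m h else 0 := fun _ => rfl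
  refine ⟨f, isConvergent_of_finite ((Finsupp.finite_of_degree_lt M).subset fun m hm => ?_),
    fun d hd h0 => hd ?_, fun m hm => ?_⟩
  · by_contra h0
    have h1 : ¬ m.degree < M := h0
    exact hm (by rw [hf, if_neg h1])
  · rw [hf, h0, ite_self]
  · rw [mem_degGE, not_le] at hm
    rw [map_sub, hf, if_pos hm, sub_self]

theorem mem_supp_of_monomial_mul {k : ℕ} {a : Fin k →₀ ℕ} {f : Ser k}
    {U V : UpperSet (Fin k →₀ ℕ)} (h : monomial a 1 * f ∈ supp U)
    (hUV : ∀ m, a + m ∈ U → m ∈ V) : f ∈ supp V := fun m hm => by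
  have := h (a + m) fun h1 => hm (hUV m h1)
  rwa [coeff_add_monomial_mul, one_mul] at this

section Step

variable {r g n : ℕ} [NeZero g] {lam : Fin g → Fin r →₀ ℕ} {S : Ser r}

/-- A formal witness h is replaced by one of high order and then truncated to a polynomial. The loss
2|λ₁| in the order of σ comes from δ = γ + ν_i - 2λ₁; the loss |λ₁| for ρ comes from cancelling
t^{λ₁}. -/
theorem exists_elimination_step (hS : IsNormalized n lam S) {P : ℕ → ℕ} (hP : OrderBound n S P)
    (γ : Fin r →₀ ℕ) :
    ∃ (σ : Fin (r + 1) → Ser (r + 1)) (ρ : Fin r → Ser r) (S' : Ser r),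
      IsNormalized n lam S' ∧ ConjStable n S S' ∧ IsUnipotent n (lam 0) σ ρ ∧
      (∀ j, IsConvergent (σ j)) ∧ (∀ i, IsConvergent (ρ i)) ∧ Carries n σ ρ S S' ∧
      (γ ∈ formalEliminationSet n (lam 0) S → lam 0 < γ → coeff γ S' = 0) ∧
      (∀ δ, δ.degree ≤ γ.degree → δ ≠ γ → coeff δ S' = coeff δ S) ∧
      (∀ j, σ j - X j ∈ supp (degGE (r + 1) (P (γ.degree - 2 * (lam 0).degree)))) ∧
      ∀ i, ρ i - X i ∈ supp (degGE r (γ.degree - (lam 0).degree)) := by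
  have hN := hS.1
  have hn := hN.isFormalQOParam.pos
  have hS0 := hN.isFormalQOParam.nonunit
  have hH0 := constantCoeff_param hn hS0
  by_cases hγ : γ ∈ formalEliminationSet n (lam 0) S ∧ lam 0 < γ
  swap
  · refine ⟨fun j => X j, fun i => X i, S, hS, fun ω ω' _ _ => ⟨id, fun _ => id⟩,
      isUnipotent_X n (lam 0), isConvergent_X, isConvergent_X, fun j => ?_,
      fun h1 h2 => absurd ⟨h1, h2⟩ hγ, fun _ _ _ => rfl, fun j => ?_, fun i => ?_⟩
    · rw [subst_X (hasSubst hH0), subst_id]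
    · rw [sub_self]; exact zero_mem _
    · rw [sub_self]; exact zero_mem _
  obtain ⟨hγ, hlt⟩ := hγ
  -- This set contains everything strictly above γ and also absorbs the truncation error.
  let U := degGE r (γ.degree + 1)
  have hγU : γ ∉ U := by simp [U, mem_degGE]
  have hU : ∀ δ, γ < δ → δ ∈ U := fun δ hδ => by
    obtain ⟨e, rfl⟩ := exists_add_of_le hδ.le
    have he : e.degree ≠ 0 := fun h0 => by
      rw [Finsupp.degree_eq_zero_iff] at h0
      rw [h0, add_zero] at hδ
      exact lt_irrefl _ hδ
    rw [mem_degGE, map_add]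
    omega
  have hIoiU : ∀ δ ∈ UpperSet.Ioi γ, δ ∈ U := fun δ hδ => hU δ (UpperSet.mem_Ioi_iff.1 hδ)
  -- replace `h` by a series of higher order and truncate it
  have hprep : ∀ (δ : Fin r →₀ ℕ) (h : Ser (r + 1)) (M : ℕ), IsDominantExponent (pullback n S h) δ →
      γ.degree - 2 * (lam 0).degree ≤ δ.degree → ∃ h' f : Ser (r + 1), IsConvergent f ∧
        IsDominantExponent (pullback n S h') δ ∧
        (∀ d, coeff d f ≠ 0 → coeff d h' ≠ 0) ∧
        pullback n S f - pullback n S h' ∈ supp (degGE r M) ∧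
        f ∈ supp (degGE (r + 1) (P (γ.degree - 2 * (lam 0).degree))) := by
    intro δ h M hd hδ
    obtain ⟨h', hh', hord⟩ := hP _ h (supp_mono (fun m hm => by
      rw [UpperSet.mem_Ici_iff] at hm
      exact hδ.trans (Finsupp.degree_mono hm)) (isDominantExponent_iff.1 hd).2)
    obtain ⟨f, hfc, hfs, hfM⟩ := exists_truncation h' M
    refine ⟨h', f, hfc, by rwa [hh'], hfs, ?_, fun d hd => by_contra fun h0 => hfs d h0 (hord d hd)⟩
    have := subst_mem_supp_degGE hH0 hfM
    rwa [subst_sub (hasSubst hH0)] at this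
  suffices ∃ (σ : Fin (r + 1) → Ser (r + 1)) (ρ : Fin r → Ser r) (S' : Ser r),
      Eliminates n lam S γ U σ ρ S' ∧
      (∀ j, σ j - X j ∈ supp (degGE (r + 1) (P (γ.degree - 2 * (lam 0).degree)))) ∧
      ∀ i, ρ i - X i ∈ supp (degGE r (γ.degree - (lam 0).degree)) by
    obtain ⟨σ, ρ, S', hE, h1, h2⟩ := this
    refine ⟨σ, ρ, S', hE.isNormalized, hE.conjStable, hE.isUnipotent, hE.convergent_left,
      hE.convergent_right, hE.carries, fun _ _ => hE.coeff_eq_zero, fun δ hδ => hE.coeff_eq δ ?_,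
      h1, h2⟩
    rw [mem_degGE]
    omega
  rcases hγ with ⟨h, hd⟩ | ⟨i, hi, δ, ⟨h, hd⟩, hγδ⟩
  · obtain ⟨h', f, hfc, hd', hfs, hfM, hford⟩ := hprep γ h (γ.degree + 1) hd (Nat.sub_le _ _)
    have hT := termsAbove_of_pullback hN (supp_mono (fun m hm => by
      rw [UpperSet.mem_Ici_iff] at hm
      exact lt_of_lt_of_le hlt hm) (isDominantExponent_iff.1 hd').2)
    obtain ⟨σ, S', hE, hσ⟩ := eliminates_of_mem_semigroup hS (U := U) hγU
      (fun d hd => hT d (hfs d hd)) hfc hd'.1 (by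
        rw [← sub_add_sub_cancel _ (pullback n S h')]
        exact add_mem hfM (supp_mono hIoiU hd'.sub_monomial_mem))
    exact ⟨σ, _, S', hE, hσ _ hford, fun i => by rw [sub_self]; exact zero_mem _⟩
  · have hdeg : γ.degree + n = δ.degree + 2 * (lam 0).degree := by
      have := congrArg Finsupp.degree hγδ
      rwa [map_add, map_add, Finsupp.degree_single, map_nsmul, smul_eq_mul] at this
    -- The additional n compensates for the division by t_i^n.
    obtain ⟨h', f, hfc, hd', hfs, hfM, hford⟩ := hprep δ h (γ.degree + 1 + n) hd (by omega)
    obtain ⟨w, hw⟩ := exists_X_pow_mul_eq hN hi (pullback n S f)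
    obtain ⟨w', hw'⟩ := exists_X_pow_mul_eq hN hi (pullback n S h')
    have hdw := isDominantExponent_translate hN hγδ hd' hw'
    have hww : w - w' ∈ supp U := by
      refine mem_supp_of_monomial_mul (a := Finsupp.single i n) (U := degGE r (γ.degree + 1 + n))
        ?_ fun m hm => ?_
      · rw [← X_pow_eq, mul_sub, hw, hw', ← mul_sub]
        exact Ideal.mul_mem_left _ _ hfM
      · rw [mem_degGE, map_add, Finsupp.degree_single] at hm
        rw [mem_degGE]
        omega
    obtain ⟨σ, ρ, S', hE, hσ, hρ⟩ := eliminates_of_mem_translate hS hlt hγU hU hi hfc hw hdw.1 (by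
        rw [← sub_add_sub_cancel _ (monomial (lam 0) 1 * w'), ← mul_sub]
        exact add_mem (Ideal.mul_mem_left _ _ hww) (supp_mono hIoiU hdw.sub_monomial_mem))
    refine ⟨σ, ρ, S', hE, hσ _ hford, fun j => ?_⟩
    refine mem_supp_of_monomial_mul (hρ (degGE r γ.degree) (mem_degGE.2 le_rfl)
      (fun m hm => mem_degGE.2 ((Nat.le_succ _).trans (mem_degGE.1 hm))) j) fun m hm => ?_
    rw [mem_degGE, map_add] at hm
    rw [mem_degGE]
    omega

end Step

/-! ### Composition and limits of unipotent coordinate changes -/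

theorem isMonic_iff {k : ℕ} {a : Fin k → Ser k} :
    IsMonic a ↔ ∀ i, a i ∈ supp (varSet i) ∧ a i - X i ∈ supp (degGE k 2) := by
  constructor
  · intro h i
    refine ⟨?_, h.sub_mem i⟩
    obtain ⟨v, -, hv⟩ := h i
    rw [hv]
    exact Ideal.mul_mem_right _ _ (monomial_mem_supp (by simp [mem_varSet]) 1)
  · intro h i
    obtain ⟨h1, h2⟩ := h i
    have h3 : a i - X i ∈ supp (UpperSet.Ici (Finsupp.single i 1)) :=
      supp_mono (fun m hm => by
        rw [UpperSet.mem_Ici_iff, Finsupp.single_le_iff]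
        exact Nat.one_le_iff_ne_zero.2 (mem_varSet.1 hm))
        (sub_mem h1 (monomial_mem_supp (by simp [mem_varSet]) 1))
    obtain ⟨v, hv, hv'⟩ := exists_eq_monomial_mul h3
    refine ⟨v, ?_, ?_⟩
    · rw [← coeff_zero_eq_constantCoeff_apply, hv', add_zero]
      exact h2 _ (by simp [mem_degGE])
    · rw [mul_add, mul_one, X_def, ← hv, ← X_def, add_sub_cancel]

theorem IsMonic.comp {k : ℕ} {a b : Fin k → Ser k} (ha : IsMonic a) (hb : IsMonic b) :
    IsMonic (QuasiOrdinary.comp a b) := fun i => by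
  obtain ⟨v, hv, hv'⟩ := ha i
  obtain ⟨w, hw, hw'⟩ := hb i
  have hs := hasSubst hb.constantCoeff
  refine ⟨w + subst b v + w * subst b v, ?_, ?_⟩
  · rw [map_add, map_add, map_mul, hw, constantCoeff_subst_zero hb.constantCoeff hv]
    simp
  · rw [QuasiOrdinary.comp, hv', subst_mul hs, subst_X hs, hw', subst_add hs,
      subst_one hb.constantCoeff]
    ring

theorem mon_mem_of_mem {k l : ℕ} {a : Fin k → Ser l} {d : Fin k →₀ ℕ} {s : Fin k} (hd : d s ≠ 0)
    {I : Ideal (Ser l)} (h : a s ∈ I) : mon a d ∈ I := by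
  rw [mon_eq, ← Finset.mul_prod_erase _ _ (Finset.mem_univ s)]
  exact Ideal.mul_mem_right _ _ (Ideal.pow_mem_of_mem I h _ (Nat.pos_of_ne_zero hd))

/-- The ideals in the definition are stable under substitution. If n ≤ l i, then X^α is divisible by
X_i, so σ'_{r+1} lies in (X_i, X_{r+1}); and modulo X_{r+1} each σ'_i is divisible by X_i, so X^α is
sent into (X_{r+1}, X^α). -/
theorem IsUnipotent.comp {r n : ℕ} (hn : 0 < n) {l : Fin r →₀ ℕ}
    {σ σ' : Fin (r + 1) → Ser (r + 1)} {ρ ρ' : Fin r → Ser r} (h : IsUnipotent n l σ ρ)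
    (h' : IsUnipotent n l σ' ρ') :
    IsUnipotent n l (QuasiOrdinary.comp σ σ') (QuasiOrdinary.comp ρ ρ') := by
  have h0 := h'.constantCoeff
  have hs := hasSubst h0
  refine ⟨h.monic.comp h'.monic, fun i => ?_, fun i => ?_, ?_, ?_⟩
  · refine subst_mem_supp h0 fun d hd => ?_
    have hdm : d ∈ mixedSet n l i := by_contra fun h1 => hd (h.mem i d h1)
    rcases mem_mixedSet.1 hdm with h1 | ⟨h1, h2⟩
    · exact mon_mem_of_mem h1 (h'.mem i)
    · refine mon_mem_of_mem h2 (supp_mono (fun m hm => ?_) h'.mem_last)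
      rw [mem_mixedSet]
      refine (mem_lastSet.1 hm).elim (fun h3 => Or.inr ⟨h1, h3⟩) fun h3 => Or.inl fun h4 => ?_
      have := h3 i
      rw [h4, mul_zero] at this
      omega
  · obtain ⟨d, hd, hd2⟩ := h.jet i
    obtain ⟨d', hd', hd2'⟩ := h'.jet i
    refine ⟨d + d', fun hi => by rw [hd hi, hd' hi, add_zero], ?_⟩
    have h1 := subst_mem_supp_degGE h0 hd2
    rw [subst_sub hs, subst_add hs, subst_mul hs, subst_C' h0, subst_X hs, subst_X hs] at h1
    have h2 := add_mem (add_mem h1 hd2') (Ideal.mul_mem_left _ (C d) h'.jet_last)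
    convert h2 using 1
    rw [map_add, QuasiOrdinary.comp]
    ring
  -- Here y_i collects the terms of σ'_i divisible by X_i; the remainder is a multiple of X_{r+1}.
  · have hy : ∀ i : Fin r, ∃ y, y ∈ supp (UpperSet.Ici (Finsupp.single i.castSucc 1)) ∧
        σ' i.castSucc - y ∈ supp (varSet (Fin.last r)) := fun i => by
      obtain ⟨p, q, hpq, -⟩ := exists_eq_monomial_mul_add (a := Finsupp.single i.castSucc 1)
        (b := Finsupp.single (Fin.last r) 1) (fun m hm => by
          rw [mem_mixedSet] at hm
          rw [Finsupp.single_le_iff, Finsupp.single_le_iff]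
          omega) (h'.mem i)
      refine ⟨monomial (Finsupp.single i.castSucc 1) 1 * p,
        Ideal.mul_mem_right _ _ (monomial_mem_supp (by simp) 1), ?_⟩
      rw [hpq, add_sub_cancel_left]
      exact Ideal.mul_mem_right _ _ (monomial_mem_supp (by simp [mem_varSet]) 1)
    choose y hy1 hy2 using hy
    refine subst_mem_supp h0 fun d hd => ?_
    have hdm : d ∈ lastSet n l := by_contra fun h1 => hd (h.mem_last d h1)
    rcases mem_lastSet.1 hdm with h1 | h1
    · exact mon_mem_of_mem h1 h'.mem_last
    · rw [mon_eq, Fin.prod_univ_castSucc]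
      refine Ideal.mul_mem_right _ _ ?_
      rw [← sub_add_cancel (∏ i : Fin r, _) (∏ i : Fin r, y i ^ d i.castSucc)]
      refine add_mem (supp_mono (U := varSet (Fin.last r))
        (fun m hm => mem_lastSet.2 (Or.inl (mem_varSet.1 hm)))
        (prod_sub_prod_mem _ _ _ _ fun i _ => pow_sub_pow_mem _ (hy2 i) _))
        (supp_mono (fun m hm => ?_) (prod_mem_supp_Ici _ _ _ fun i _ => pow_mem_supp_Ici (hy1 i) _))
      refine mem_lastSet.2 (Or.inr fun i => (h1 i).trans (Nat.mul_le_mul_left n ?_))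
      have h2 := UpperSet.mem_Ici_iff.1 hm i.castSucc
      rw [Finsupp.finsetSum_apply] at h2
      refine le_trans ?_ h2
      refine le_trans ?_ (Finset.single_le_sum (fun _ _ => Nat.zero_le _) (Finset.mem_univ i))
      simp
  · have h1 := subst_mem_supp_degGE h0 h.jet_last
    rw [subst_sub hs, subst_X hs] at h1
    have := add_mem h1 h'.jet_last
    rwa [sub_add_sub_cancel] at this

theorem Carries.comp {r n : ℕ} (hn : 0 < n) {l : Fin r →₀ ℕ}
    {σ σ' : Fin (r + 1) → Ser (r + 1)} {ρ ρ' : Fin r → Ser r} {S S' S'' : Ser r}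
    (hU : IsUnipotent n l σ ρ) (hU' : IsUnipotent n l σ' ρ')
    (hS : constantCoeff S = 0) (hS' : constantCoeff S' = 0)
    (h : Carries n σ ρ S S') (h' : Carries n σ' ρ' S' S'') :
    Carries n (QuasiOrdinary.comp σ' σ) (QuasiOrdinary.comp ρ' ρ) S S'' := fun j => by
  have h1 := h.pullback_subst hn hU hS hS' (σ' j)
  rw [pullback, pullback, h' j, subst_subst hU'.monic.constantCoeff hU.monic.constantCoeff] at h1
  exact h1

theorem formallyTendsto_iff {k : ℕ} {f : ℕ → Ser k} {F : Ser k} :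
    FormallyTendsto f F ↔ ∀ p, ∀ᶠ j in atTop, F - f j ∈ supp (degGE k p) := by
  constructor
  · intro h p
    have := (eventually_all_finite (Finsupp.finite_of_degree_lt (σ := Fin k) p)).2
      fun m _ => h m
    filter_upwards [this] with j hj m hm
    rw [mem_degGE, not_le] at hm
    rw [map_sub, hj m hm, sub_self]
  · intro h m
    filter_upwards [h (m.degree + 1)] with j hj
    have := hj m (by rw [mem_degGE]; omega)
    rw [map_sub, sub_eq_zero] at this
    exact this.symm

theorem FormallyTendsto.mem_supp {k : ℕ} {f : ℕ → Ser k} {F : Ser k} (h : FormallyTendsto f F)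
    {U : UpperSet (Fin k →₀ ℕ)} (hU : ∀ j, f j ∈ supp U) : F ∈ supp U := fun m hm => by
  obtain ⟨j, hj⟩ := (h m).exists
  rw [← hj, hU j m hm]

theorem FormallyTendsto.unique {k : ℕ} {f : ℕ → Ser k} {F F' : Ser k} (h : FormallyTendsto f F)
    (h' : FormallyTendsto f F') : F = F' := by
  ext m
  obtain ⟨j, hj, hj'⟩ := ((h m).and (h' m)).exists
  rw [← hj, hj']

theorem FormallyTendsto.subst {k l : ℕ} {a : ℕ → Fin k → Ser l} {A : Fin k → Ser l}
    {f : ℕ → Ser k} {F : Ser k} (ha0 : ∀ j i, constantCoeff (a j i) = 0)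
    (hA0 : ∀ i, constantCoeff (A i) = 0) (ha : ∀ i, FormallyTendsto (fun j => a j i) (A i))
    (hf : FormallyTendsto f F) : FormallyTendsto (fun j => subst (a j) (f j)) (subst A F) := by
  rw [formallyTendsto_iff] at *
  intro p
  filter_upwards [hf p, eventually_all.2 fun i => formallyTendsto_iff.1 (ha i) p] with j h1 h2
  have h3 := subst_mem_supp_degGE (ha0 j) h1
  rw [subst_sub (hasSubst (ha0 j))] at h3
  have := add_mem (subst_sub_subst_mem_supp' hA0 (ha0 j) h2 F) h3
  rwa [sub_add_sub_cancel] at this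

theorem formallyTendsto_const {k : ℕ} (F : Ser k) : FormallyTendsto (fun _ => F) F :=
  fun _ => Eventually.of_forall fun _ => rfl

/-- A sequence whose increments have orders tending to infinity converges. -/
theorem exists_formallyTendsto {k : ℕ} {f : ℕ → Ser k} {q : ℕ → ℕ} (hq : Tendsto q atTop atTop)
    (h : ∀ j, f (j + 1) - f j ∈ supp (degGE k (q j))) : ∃ F, FormallyTendsto f F := by
  have hJ : ∀ m : Fin k →₀ ℕ, ∃ J, ∀ j ≥ J, coeff m (f j) = coeff m (f J) := fun m => by
    obtain ⟨J, hJ⟩ := eventually_atTop.1 (tendsto_atTop.1 hq (m.degree + 1))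
    refine ⟨J, fun j hj => ?_⟩
    induction j, hj using Nat.le_induction with
    | base => rfl
    | succ j hj ih =>
      rw [← ih, ← sub_eq_zero, ← map_sub]
      refine h j m ?_
      have := hJ j hj
      rw [mem_degGE]
      omega
  choose J hJ using hJ
  exact ⟨fun m => coeff m (f (J m)), fun m => eventually_atTop.2 ⟨J m, hJ m⟩⟩

theorem exists_iterComp_tendsto {k : ℕ} {f : ℕ → Fin k → Ser k} {q : ℕ → ℕ}
    (hq : Tendsto q atTop atTop) (h : ∀ j i, f j i - X i ∈ supp (degGE k (q j)))
    (h0 : ∀ j i, constantCoeff (iterComp f j i) = 0) :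
    ∃ F : Fin k → Ser k, ∀ i, FormallyTendsto (fun j => iterComp f j i) (F i) := by
  have : ∀ i, ∃ F, FormallyTendsto (fun j => iterComp f j i) F := fun i => by
    refine exists_formallyTendsto hq fun j => ?_
    have := subst_mem_supp_degGE (h0 j) (h j i)
    rwa [subst_sub (hasSubst (h0 j)), subst_X (hasSubst (h0 j))] at this
  choose F hF using this
  exact ⟨F, hF⟩

/-- Support conditions pass to coefficientwise limits, and the one-jet of the limit is attained at a
finite stage. -/
theorem IsUnipotent.of_tendsto {r n : ℕ} {l : Fin r →₀ ℕ}
    {σ : ℕ → Fin (r + 1) → Ser (r + 1)} {ρ : ℕ → Fin r → Ser r}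
    {σ' : Fin (r + 1) → Ser (r + 1)} {ρ' : Fin r → Ser r}
    (h : ∀ j, IsUnipotent n l (σ j) (ρ j)) (hσ : ∀ i, FormallyTendsto (fun j => σ j i) (σ' i))
    (hρ : ∀ i, FormallyTendsto (fun j => ρ j i) (ρ' i)) : IsUnipotent n l σ' ρ' := by
  refine ⟨isMonic_iff.2 fun i => ⟨?_, ?_⟩, fun i => ?_, fun i => ?_, ?_, ?_⟩
  · exact (hρ i).mem_supp fun j => ((isMonic_iff.1 (h j).monic) i).1
  · obtain ⟨j, hj⟩ := (formallyTendsto_iff.1 (hρ i) 2).exists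
    rw [← sub_add_sub_cancel]
    exact add_mem hj ((isMonic_iff.1 (h j).monic) i).2
  · exact (hσ _).mem_supp fun j => (h j).mem i
  · obtain ⟨j, hj⟩ := (formallyTendsto_iff.1 (hσ i.castSucc) 2).exists
    obtain ⟨d, hd, hd2⟩ := (h j).jet i
    refine ⟨d, hd, ?_⟩
    rw [← sub_add_sub_cancel]
    exact add_mem hj hd2
  · exact (hσ _).mem_supp fun j => (h j).mem_last
  · obtain ⟨j, hj⟩ := (formallyTendsto_iff.1 (hσ (Fin.last r)) 2).exists
    rw [← sub_add_sub_cancel]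
    exact add_mem hj (h j).jet_last

theorem FormallyTendsto.param {r n : ℕ} {T : ℕ → Ser r} {S : Ser r} (h : FormallyTendsto T S)
    (i : Fin (r + 1)) : FormallyTendsto (fun j => param n (T j) i) (param n S i) := by
  induction i using Fin.lastCases with
  | last => simp_rw [param_last]; exact h
  | cast i => simp_rw [param_castSucc]; exact formallyTendsto_const _

/-- The limit of a sequence of coordinate changes. -/
theorem exists_limit_carries {r n : ℕ} (hn : 0 < n) {l : Fin r →₀ ℕ}
    {σ : ℕ → Fin (r + 1) → Ser (r + 1)} {ρ : ℕ → Fin r → Ser r} {T : ℕ → Ser r} {S' : Ser r}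
    (hU : ∀ j, IsUnipotent n l (σ j) (ρ j)) (hT0 : ∀ j, constantCoeff (T j) = 0)
    (hC : ∀ j, Carries n (σ j) (ρ j) (T j) (T (j + 1))) (hT : FormallyTendsto T S')
    {q : ℕ → ℕ} (hq : Tendsto q atTop atTop)
    (hσ : ∀ j i, σ j i - X i ∈ supp (degGE (r + 1) (q j)))
    (hρ : ∀ j i, ρ j i - X i ∈ supp (degGE r (q j))) :
    ∃ (σ' : Fin (r + 1) → Ser (r + 1)) (ρ' : Fin r → Ser r),
      (∀ i, FormallyTendsto (fun j => iterComp σ j i) (σ' i)) ∧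
      (∀ i, FormallyTendsto (fun j => iterComp ρ j i) (ρ' i)) ∧
      IsUnipotent n l σ' ρ' ∧ Carries n σ' ρ' (T 0) S' := by
  have hI : ∀ j, IsUnipotent n l (iterComp σ j) (iterComp ρ j) ∧
      Carries n (iterComp σ j) (iterComp ρ j) (T 0) (T j) := fun j => by
    induction j with
    | zero =>
      refine ⟨isUnipotent_X n l, fun i => ?_⟩
      rw [iterComp, iterComp, subst_X (hasSubst (constantCoeff_param hn (hT0 0))), subst_id]
    | succ j ih =>
      exact ⟨(hU j).comp hn ih.1, ih.2.comp hn ih.1 (hU j) (hT0 0) (hT0 j) (hC j)⟩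
  have hσ0 := fun j => (hI j).1.constantCoeff
  have hρ0 := fun j => (hI j).1.monic.constantCoeff
  obtain ⟨σ', hσ'⟩ := exists_iterComp_tendsto hq hσ hσ0
  obtain ⟨ρ', hρ'⟩ := exists_iterComp_tendsto hq hρ hρ0
  have hU' : IsUnipotent n l σ' ρ' := IsUnipotent.of_tendsto (fun j => (hI j).1) hσ' hρ'
  refine ⟨σ', ρ', hσ', hρ', hU', fun i => ?_⟩
  have hH0 := constantCoeff_param hn (hT0 0)
  have h1 := FormallyTendsto.subst (a := fun _ => QuasiOrdinary.param n (T 0)) (fun _ => hH0) hH0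
    (fun _ => formallyTendsto_const _) (hσ' i)
  have h2 := FormallyTendsto.subst hρ0 hU'.monic.constantCoeff hρ' (hT.param (n := n) i)
  -- Both sides of the desired identity are limits of the same sequence.
  refine h1.unique ?_
  convert h2 using 2 with j
  exact (hI j).2 i

/-! ### Enumeration of the exponents -/

theorem exists_enumeration {k : ℕ} [NeZero k] : ∃ e : ℕ → Fin k →₀ ℕ, Function.Bijective e ∧
    ∀ i j, i ≤ j → (e i).degree ≤ (e j).degree := by
  classical
  let F : ℕ → Finset (Fin k →₀ ℕ) := fun d => (Finsupp.finite_of_degree_lt d).toFinset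
  have hF : ∀ d γ, γ ∈ F d ↔ γ.degree < d := fun d γ => by simp [F]
  -- The sum over all exponents of lower degree makes φ increase strictly with the degree, while the
  -- last summand separates exponents of equal degree. Listing the infinite range of φ in order
  -- gives the enumeration.
  let φ : (Fin k →₀ ℕ) → ℕ := fun γ =>
    ∑ δ ∈ F γ.degree, (Encodable.encode δ + 1) + Encodable.encode γ
  have hφ : ∀ γ γ', γ.degree < γ'.degree → φ γ < φ γ' := fun γ γ' h => by
    have h1 : insert γ (F γ.degree) ⊆ F γ'.degree := fun δ hδ => by
      rw [hF]
      rcases Finset.mem_insert.1 hδ with rfl | h2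
      · exact h
      · exact ((hF _ _).1 h2).trans h
    have h2 := Finset.sum_le_sum_of_subset (f := fun δ => Encodable.encode δ + 1) h1
    rw [Finset.sum_insert (by simp [hF])] at h2
    simp only [φ]
    omega
  have hinj : Function.Injective φ := fun γ γ' h => by
    have hdeg : γ.degree = γ'.degree := by
      rcases lt_trichotomy γ.degree γ'.degree with h1 | h1 | h1
      · exact absurd h (hφ _ _ h1).ne
      · exact h1
      · exact absurd h (hφ _ _ h1).ne'
    simp only [φ, hdeg, add_right_inj] at h
    exact Encodable.encode_injective h
  have hinf : Infinite (Fin k →₀ ℕ) :=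
    Infinite.of_injective (fun m : ℕ => Finsupp.single (0 : Fin k) m) (Finsupp.single_injective 0)
  have : Infinite (Set.range φ) := Set.infinite_coe_iff.2 (Set.infinite_range_of_injective hinj)
  let o := Nat.Subtype.orderIsoOfNat (Set.range φ)
  let b := Equiv.ofInjective φ hinj
  have hb : ∀ j, φ (b.symm (o j)) = o j := fun j =>
    congrArg Subtype.val (b.apply_symm_apply (o j))
  refine ⟨fun j => b.symm (o j), b.symm.bijective.comp o.bijective, fun i j hij => ?_⟩
  by_contra hlt
  have h1 := hφ _ _ (not_le.1 hlt)
  rw [hb, hb] at h1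
  exact absurd (o.monotone hij) (not_le.2 h1)

theorem tendsto_degree {k : ℕ} {e : ℕ → Fin k →₀ ℕ} (he : Function.Injective e) :
    Tendsto (fun j => (e j).degree) atTop atTop := by
  refine tendsto_atTop.2 fun d => ?_
  rw [← Nat.cofinite_eq_atTop]
  refine ((Finsupp.finite_of_degree_lt (σ := Fin k) d).preimage he.injOn).subset fun j hj => ?_
  exact not_le.1 (show ¬ d ≤ (e j).degree from hj)

/-! ### Stability of conjugates under composition and limits -/

theorem ConjStable.trans {r n : ℕ} {S S' S'' : Ser r} (h : ConjStable n S S')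
    (h' : ConjStable n S' S'') : ConjStable n S S'' := fun ω ω' hω hω' =>
  ⟨fun h1 => (h' ω ω' hω hω').1 ((h ω ω' hω hω').1 h1),
    fun l hl => (h' ω ω' hω hω').2 l ((h ω ω' hω hω').2 l hl)⟩

theorem ConjStable.of_tendsto {r n : ℕ} {S S' : Ser r} {T : ℕ → Ser r}
    (h : ∀ j, ConjStable n S (T j)) (hT : FormallyTendsto T S') : ConjStable n S S' := by
  have hcoeff : ∀ ω ω' : Fin r → ℂ, ∀ m, ∃ j,
      coeff m (rescale ω S' - rescale ω' S') = coeff m (rescale ω (T j) - rescale ω' (T j)) :=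
    fun ω ω' m => by
      obtain ⟨j, hj⟩ := (hT m).exists
      refine ⟨j, ?_⟩
      rw [map_sub, map_sub, coeff_rescale, coeff_rescale, coeff_rescale, coeff_rescale, hj]
  intro ω ω' hω hω'
  constructor
  · intro heq
    rw [← sub_eq_zero]
    ext m
    obtain ⟨j, hj⟩ := hcoeff ω ω' m
    rw [hj, (h j ω ω' hω hω').1 heq, sub_self]
  · intro l hl
    refine ⟨?_, fun δ hδ => ?_⟩
    · obtain ⟨j, hj⟩ := hcoeff ω ω' l
      rw [hj]
      exact ((h j ω ω' hω hω').2 l hl).1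
    · obtain ⟨j, hj⟩ := hcoeff ω ω' δ
      rw [hj] at hδ
      exact ((h j ω ω' hω hω').2 l hl).2 δ hδ

/-! ### The quasi-short form -/

section QuasiShort

variable {r g n : ℕ} [NeZero g] {lam : Fin g → Fin r →₀ ℕ} {S : Ser r}

theorem exists_quasiShort (hS : IsNormalized n lam S) :
    ∃ S' : Ser r, IsFormalQuasiShort n lam S' ∧ FormallyEquivalent n lam S S' := by
  have hn := hS.1.isFormalQOParam.pos
  -- With no variables λ₁ would be zero; a variable is needed for an infinite enumeration.
  have hr : NeZero r := ⟨by
    rintro rfl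
    exact hS.1.ne_zero (Subsingleton.elim _ _)⟩
  obtain ⟨P, hP, hPt⟩ := exists_orderBound hn hS.1.isFormalQOParam.nonunit
  obtain ⟨e, he, hmono⟩ := exists_enumeration (k := r)
  have hdeg := tendsto_degree he.injective
  -- The state carries the order bound with the same `P` throughout, so the orders of the coordinate
  -- changes tend to infinity uniformly.
  have hstep : ∀ j (T : {T : Ser r // IsNormalized n lam T ∧ OrderBound n T P}), ∃
      (T' : {T : Ser r // IsNormalized n lam T ∧ OrderBound n T P})
      (σ : Fin (r + 1) → Ser (r + 1)) (ρ : Fin r → Ser r),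
      ConjStable n T.1 T'.1 ∧ IsUnipotent n (lam 0) σ ρ ∧
      (∀ j, IsConvergent (σ j)) ∧ (∀ i, IsConvergent (ρ i)) ∧ Carries n σ ρ T.1 T'.1 ∧
      (e j ∈ formalEliminationSet n (lam 0) T.1 → lam 0 < e j → coeff (e j) T'.1 = 0) ∧
      (∀ δ, δ.degree ≤ (e j).degree → δ ≠ e j → coeff δ T'.1 = coeff δ T.1) ∧
      (∀ i, σ i - X i ∈ supp (degGE (r + 1) (P ((e j).degree - 2 * (lam 0).degree)))) ∧
      ∀ i, ρ i - X i ∈ supp (degGE r ((e j).degree - (lam 0).degree)) := by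
    rintro j ⟨T, hT, hTP⟩
    obtain ⟨σ, ρ, T', h1, h2, h3, h4, h5, h6, h7⟩ := exists_elimination_step hT hTP (e j)
    exact ⟨⟨T', h1, hTP.of_carries hn h6 h3 hT.1.isFormalQOParam.nonunit
      h1.1.isFormalQOParam.nonunit⟩, σ, ρ, h2, h3, h4, h5, h6, h7⟩
  choose N sσ sρ hconj hU hσc hρc hC helim hkeep hσ hρ using hstep
  obtain ⟨T, hT0, hT⟩ : ∃ T : ℕ → {T : Ser r // IsNormalized n lam T ∧ OrderBound n T P},
      (T 0).1 = S ∧ ∀ j, T (j + 1) = N j (T j) :=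
    ⟨fun j => Nat.rec ⟨S, hS, hP⟩ (fun j x => N j x) j, rfl, fun _ => rfl⟩
  have hTnonunit : ∀ j, constantCoeff (T j).1 = 0 :=
    fun j => (T j).2.1.1.isFormalQOParam.nonunit
  -- each coefficient is changed only by finitely many steps
  have hlater : ∀ k j, k < j → coeff (e k) (T j).1 = coeff (e k) (T (k + 1)).1 := fun k j hkj => by
    induction j, hkj using Nat.le_induction with
    | base => rfl
    | succ j hkj ih =>
      rw [← ih, hT]
      exact hkeep j (T j) (e k) (hmono k j (by omega)) fun h => by
        have := he.injective h
        omega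
  obtain ⟨S', hS'⟩ : ∃ S' : Ser r, ∀ k, coeff (e k) S' = coeff (e k) (T (k + 1)).1 := by
    let E := Equiv.ofBijective e he
    refine ⟨fun m => coeff m (T (E.symm m + 1)).1, fun k => ?_⟩
    show coeff (e k) (T (E.symm (E k) + 1)).1 = _
    rw [E.symm_apply_apply]
  have hTS' : FormallyTendsto (fun j => (T j).1) S' := fun m => by
    obtain ⟨k, rfl⟩ := he.surjective m
    filter_upwards [eventually_gt_atTop k] with j hj
    rw [hlater k j hj, hS']
  obtain ⟨q, hq, hq1, hq2⟩ : ∃ q : ℕ → ℕ, Tendsto q atTop atTop ∧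
      (∀ j, q j ≤ P ((e j).degree - 2 * (lam 0).degree)) ∧
      ∀ j, q j ≤ (e j).degree - (lam 0).degree := by
    refine ⟨fun j => min (P ((e j).degree - 2 * (lam 0).degree))
      ((e j).degree - (lam 0).degree), tendsto_atTop.2 fun d => ?_,
      fun j => min_le_left _ _, fun j => min_le_right _ _⟩
    filter_upwards [(hPt.comp ((tendsto_sub_atTop_nat (2 * (lam 0).degree)).comp
      hdeg)).eventually_ge_atTop d, ((tendsto_sub_atTop_nat (lam 0).degree).comp
      hdeg).eventually_ge_atTop d] with j h1 h2
    exact le_min h1 h2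
  have hσq : ∀ j i, sσ j (T j) i - X i ∈ supp (degGE (r + 1) (q j)) := fun j i =>
    supp_mono (fun m hm => (hq1 j).trans (mem_degGE.1 hm)) (hσ j (T j) i)
  have hρq : ∀ j i, sρ j (T j) i - X i ∈ supp (degGE r (q j)) := fun j i =>
    supp_mono (fun m hm => (hq2 j).trans (mem_degGE.1 hm)) (hρ j (T j) i)
  -- The composition from step k onwards carries `T k` to the limit. The case k = 0 gives the formal
  -- equivalence; general k compares the elimination set of the limit with that of `T k`.
  have htail : ∀ k, ∃ (σ' : Fin (r + 1) → Ser (r + 1)) (ρ' : Fin r → Ser r),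
      (∀ i, FormallyTendsto (fun j => iterComp (fun j => sσ (k + j) (T (k + j))) j i) (σ' i)) ∧
      (∀ i, FormallyTendsto (fun j => iterComp (fun j => sρ (k + j) (T (k + j))) j i) (ρ' i)) ∧
      IsUnipotent n (lam 0) σ' ρ' ∧ Carries n σ' ρ' (T k).1 S' := fun k => by
    have hk : Tendsto (fun j : ℕ => k + j) atTop atTop :=
      tendsto_atTop_mono (fun j => Nat.le_add_left j k) tendsto_id
    have hC' : ∀ j, Carries n (sσ (k + j) (T (k + j))) (sρ (k + j) (T (k + j))) (T (k + j)).1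
        (T (k + (j + 1))).1 := fun j => by
      rw [← add_assoc, hT]
      exact hC _ _
    have hlim : FormallyTendsto (fun j => (T (k + j)).1) S' := fun m => hk.eventually (hTS' m)
    exact exists_limit_carries hn (l := lam 0) (σ := fun j => sσ (k + j) (T (k + j)))
      (ρ := fun j => sρ (k + j) (T (k + j))) (T := fun j => (T (k + j)).1) (S' := S')
      (q := fun j => q (k + j)) (fun j => hU (k + j) (T (k + j))) (fun j => hTnonunit (k + j))
      hC' hlim (hq.comp hk) (fun j => hσq (k + j)) (fun j => hρq (k + j))
  -- the limit is normalized
  have hdomT : ∀ j, (T j).1 ∈ supp (UpperSet.Ici (lam 0)) := fun j => (T j).2.1.1.mem_supp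
  have hS'1 : coeff (lam 0) S' = 1 := by
    obtain ⟨j, hj⟩ := (hTS' (lam 0)).exists
    rw [← hj, (T j).2.1.1.monic]
  have hS'd : IsDominantExponent S' (lam 0) :=
    isDominantExponent_iff.2 ⟨by rw [hS'1]; exact one_ne_zero, hTS'.mem_supp hdomT⟩
  have hstab : ∀ j, ConjStable n S (T j).1 := fun j => by
    induction j with
    | zero => rw [hT0]; exact fun ω ω' _ _ => ⟨id, fun _ => id⟩
    | succ j ih => rw [hT]; exact ih.trans (hconj j (T j))
  have hN' : IsFormalNormalized n lam S' :=
    hS.1.of_conjStable (ConjStable.of_tendsto hstab hTS') hS'd hS'1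
  refine ⟨S', ⟨hN', fun γ hγ hmem => ?_⟩, ?_⟩
  · obtain ⟨k, rfl⟩ := he.surjective γ
    obtain ⟨σ', ρ', -, -, hU', hC'⟩ := htail k
    have hne : e k ≠ lam 0 := fun h => hγ (by
      rw [h, map_sub, hS'1, coeff_monomial_same, sub_self])
    rw [map_sub, coeff_monomial_ne hne, sub_zero] at hγ
    refine hγ ?_
    rw [hS', hT]
    -- A forbidden exponent of the limit is already forbidden for `T k`, so step k made its
    -- coefficient zero and no later step changed it.
    exact helim k (T k) (formalEliminationSet_subset_of_carries hn hC' hU' (hTnonunit k)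
      hN'.isFormalQOParam.nonunit (eliminationSet_subset n (lam 0) S' hmem))
      (lt_of_le_of_ne (hS'd.2 _ hγ) hne.symm)
  · obtain ⟨σ', ρ', h1, h2, hU', hC'⟩ := htail 0
    simp_rw [zero_add] at h1 h2
    rw [hT0] at hC'
    refine ⟨fun j => sσ j (T j), fun j => sρ j (T j), fun j => (T j).1, σ', ρ', hT0, fun j => ?_,
      hTS', h1, h2, hU'.inFormalTildeA₁ hn, hC'⟩
    refine ⟨⟨(T j).2.1.1.isFormalQOParam, (T j).2.1.2⟩,
      ⟨(hU j (T j)).inFormalTildeA₁ hn, hσc j (T j), hρc j (T j)⟩, ?_⟩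
    beta_reduce
    rw [hT]
    exact hC j (T j)

end QuasiShort

end QuasiOrdinary

end

theorem mainTheorem3 {r n g : ℕ} [NeZero g] (lam : Fin g → Fin r →₀ ℕ)
    (S : QuasiOrdinary.Ser r) (hS : QuasiOrdinary.IsNormalized n lam S) :
    (∀ γ : Fin r →₀ ℕ, MvPowerSeries.coeff γ S ≠ 0 → lam 0 < γ →
      γ ∈ QuasiOrdinary.eliminationSet n (lam 0) S →
      QuasiOrdinary.IsEliminable n lam S γ) ∧
    (∃ S' : QuasiOrdinary.Ser r, QuasiOrdinary.IsFormalQuasiShort n lam S' ∧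
      QuasiOrdinary.FormallyEquivalent n lam S S') :=
  ⟨fun _ _ hγ h => QuasiOrdinary.isEliminable_of_mem hS hγ h, QuasiOrdinary.exists_quasiShort hS⟩
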